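/- **Setting.** Let $F_v$ be $\mathbb R$, $\mathbb C$ or a nonarchimedean local field (this covers every completion of a number field), with normalised absolute value $|\cdot|_v$ (so $|z|_v=z\bar z$ on $\mathbb C$, and $|\varpi|_v=1/q$ for a uniformizer $\varpi$ and residue field of $q$ elements). Let $\psi_v(x)=e^{2\pi i x}$ on $\mathbb R$, $\psi_v(x)=e^{4\pi i\,\mathrm{Re}(x)}$ on $\mathbb C$, and in the nonarchimedean case let $\psi_v$ be any nontrivial continuous unitary additive character, $e$ being the largest integer with $\psi_v$ trivial on $\varpi^{-e}\mathcal O_v$. Let $dx$ be the self-dual measure (Lebesgue on $\mathbb R$, twice Lebesgue on $\mathbb C$, $\mathrm{vol}(\mathcal O_v)=q^{-e/2}$ otherwise), $d^\times x=dx/|x|_v$ and $\widehat f(y)=\int f(x)\psi_v(xy)\,dx$. Let $\mathcal S(F_v)$ be the space of Schwartz functions (locally constant of compact support if $v$ is nonarchimedean) and $\mathcal S(F_v^\times)$ the space of restrictions of its elements to $F_v^\times$. For $s\in\mathbb C$ let $\mathcal S_\rho(F_v^\times)=\mathcal S(F_v^\times)+|x|_v^{1-2s}\mathcal S(F_v^\times)$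 if $s\ne 1/2$, and $\mathcal S_\rho(F_v^\times)=\mathcal S(F_v^\times)+\log|x|_v\,\mathcal S(F_v^\times)$ if $s=1/2$. The Hankel transform $\mathcal H_s\phi\in L^2(F_v)$ is the Fourier transform (in $L^2$, equivalently as a tempered distribution) of $x\mapsto |x|_v^{2s-2}\widehat\phi(1/x)$; it is defined when this function lies in $L^2(F_v)$. For a continuous unitary character $\chi$ of $F_v^\times$ put $\gamma_v(s,\chi)=\epsilon(s,\chi)L_v(1-s,\chi^{-1})/L_v(s,\chi)$ with the usual local factors with respect to $\psi_v$ and $dx$: * $F_v=\mathbb R$, $\chi(x)=\mathrm{sgn}(x)^a|x|^{it}$ with $a\in\{0,1\}$: $L_v(s,\chi)=\pi^{-(s+it+a)/2}\,\Gamma(\tfrac{s+it+a}2)$ and $\epsilon=i^a$. * $F_v=\mathbb C$, $\chi(z)=(z/\sqrt{z\bar z})^n(z\bar z)^{it}$ with $n\in\mathbb Z$: $L_v(s,\chi)=(2\pi)^{1-s'}\Gamma(s')$ with $s'=s+it+|n|/2$, and $\epsilon=i^{|n|}$. * $F_v$ nonarchimedean, $\chi$ unramified: $L_v(s,\chi)=(1-\chi(\varpi)q^{-s})^{-1}$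 and $\epsilon(s,\chi)=\chi(\varpi)^e q^{e(1/2-s)}$. * $F_v$ nonarchimedean, $\chi$ ramified of conductor exponent $c$: $L_v(s,\chi)=1$ and $\epsilon(s,\chi)=\int_{\varpi^{-(e+c)}\mathcal O_v^\times}\chi^{-1}(x)|x|_v^{-s}\psi_v(x)\,dx$. The Mellin transform $\mathcal M(f)(\chi,w)$ is $\int_{F_v^\times}f(x)\chi(x)|x|_v^{w}\,d^\times x$ for $\mathrm{Re}(w)>0$, and the meromorphic continuation of this integral in $w$ elsewhere. **Proposition.** Suppose $\mathrm{Re}(s)\le 1/2$. (a) Let $\phi\in\mathcal S_\rho(F_v^\times)$. Then $\mathcal H_s\phi$ is defined. For every continuous unitary character $\chi$ of $F_v^\times$, the integral defining $\mathcal M(\mathcal H_s\phi)(\chi,\mu)$ converges absolutely for $0<\mathrm{Re}(\mu)<1/2$ and continues meromorphically to the strip $2\mathrm{Re}(s)-1<\mathrm{Re}(\mu)<1/2$. The integral defining $\mathcal M(\phi)(\chi^{-1},w)$ converges absolutely at those $w$ of the strip $2\mathrm{Re}(s)-1/2<\mathrm{Re}(w)<1$ with $\mathrm{Re}(w)>0$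 and continues meromorphically to that strip. For $2\mathrm{Re}(s)-1<\mathrm{Re}(\mu)<1/2$, $$\mathcal M(\mathcal H_s\phi)(\chi,\mu)=\gamma_v(1-\mu,\chi^{-1})\,\gamma_v(2s-\mu,\chi^{-1})\,\mathcal M(\phi)(\chi^{-1},2s-\mu),$$ as an identity of meromorphic functions of $\mu$ on this strip, and pointwise at every $\mu$ at which neither $\gamma_v(1-\mu,\chi^{-1})$ nor $\mathcal M(\phi)(\chi^{-1},2s-\mu)$ has a pole. (b) Let $F_v=\mathbb R$ and let $\phi$ be in the larger space obtained by replacing $\mathcal S(\mathbb R^\times)$, in the definition of $\mathcal S_\rho(\mathbb R^\times)$, by the space of functions which agree with one Schwartz function on $x>0$ and with another one on $x<0$. Then $\mathcal H_s\phi$ is defined if $\mathrm{Re}(s)>1/4$; and whenever $\mathcal H_s\phi$ is defined, all the assertions of (a) on Mellin transforms hold for $\phi$. -/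

import Mathlib

open MeasureTheory Filter Topology
open scoped NormedField Valued SchwartzMap

noncomputable section

namespace HankelGL1

/-- The data attached to a local field `K` that enter the statement: normalised absolute value,
additive character, additive Haar measure, space of Schwartz(-Bruhat) functions, and the local
`L`- and `ε`-factors of unitary characters of `Kˣ`.  This is only a record: it is used below for
the three explicit values `realData`, `complexData` and `nonarchData`. -/
structure LocalFieldData (K : Type*) [Field K] [TopologicalSpace K] [MeasurableSpace K] where
  abs : K → ℝ
  psi : K → ℂ
  vol : Measure K
  schwartz : Set (K → ℂ)
  LFactor : ℂ → (Kˣ →ₜ* Circle) → ℂ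
  epsilon : ℂ → (Kˣ →ₜ* Circle) → ℂ

section general

open Classical in
/-- A unitary character of `Kˣ`, viewed as a function on `K` vanishing at `0`. -/
def charExt {K : Type*} [Field K] [TopologicalSpace K] (χ : Kˣ →ₜ* Circle) (x : K) : ℂ :=
  if hx : x = 0 then 0 else ((χ (Units.mk0 x hx) : Circle) : ℂ)

variable {K : Type*} [Field K] [TopologicalSpace K] [MeasurableSpace K] (D : LocalFieldData K)

/-- `γ(s, χ) = ε(s, χ) L(1 - s, χ⁻¹) / L(s, χ)`. -/
def LocalFieldData.gamma (s : ℂ) (χ : Kˣ →ₜ* Circle) : ℂ :=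
  D.epsilon s χ * D.LFactor (1 - s) χ⁻¹ / D.LFactor s χ

/-- The Fourier transform `f̂(y) = ∫ f(x) ψ(x y) dx`. -/
def LocalFieldData.fourier (f : K → ℂ) (y : K) : ℂ :=
  ∫ x, f x * D.psi (x * y) ∂D.vol

/-- `S(Kˣ)`: restrictions to `Kˣ` of Schwartz functions on `K`.  Functions on `Kˣ` are represented
by functions on `K` whose value at `0` is arbitrary. -/
def LocalFieldData.schwartzUnits : Set (K → ℂ) :=
  {f | ∃ g ∈ D.schwartz, ∀ x, x ≠ 0 → f x = g x}

open Classical in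
/-- `T + |x|^{1-2s} T` if `1 - 2s ≠ 0`, and `T + log|x| T` if `1 - 2s = 0`, for a space `T` of
functions on `Kˣ`. -/
def LocalFieldData.rhoSpace (T : Set (K → ℂ)) (s : ℂ) : Set (K → ℂ) :=
  {φ | ∃ f₁ ∈ T, ∃ f₂ ∈ T, ∀ x, x ≠ 0 →
    φ x = f₁ x +
      (if 1 - 2 * s ≠ 0 then (D.abs x : ℂ) ^ (1 - 2 * s) else (Real.log (D.abs x) : ℂ)) * f₂ x}

/-- The `ρ`-Schwartz space `S_ρ(Kˣ)` (with parameter `s`). -/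
def LocalFieldData.schwartzRho (s : ℂ) : Set (K → ℂ) :=
  D.rhoSpace D.schwartzUnits s

/-- The function `x ↦ |x|^{2s-2} φ̂(1/x)`. -/
def LocalFieldData.hankelSymbol (s : ℂ) (φ : K → ℂ) (x : K) : ℂ :=
  (D.abs x : ℂ) ^ (2 * s - 2) * D.fourier φ x⁻¹

/-- `h = H_s φ`: the function `g(x) = |x|^{2s-2} φ̂(1/x)` is square integrable and `h ∈ L²` is its
Fourier transform, i.e. `∫ h f = ∫ g f̂` for all Schwartz functions `f`.  Such an `h` is unique up
to a null set. -/
def LocalFieldData.IsHankelTransform (s : ℂ) (φ h : K → ℂ) : Prop :=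
  MemLp (D.hankelSymbol s φ) 2 D.vol ∧ MemLp h 2 D.vol ∧
    ∀ f ∈ D.schwartz, ∫ x, h x * f x ∂D.vol = ∫ x, D.hankelSymbol s φ x * D.fourier f x ∂D.vol

/-- The integrand of `∫_{Kˣ} f(x) χ(x) |x|^w d^×x`, where `d^×x = dx / |x|`. -/
def LocalFieldData.mellinIntegrand (f : K → ℂ) (χ : Kˣ →ₜ* Circle) (w : ℂ) (x : K) : ℂ :=
  f x * charExt χ x * (D.abs x : ℂ) ^ (w - 1)

/-- `A` is the Mellin transform `w ↦ M(f)(χ, w)` on the vertical strip `U` (which meets the half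
plane `Re w > 0`): on `Re w > 0` it is the absolutely convergent integral
`∫_{Kˣ} f(x) χ(x) |x|^w d^×x`, and on all of `U` it is the meromorphic continuation of that
integral (with value `0` at the poles). -/
def LocalFieldData.IsMellinTransform (f : K → ℂ) (χ : Kˣ →ₜ* Circle) (U : Set ℂ) (A : ℂ → ℂ) :
    Prop :=
  MeromorphicNFOn A U ∧
    ∀ w ∈ U, 0 < w.re → Integrable (D.mellinIntegrand f χ w) D.vol ∧
      A w = ∫ x, D.mellinIntegrand f χ w x ∂D.vol

/-- The strip `2 Re(s) - 1 < Re(μ) < 1/2`. -/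
def strip (s : ℂ) : Set ℂ := {μ | 2 * s.re - 1 < μ.re ∧ μ.re < 1 / 2}

/-- `M(h)(χ, μ) = γ(1 - μ, χ⁻¹) γ(2s - μ, χ⁻¹) M(φ)(χ⁻¹, 2s - μ)` on the strip
`2 Re(s) - 1 < Re(μ) < 1/2`: as an identity of meromorphic functions, and pointwise at every `μ`
for which neither `γ(·, χ⁻¹)` has a pole at `1 - μ` nor `M(φ)(χ⁻¹, ·)` has a pole at `2s - μ`. -/
def LocalFieldData.MellinIdentity (s : ℂ) (φ : K → ℂ) (χ : Kˣ →ₜ* Circle) (h : K → ℂ) : Prop :=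
  ∃ A B : ℂ → ℂ,
    D.IsMellinTransform h χ (strip s) A ∧
    D.IsMellinTransform φ χ⁻¹ {w | 2 * s - w ∈ strip s} B ∧
    (∀ μ₀ ∈ strip s, ∀ᶠ μ in 𝓝[≠] μ₀,
      A μ = D.gamma (1 - μ) χ⁻¹ * D.gamma (2 * s - μ) χ⁻¹ * B (2 * s - μ)) ∧
    (∀ μ ∈ strip s, AnalyticAt ℂ (fun z => D.gamma z χ⁻¹) (1 - μ) → AnalyticAt ℂ B (2 * s - μ) →
      A μ = D.gamma (1 - μ) χ⁻¹ * D.gamma (2 * s - μ) χ⁻¹ * B (2 * s - μ))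

end general

section real

open Classical in
/-- The `a ∈ {0, 1}` with `χ(x) = sgn(x)^a |x|^{it}`. -/
def realParity (χ : ℝˣ →ₜ* Circle) : ℕ := if χ (-1) = 1 then 0 else 1

/-- The `t ∈ ℝ` with `χ(x) = sgn(x)^a |x|^{it}`. -/
def realExponent (χ : ℝˣ →ₜ* Circle) : ℝ :=
  Classical.epsilon fun t : ℝ =>
    ∀ x : ℝˣ, 0 < (x : ℝ) → ((χ x : Circle) : ℂ) = ((x : ℝ) : ℂ) ^ ((t : ℂ) * Complex.I)

/-- `K = ℝ`, `ψ(x) = e^{2πix}`, Lebesgue measure. -/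
def realData : LocalFieldData ℝ where
  abs x := |x|
  psi x := Complex.exp (2 * Real.pi * Complex.I * x)
  vol := volume
  schwartz := {f | ∃ g : 𝓢(ℝ, ℂ), f = g}
  LFactor s χ := Complex.Gammaℝ (s + realExponent χ * Complex.I + realParity χ)
  epsilon _ χ := Complex.I ^ realParity χ

/-- Functions on `ℝˣ` that agree with one Schwartz function of `ℝ` on `x > 0` and with another
one on `x < 0`. -/
def realTwoSidedSchwartz : Set (ℝ → ℂ) :=
  {f | ∃ g₁ g₂ : 𝓢(ℝ, ℂ), (∀ x, 0 < x → f x = g₁ x) ∧ (∀ x, x < 0 → f x = g₂ x)}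

end real

section complex

/-- The `(n, t) ∈ ℤ × ℝ` with `χ(z) = (z/‖z‖)^n ‖z‖^{2it}`. -/
def complexParams (χ : ℂˣ →ₜ* Circle) : ℤ × ℝ :=
  Classical.epsilon fun p : ℤ × ℝ =>
    ∀ z : ℂˣ, ((χ z : Circle) : ℂ) =
      ((z : ℂ) / (‖(z : ℂ)‖ : ℂ)) ^ p.1 * ((‖(z : ℂ)‖ ^ 2 : ℝ) : ℂ) ^ ((p.2 : ℂ) * Complex.I)

/-- `ζ_ℂ(s) = (2π)^{1-s} Γ(s)`. -/
def zetaC (s : ℂ) : ℂ := (2 * Real.pi : ℂ) ^ (1 - s) * Complex.Gamma s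

/-- `K = ℂ`, `|z| = z z̄`, `ψ(z) = e^{4πi Re z}`, twice the Lebesgue measure. -/
def complexData : LocalFieldData ℂ where
  abs z := ‖z‖ ^ 2
  psi z := Complex.exp (4 * Real.pi * Complex.I * z.re)
  vol := (2 : ENNReal) • volume
  schwartz := {f | ∃ g : 𝓢(ℂ, ℂ), f = g}
  LFactor s χ :=
    zetaC (s + (complexParams χ).2 * Complex.I + ((complexParams χ).1.natAbs : ℂ) / 2)
  epsilon _ χ := Complex.I ^ (complexParams χ).1.natAbs

end complex

section nonarch

variable {K : Type*} [NontriviallyNormedField K] [IsUltrametricDist K]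

variable (K) in
/-- The cardinality of the residue field. -/
def resCard : ℕ := Nat.card 𝓀[K]

/-- `ϖ` is a uniformizer and the absolute value is normalised by `|ϖ| = 1/q`. -/
def IsNormalizedUniformizer (ϖ : Kˣ) : Prop :=
  ‖(ϖ : K)‖ = (resCard K : ℝ)⁻¹ ∧ ∀ x : K, ‖x‖ < 1 → ‖x‖ ≤ ‖(ϖ : K)‖

/-- The largest `e` such that `ψ` is trivial on `ϖ^{-e} O = {|x| ≤ q^e}`. -/
def addConductor (ψ : AddChar K Circle) : ℤ :=
  sSup {n : ℤ | ∀ x : K, ‖x‖ ≤ (resCard K : ℝ) ^ n → ψ x = 1}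

/-- The conductor exponent of `χ`: the least `n ≥ 0` such that `χ` is trivial on the units
congruent to `1` modulo `ϖ^n` (so it is `0` exactly when `χ` is unramified). -/
def mulConductor (χ : Kˣ →ₜ* Circle) : ℕ :=
  sInf {n : ℕ | ∀ u : Kˣ, ‖(u : K)‖ = 1 → ‖(u : K) - 1‖ ≤ (resCard K : ℝ) ^ (-(n : ℤ)) → χ u = 1}

/-- A nonarchimedean local field with its normalised absolute value, uniformizer `ϖ`, nontrivial
additive character `ψ` and Haar measure `μ`.  With `e` the conductor exponent of `ψ` and `c` that
of `χ`: `L(s, χ) = (1 - χ(ϖ) q^{-s})⁻¹` and `ε(s, χ) = χ(ϖ)^e q^{e(1/2-s)}` if `c = 0`;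
`L(s, χ) = 1` and `ε(s, χ) = ∫_{ϖ^{-(e+c)} O^×} χ⁻¹(x) |x|^{-s} ψ(x) dx` if `c > 0`. -/
def nonarchData [MeasurableSpace K] (ϖ : Kˣ) (ψ : AddChar K Circle) (μ : Measure K) :
    LocalFieldData K where
  abs x := ‖x‖
  psi x := ((ψ x : Circle) : ℂ)
  vol := μ
  schwartz := {f | IsLocallyConstant f ∧ HasCompactSupport f}
  LFactor s χ :=
    if mulConductor χ = 0 then (1 - ((χ ϖ : Circle) : ℂ) * (resCard K : ℂ) ^ (-s))⁻¹ else 1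
  epsilon s χ :=
    if mulConductor χ = 0 then
      ((χ ϖ : Circle) : ℂ) ^ addConductor ψ *
        (resCard K : ℂ) ^ ((addConductor ψ : ℂ) * (1 / 2 - s))
    else
      ∫ x in {x : K | ‖x‖ = (resCard K : ℝ) ^ (addConductor ψ + (mulConductor χ : ℤ))},
        charExt χ⁻¹ x * (‖x‖ : ℂ) ^ (-s) * ((ψ x : Circle) : ℂ) ∂μ

end nonarch

end HankelGL1

end

noncomputable section

namespace HankelGL1

set_option linter.unusedSectionVars false


/-! ### Unitary characters as functions on the field -/

section charExt

variable {K : Type*} [NontriviallyNormedField K]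

/-! The identity is Tate's local functional equation, used twice. Let `u` be the Fourier transform
of `v` in the sense of distributions, and suppose that for some `w` with `0 < Re w < 1` the Mellin
integrals of `u` at `(χ⁻¹, 1 - w)` and of `v` at `(χ, w)` converge absolutely. Testing against the
dilates of a Schwartz function `f` and integrating over the dilation parameter gives, by Fubini,
`M(u) M(f) = M(v) M(f̂)`. Hence one `f` with `M(f) ≠ 0` and `M(f̂) = γ M(f)` yields `M(u)(χ⁻¹, 1 -
w) = γ(w, χ) M(v)(χ, w)` for all such pairs (`mellin_eq_gamma_mul`). A place therefore only has to
supply one test function per character, together with Fourier inversion on its Schwartz space and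
elementary properties of `γ`; this is the content of `IsTate`. The test functions are polynomials
times Gaussians at the archimedean places and indicators of `O` or `1 + ϖ^c O` at the others.

Put `F = φ̂` and `g(x) = |x|^{2s-2} F(1/x)`, and let `h` be the Fourier transform of `g`. Inversion
`x ↦ 1/x` turns the Mellin transform of `g` at `(χ⁻¹, 1 - μ)` into `G(μ) = M(F)(χ, 1 - 2s + μ)`. The
pair `(h, g)` gives `M(h)(χ, μ) = γ(1 - μ, χ⁻¹) G(μ)`, the pair `(F, φ)` gives `G(μ) = γ(2s - μ,
χ⁻¹) M(φ)(χ⁻¹, 2s - μ)`. The pivot is that `G` is holomorphic on the whole strip: `F` is bounded,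
which settles convergence near `0` and produces the left edge; `g ∈ L²` means that `|F|² |y|^{3 - 4
Re s}` is integrable for `dy/|y|`, which settles convergence at infinity and produces the right
edge. Both continuations are then read off from `G`, and the identity extends to the strip
(`mellinIdentity`).

The delicate point is absolute convergence of `M(h)` for all small `Re μ > 0`, since near `0` square
integrability of `h` only reaches `Re μ > 1/2`. Because `Re s ≤ 1/2`, one has `g = O(1/|x|)` at
infinity. Cutting `g` at `|x| = R`, the inner part has `L¹` norm `O(R^ε)`, hence a Fourier transform
of that size, and the outer part is small in `L²`. So the integral of `|h|` over `|x| ≤ 1/R` is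
`O(R^{ε-1})`, and summation over shells gives convergence (`integrableOn_ball_of_fourier`).

For the existence of `H_s φ` one needs `g ∈ L²`. If `Re s = 1/2` this is Plancherel for `φ`. If `Re
s < 1/2` it follows from the decay `O(|y|^{-1 - Re β})` of the Fourier transform of `|x|^β f`,
obtained by translating the function by an amount comparable to `1/y`: once at a nonarchimedean
place, where a difference vanishes off a small ball, and `k` times at an archimedean one
(`fourier_symbol_le`). -/

lemma charExt_zero (χ : Kˣ →ₜ* Circle) : charExt χ 0 = 0 := by simp [charExt]

lemma charExt_of_ne (χ : Kˣ →ₜ* Circle) {x : K} (hx : x ≠ 0) :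
    charExt χ x = ((χ (Units.mk0 x hx) : Circle) : ℂ) := by simp [charExt, hx]

lemma charExt_unit (χ : Kˣ →ₜ* Circle) (u : Kˣ) : charExt χ (u : K) = ((χ u : Circle) : ℂ) := by
  rw [charExt_of_ne χ u.ne_zero, Units.mk0_val]

lemma norm_charExt (χ : Kˣ →ₜ* Circle) {x : K} (hx : x ≠ 0) : ‖charExt χ x‖ = 1 := by
  rw [charExt_of_ne χ hx, Circle.norm_coe]

lemma charExt_mul (χ : Kˣ →ₜ* Circle) (x y : K) :
    charExt χ (x * y) = charExt χ x * charExt χ y := by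
  rcases eq_or_ne x 0 with rfl | hx
  · simp [charExt_zero]
  rcases eq_or_ne y 0 with rfl | hy
  · simp [charExt_zero]
  rw [charExt_of_ne χ hx, charExt_of_ne χ hy, charExt_of_ne χ (mul_ne_zero hx hy),
    Units.mk0_mul, map_mul, Circle.coe_mul]

lemma charExt_inv_char (χ : Kˣ →ₜ* Circle) (x : K) : charExt χ⁻¹ x = (charExt χ x)⁻¹ := by
  rcases eq_or_ne x 0 with rfl | hx
  · simp [charExt_zero]
  rw [charExt_of_ne _ hx, charExt_of_ne _ hx, ← Circle.coe_inv]
  rfl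

lemma charExt_inv (χ : Kˣ →ₜ* Circle) (x : K) : charExt χ x⁻¹ = (charExt χ x)⁻¹ := by
  rcases eq_or_ne x 0 with rfl | hx
  · simp [charExt_zero]
  have h := charExt_mul χ x x⁻¹
  have h1 : charExt χ (1 : K) = 1 := by
    have := charExt_unit χ (1 : Kˣ)
    simpa using this
  rw [mul_inv_cancel₀ hx, h1] at h
  exact eq_inv_of_mul_eq_one_right h.symm

lemma continuousOn_charExt (χ : Kˣ →ₜ* Circle) : ContinuousOn (charExt χ) {0}ᶜ := by
  rw [continuousOn_iff_continuous_domRestrict]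
  have h : Continuous fun x : {x : K // x ≠ 0} =>
      ((χ ((unitsHomeomorphNeZero (G₀ := K)).symm x) : Circle) : ℂ) :=
    continuous_subtype_val.comp ((map_continuous χ).comp
      (unitsHomeomorphNeZero (G₀ := K)).symm.continuous)
  refine h.congr ?_
  rintro ⟨x, hx⟩
  have hu : (unitsHomeomorphNeZero (G₀ := K)).symm ⟨x, hx⟩ = Units.mk0 x hx := by
    rw [Homeomorph.symm_apply_eq]
    rfl
  have := charExt_of_ne χ (x := x) hx
  rw [← hu] at this
  exact this.symm

lemma measurable_charExt [MeasurableSpace K] [BorelSpace K] (χ : Kˣ →ₜ* Circle) : Measurable (charExt χ) :=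
  measurable_of_continuousOn_compl_singleton 0 (continuousOn_charExt χ)

end charExt

/-! ### Haar measure `dx / |x|` and its invariance -/

section framework

variable {K : Type*} [NontriviallyNormedField K] [MeasurableSpace K]
  {D : LocalFieldData K} {d : ℕ}

/-- The absolute value of `D` is `‖x‖ ^ d`, it is the module of the Haar measure of `D`, and the
additive character of `D` is continuous and unitary. -/
structure LocalFieldData.IsLocal (D : LocalFieldData K) (d : ℕ) : Prop where
  pos : 0 < d
  abs_eq : ∀ x, D.abs x = ‖x‖ ^ d
  haar : D.vol.IsAddHaarMeasure
  map_mul : ∀ a : K, a ≠ 0 → ENNReal.ofReal (D.abs a) • D.vol.map (a * ·) = D.vol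
  psi_continuous : Continuous D.psi
  psi_add : ∀ x y, D.psi (x + y) = D.psi x * D.psi y
  psi_norm : ∀ x, ‖D.psi x‖ = 1

/-- The multiplicative Haar measure `dx / |x|`. -/
def LocalFieldData.mulHaar (D : LocalFieldData K) : Measure K :=
  D.vol.withDensity fun x => ENNReal.ofReal (D.abs x)⁻¹

/-- The quasi-character `χ(x) |x|^w`, extended by `0` to `x = 0`. -/
def LocalFieldData.quasi (D : LocalFieldData K) (χ : Kˣ →ₜ* Circle) (w : ℂ) (x : K) : ℂ :=
  charExt χ x * (D.abs x : ℂ) ^ w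

namespace LocalFieldData.IsLocal

variable (hD : D.IsLocal d)
include hD

lemma abs_mul (x y : K) : D.abs (x * y) = D.abs x * D.abs y := by
  simp [hD.abs_eq, mul_pow]

lemma abs_inv (x : K) : D.abs x⁻¹ = (D.abs x)⁻¹ := by
  simp [hD.abs_eq]

lemma abs_zero : D.abs 0 = 0 := by
  simp [hD.abs_eq, hD.pos.ne']

lemma abs_one : D.abs 1 = 1 := by
  simp [hD.abs_eq]

lemma abs_zpow (x : K) (n : ℤ) : D.abs (x ^ n) = D.abs x ^ n := by
  simp only [hD.abs_eq, norm_zpow]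
  rw [← zpow_natCast, ← zpow_natCast, ← zpow_mul, ← zpow_mul, mul_comm]

lemma abs_nonneg (x : K) : 0 ≤ D.abs x := by
  rw [hD.abs_eq]; positivity

lemma abs_pos {x : K} (hx : x ≠ 0) : 0 < D.abs x := by
  rw [hD.abs_eq]; positivity

lemma one_le_abs_iff (x : K) : 1 ≤ D.abs x ↔ 1 ≤ ‖x‖ := by
  rw [hD.abs_eq, one_le_pow_iff_of_nonneg (norm_nonneg x) hD.pos.ne']

lemma continuous_abs : Continuous D.abs := by
  rw [show D.abs = fun x => ‖x‖ ^ d from funext hD.abs_eq]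
  fun_prop

lemma psi_zero : D.psi 0 = 1 := by
  have h := hD.psi_add 0 0
  have h0 : D.psi 0 ≠ 0 := by
    intro h; have := hD.psi_norm 0; simp [h] at this
  rw [add_zero] at h
  exact (mul_eq_left₀ h0).1 h.symm

lemma psi_neg (x : K) : D.psi (-x) = (starRingEnd ℂ) (D.psi x) := by
  have h := hD.psi_add x (-x)
  rw [add_neg_cancel, hD.psi_zero] at h
  have h1 : D.psi x * (starRingEnd ℂ) (D.psi x) = 1 := by
    rw [Complex.mul_conj, Complex.normSq_eq_norm_sq, hD.psi_norm]; simp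
  have h0 : D.psi x ≠ 0 := by
    intro h; have := hD.psi_norm x; simp [h] at this
  exact mul_left_cancel₀ h0 (h.symm.trans h1.symm)

lemma exists_one_lt_abs : ∃ t : K, t ≠ 0 ∧ 1 < ‖t‖ ∧ 1 < D.abs t := by
  obtain ⟨t, ht⟩ := NormedField.exists_one_lt_norm K
  refine ⟨t, norm_pos_iff.1 (one_pos.trans ht), ht, ?_⟩
  rw [hD.abs_eq]
  exact one_lt_pow₀ ht hD.pos.ne'

variable [BorelSpace K]

lemma measurable_abs : Measurable D.abs := hD.continuous_abs.measurable

lemma measurable_psi : Measurable D.psi := hD.psi_continuous.measurable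

lemma measurable_quasi (χ : Kˣ →ₜ* Circle) (w : ℂ) : Measurable (D.quasi χ w) := by
  have := hD.measurable_abs
  have h1 := measurable_charExt χ
  have h2 : Measurable fun x => (D.abs x : ℂ) ^ w := by fun_prop
  exact h1.mul h2

omit [BorelSpace K] in
lemma quasi_zero (χ : Kˣ →ₜ* Circle) (w : ℂ) : D.quasi χ w 0 = 0 := by
  simp [quasi, charExt_zero]

omit [BorelSpace K] in
lemma norm_quasi (χ : Kˣ →ₜ* Circle) (w : ℂ) {x : K} (hx : x ≠ 0) :
    ‖D.quasi χ w x‖ = D.abs x ^ w.re := by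
  rw [quasi, norm_mul, norm_charExt χ hx, one_mul, Complex.norm_cpow_eq_rpow_re_of_pos
    (hD.abs_pos hx)]

omit [BorelSpace K] in
lemma quasi_mul (χ : Kˣ →ₜ* Circle) (w : ℂ) (x y : K) :
    D.quasi χ w (x * y) = D.quasi χ w x * D.quasi χ w y := by
  simp only [quasi, charExt_mul, hD.abs_mul, Complex.ofReal_mul,
    Complex.mul_cpow_ofReal_nonneg (hD.abs_nonneg x) (hD.abs_nonneg y)]
  ring

omit [BorelSpace K] in
lemma quasi_inv_char (χ : Kˣ →ₜ* Circle) (w : ℂ) (x : K) :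
    D.quasi χ⁻¹ (-w) x = (D.quasi χ w x)⁻¹ := by
  rw [quasi, quasi, charExt_inv_char, Complex.cpow_neg, mul_inv]

omit [BorelSpace K] in
lemma quasi_inv (χ : Kˣ →ₜ* Circle) (w : ℂ) (x : K) :
    D.quasi χ w x⁻¹ = D.quasi χ⁻¹ (-w) x := by
  rw [hD.quasi_inv_char, quasi, quasi, charExt_inv, mul_inv, hD.abs_inv]
  congr 1
  push_cast
  rw [Complex.inv_cpow]
  rw [Complex.arg_ofReal_of_nonneg (hD.abs_nonneg x)]
  exact Real.pi_pos.ne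

omit [BorelSpace K] in
lemma quasi_add (χ : Kˣ →ₜ* Circle) (w z : ℂ) (x : K) :
    D.quasi χ (w + z) x = D.quasi χ w x * (D.abs x : ℂ) ^ z := by
  rcases eq_or_ne x 0 with rfl | hx
  · simp [hD.quasi_zero]
  · rw [quasi, quasi, Complex.cpow_add _ _ (by exact_mod_cast (hD.abs_pos hx).ne'), mul_assoc]

omit [BorelSpace K] in
lemma quasi_ne_zero (χ : Kˣ →ₜ* Circle) (w : ℂ) {x : K} (hx : x ≠ 0) : D.quasi χ w x ≠ 0 := by
  rw [← norm_ne_zero_iff, hD.norm_quasi χ w hx]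
  exact (Real.rpow_pos_of_pos (hD.abs_pos hx) _).ne'

/-- Multiplication by `t` fixes `{0}` but scales its finite mass by `|t| > 1`. -/
lemma vol_singleton : D.vol {(0 : K)} = 0 := by
  have := hD.haar
  obtain ⟨t, ht0, -, ht⟩ := hD.exists_one_lt_abs
  have h := congrArg (fun μ : Measure K => μ {0}) (hD.map_mul t ht0)
  simp only [Measure.smul_apply, smul_eq_mul] at h
  rw [Measure.map_apply (by fun_prop) (measurableSet_singleton 0)] at h
  have hp : (t * ·) ⁻¹' {(0 : K)} = {0} := by
    ext x; simp [ht0]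
  rw [hp] at h
  by_contra h0
  have hfin : D.vol {(0 : K)} ≠ ⊤ := (isCompact_singleton.measure_lt_top).ne
  have h1 := congrArg ENNReal.toReal h
  rw [ENNReal.toReal_mul, ENNReal.toReal_ofReal (hD.abs_nonneg t)] at h1
  have h2 : 0 < (D.vol {(0 : K)}).toReal := ENNReal.toReal_pos h0 hfin
  nlinarith

lemma ae_ne_zero : ∀ᵐ x ∂D.vol, x ≠ 0 := by
  have := hD.vol_singleton
  rw [ae_iff]
  simpa using this

lemma lintegral_mulHaar (F : K → ENNReal) :
    ∫⁻ x, F x ∂D.mulHaar = ∫⁻ x, ENNReal.ofReal (D.abs x)⁻¹ * F x ∂D.vol := by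
  have := hD.measurable_abs
  rw [mulHaar, lintegral_withDensity_eq_lintegral_mul_non_measurable _ (by fun_prop)
    (ae_of_all _ fun x => ENNReal.ofReal_lt_top)]
  rfl

lemma ae_mulHaar_ne_zero : ∀ᵐ x ∂D.mulHaar, x ≠ 0 :=
  (withDensity_absolutelyContinuous _ _).ae_le hD.ae_ne_zero

lemma vol_absolutelyContinuous : D.vol ≪ D.mulHaar := by
  have := hD.measurable_abs
  refine withDensity_absolutelyContinuous' (by fun_prop) ?_
  filter_upwards [hD.ae_ne_zero] with x hx
  have := hD.abs_pos hx
  simpa using this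

lemma integrable_mulHaar {E : Type*} [NormedAddCommGroup E] [NormedSpace ℝ E] (F : K → E) :
    Integrable F D.mulHaar ↔ Integrable (fun x => (D.abs x)⁻¹ • F x) D.vol := by
  have := hD.measurable_abs
  rw [mulHaar, integrable_withDensity_iff_integrable_smul' (by fun_prop)
    (ae_of_all _ fun x => ENNReal.ofReal_lt_top)]
  simp only [ENNReal.toReal_ofReal (inv_nonneg.2 (hD.abs_nonneg _))]

lemma integral_mulHaar {E : Type*} [NormedAddCommGroup E] [NormedSpace ℝ E] (F : K → E) :
    ∫ x, F x ∂D.mulHaar = ∫ x, (D.abs x)⁻¹ • F x ∂D.vol := by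
  have := hD.measurable_abs
  rw [mulHaar, integral_withDensity_eq_integral_toReal_smul (by fun_prop)
    (ae_of_all _ fun x => ENNReal.ofReal_lt_top)]
  simp only [ENNReal.toReal_ofReal (inv_nonneg.2 (hD.abs_nonneg _))]

lemma integrable_vol {E : Type*} [NormedAddCommGroup E] [NormedSpace ℝ E] (F : K → E) :
    Integrable F D.vol ↔ Integrable (fun x => D.abs x • F x) D.mulHaar := by
  rw [hD.integrable_mulHaar]
  refine integrable_congr ?_
  filter_upwards [hD.ae_ne_zero] with x hx
  rw [smul_smul, inv_mul_cancel₀ (hD.abs_pos hx).ne', one_smul]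

lemma integral_vol {E : Type*} [NormedAddCommGroup E] [NormedSpace ℝ E] (F : K → E) :
    ∫ x, F x ∂D.vol = ∫ x, D.abs x • F x ∂D.mulHaar := by
  rw [hD.integral_mulHaar]
  refine integral_congr_ae ?_
  filter_upwards [hD.ae_ne_zero] with x hx
  rw [smul_smul, inv_mul_cancel₀ (hD.abs_pos hx).ne', one_smul]

omit [BorelSpace K] in
lemma mellinIntegrand_eq (f : K → ℂ) (χ : Kˣ →ₜ* Circle) (w : ℂ) (x : K) :
    D.mellinIntegrand f χ w x = (D.abs x)⁻¹ • (f x * D.quasi χ w x) := by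
  rcases eq_or_ne x 0 with rfl | hx
  · simp [mellinIntegrand, quasi, charExt_zero]
  · have : (D.abs x : ℂ) ≠ 0 := by exact_mod_cast (hD.abs_pos hx).ne'
    rw [mellinIntegrand, quasi, Complex.cpow_sub _ _ this, Complex.cpow_one, Complex.real_smul]
    push_cast
    field_simp

lemma integrable_mellinIntegrand (f : K → ℂ) (χ : Kˣ →ₜ* Circle) (w : ℂ) :
    Integrable (D.mellinIntegrand f χ w) D.vol ↔
      Integrable (fun x => f x * D.quasi χ w x) D.mulHaar := by
  rw [hD.integrable_mulHaar]
  exact integrable_congr (ae_of_all _ (hD.mellinIntegrand_eq f χ w))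

lemma integral_mellinIntegrand (f : K → ℂ) (χ : Kˣ →ₜ* Circle) (w : ℂ) :
    ∫ x, D.mellinIntegrand f χ w x ∂D.vol = ∫ x, f x * D.quasi χ w x ∂D.mulHaar := by
  rw [hD.integral_mulHaar]
  exact integral_congr_ae (ae_of_all _ (hD.mellinIntegrand_eq f χ w))

lemma measurePreserving_mul {a : K} (ha : a ≠ 0) :
    MeasurePreserving (a * ·) D.mulHaar D.mulHaar := by
  have hm := hD.measurable_abs
  refine ⟨by fun_prop, ?_⟩
  refine Measure.ext_of_lintegral _ fun F hF => ?_
  rw [lintegral_map hF (by fun_prop), hD.lintegral_mulHaar, hD.lintegral_mulHaar]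
  conv_rhs => rw [← hD.map_mul a ha]
  rw [lintegral_smul_measure, lintegral_map (by fun_prop) (by fun_prop), smul_eq_mul,
    ← lintegral_const_mul _ (by fun_prop)]
  refine lintegral_congr fun x => ?_
  rw [← mul_assoc, ← ENNReal.ofReal_mul (hD.abs_nonneg a), hD.abs_mul]
  congr 2
  have := (hD.abs_pos ha).ne'
  field_simp

lemma lintegral_mul_left {a : K} (ha : a ≠ 0) (F : K → ENNReal) :
    ∫⁻ x, F (a * x) ∂D.mulHaar = ∫⁻ x, F x ∂D.mulHaar :=
  (hD.measurePreserving_mul ha).lintegral_comp_emb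
    (MeasurableEquiv.mulLeft₀ a ha).measurableEmbedding F

lemma integral_mul_left {E : Type*} [NormedAddCommGroup E] [NormedSpace ℝ E]
    {a : K} (ha : a ≠ 0) (F : K → E) :
    ∫ x, F (a * x) ∂D.mulHaar = ∫ x, F x ∂D.mulHaar :=
  (hD.measurePreserving_mul ha).integral_comp
    (MeasurableEquiv.mulLeft₀ a ha).measurableEmbedding F

lemma integrable_mul_left {E : Type*} [NormedAddCommGroup E] [NormedSpace ℝ E]
    {a : K} (ha : a ≠ 0) (F : K → E) :
    Integrable (fun x => F (a * x)) D.mulHaar ↔ Integrable F D.mulHaar :=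
  (hD.measurePreserving_mul ha).integrable_comp_emb
    (MeasurableEquiv.mulLeft₀ a ha).measurableEmbedding

variable [ProperSpace K]

lemma sigmaFinite_mulHaar : SigmaFinite D.mulHaar := by
  have := hD.haar
  have := hD.measurable_abs
  exact SigmaFinite.withDensity_of_ne_top' fun _ => ENNReal.ofReal_ne_top

lemma mulHaar_annulus_lt_top {r R : ℝ} (hr : 0 < r) :
    D.mulHaar {x | r ≤ ‖x‖ ∧ ‖x‖ ≤ R} < ⊤ := by
  have := hD.haar
  have hms : MeasurableSet {x : K | r ≤ ‖x‖ ∧ ‖x‖ ≤ R} :=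
    (measurableSet_le measurable_const measurable_norm).inter
      (measurableSet_le measurable_norm measurable_const)
  rw [mulHaar, withDensity_apply _ hms]
  calc ∫⁻ x in {x | r ≤ ‖x‖ ∧ ‖x‖ ≤ R}, ENNReal.ofReal (D.abs x)⁻¹ ∂D.vol
      ≤ ∫⁻ x in {x | r ≤ ‖x‖ ∧ ‖x‖ ≤ R}, ENNReal.ofReal (r ^ d)⁻¹ ∂D.vol := by
        refine setLIntegral_mono measurable_const fun x hx => ?_
        refine ENNReal.ofReal_le_ofReal ?_
        rw [hD.abs_eq]
        exact inv_anti₀ (by positivity) (pow_le_pow_left₀ hr.le hx.1 d)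
    _ = ENNReal.ofReal (r ^ d)⁻¹ * D.vol {x | r ≤ ‖x‖ ∧ ‖x‖ ≤ R} := by
        rw [setLIntegral_const]
    _ < ⊤ := by
        refine ENNReal.mul_lt_top ENNReal.ofReal_lt_top ?_
        refine lt_of_le_of_lt (measure_mono (t := Metric.closedBall 0 R) fun x hx => ?_)
          (isCompact_closedBall _ _).measure_lt_top
        simpa using hx.2

/-- The dilates of this annulus by powers of `t` all have its measure and cover everything but `0`,
so if it were null the Haar measure would vanish. -/
lemma mulHaar_annulus_pos {t : K} (ht : 1 < ‖t‖) :
    0 < D.mulHaar {x | 1 ≤ ‖x‖ ∧ ‖x‖ ≤ ‖t‖} := by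
  have := hD.haar
  rw [pos_iff_ne_zero]
  intro h
  have h2 : ∀ n : ℤ, D.mulHaar {x | ‖t‖ ^ n ≤ ‖x‖ ∧ ‖x‖ ≤ ‖t‖ ^ (n + 1)} = 0 := by
    intro n
    have ht0 : t ≠ 0 := norm_pos_iff.1 (one_pos.trans ht)
    have htn : t ^ (-n) ≠ 0 := zpow_ne_zero _ ht0
    have h3 := (hD.measurePreserving_mul htn).measure_preimage_emb
      (MeasurableEquiv.mulLeft₀ _ htn).measurableEmbedding {x | 1 ≤ ‖x‖ ∧ ‖x‖ ≤ ‖t‖}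
    rw [h] at h3
    convert h3 using 2
    ext x
    have hpos : 0 < ‖t‖ ^ n := by positivity
    simp only [Set.mem_ofPred_eq, Set.mem_preimage, norm_mul, norm_zpow]
    rw [zpow_neg, inv_mul_eq_div, le_div_iff₀ hpos, div_le_iff₀ hpos, one_mul,
      zpow_add_one₀ (norm_pos_iff.2 ht0).ne', mul_comm (‖t‖ ^ n)]
  have h3 : D.mulHaar (⋃ n : ℤ, {x | ‖t‖ ^ n ≤ ‖x‖ ∧ ‖x‖ ≤ ‖t‖ ^ (n + 1)}) = 0 :=
    measure_iUnion_null h2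
  have h4 : D.vol Set.univ = 0 := by
    have h5 : (Set.univ : Set K) ⊆
        {0} ∪ ⋃ n : ℤ, {x | ‖t‖ ^ n ≤ ‖x‖ ∧ ‖x‖ ≤ ‖t‖ ^ (n + 1)} := by
      intro x _
      rcases eq_or_ne x 0 with rfl | hx
      · simp
      · right
        obtain ⟨n, hn⟩ := exists_mem_Ico_zpow (norm_pos_iff.2 hx) ht
        exact Set.mem_iUnion.2 ⟨n, hn.1, hn.2.le⟩
    exact measure_mono_null h5 (measure_union_null hD.vol_singleton (hD.vol_absolutelyContinuous h3))
  exact NeZero.ne D.vol (Measure.measure_univ_eq_zero.1 h4)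

/-- The uniqueness argument for Haar measure: with `k` the indicator of an annulus `A` of finite
positive measure, evaluate the double integral of `k(xy) F(x⁻¹)` in both orders. Integrating first
in `y` gives `m(A) ∫ F(x⁻¹)`; replacing `x` by `x y⁻¹` first gives `m(A) ∫ F`. -/
lemma lintegral_inv (F : K → ENNReal) (hF : Measurable F) :
    ∫⁻ x, F x⁻¹ ∂D.mulHaar = ∫⁻ x, F x ∂D.mulHaar := by
  have := hD.sigmaFinite_mulHaar
  obtain ⟨t, ht0, ht, -⟩ := hD.exists_one_lt_abs
  set A : Set K := {x | 1 ≤ ‖x‖ ∧ ‖x‖ ≤ ‖t‖} with hA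
  have hms : MeasurableSet A :=
    (measurableSet_le measurable_const measurable_norm).inter
      (measurableSet_le measurable_norm measurable_const)
  set k : K → ENNReal := A.indicator 1 with hk
  have hkm : Measurable k := measurable_one.indicator hms
  have hkint : ∫⁻ x, k x ∂D.mulHaar = D.mulHaar A := lintegral_indicator_one hms
  have e1 : D.mulHaar A * ∫⁻ x, F x⁻¹ ∂D.mulHaar =
      ∫⁻ x, ∫⁻ y, k (x * y) * F x⁻¹ ∂D.mulHaar ∂D.mulHaar := by
    rw [← lintegral_const_mul _ (by fun_prop)]
    refine lintegral_congr_ae ?_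
    filter_upwards [hD.ae_mulHaar_ne_zero] with x hx
    rw [lintegral_mul_const _ (by fun_prop), hD.lintegral_mul_left hx k, hkint]
  have e2 : ∫⁻ x, ∫⁻ y, k (x * y) * F x⁻¹ ∂D.mulHaar ∂D.mulHaar =
      ∫⁻ y, ∫⁻ x, k (x * y) * F x⁻¹ ∂D.mulHaar ∂D.mulHaar :=
    lintegral_lintegral_swap (by fun_prop)
  have e3 : ∫⁻ y, ∫⁻ x, k (x * y) * F x⁻¹ ∂D.mulHaar ∂D.mulHaar =
      ∫⁻ y, ∫⁻ x, k x * F (x⁻¹ * y) ∂D.mulHaar ∂D.mulHaar := by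
    refine lintegral_congr_ae ?_
    filter_upwards [hD.ae_mulHaar_ne_zero] with y hy
    rw [← hD.lintegral_mul_left hy fun x => k x * F (x⁻¹ * y)]
    refine lintegral_congr fun x => ?_
    rw [mul_comm y x, mul_inv, mul_assoc, inv_mul_cancel₀ hy, mul_one]
  have e4 : ∫⁻ y, ∫⁻ x, k x * F (x⁻¹ * y) ∂D.mulHaar ∂D.mulHaar =
      ∫⁻ x, ∫⁻ y, k x * F (x⁻¹ * y) ∂D.mulHaar ∂D.mulHaar :=
    lintegral_lintegral_swap (by fun_prop)
  have e5 : ∫⁻ x, ∫⁻ y, k x * F (x⁻¹ * y) ∂D.mulHaar ∂D.mulHaar =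
      D.mulHaar A * ∫⁻ x, F x ∂D.mulHaar := by
    rw [← hkint, ← lintegral_mul_const _ hkm]
    refine lintegral_congr_ae ?_
    filter_upwards [hD.ae_mulHaar_ne_zero] with x hx
    rw [lintegral_const_mul _ (by fun_prop), hD.lintegral_mul_left (inv_ne_zero hx) F]
  have := e1.trans (e2.trans (e3.trans (e4.trans e5)))
  exact (ENNReal.mul_right_inj (hD.mulHaar_annulus_pos ht).ne'
    (hD.mulHaar_annulus_lt_top one_pos).ne).1 this

lemma measurePreserving_inv : MeasurePreserving (·⁻¹) D.mulHaar D.mulHaar := by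
  refine ⟨by fun_prop, ?_⟩
  refine Measure.ext_of_lintegral _ fun F hF => ?_
  rw [lintegral_map hF (by fun_prop), hD.lintegral_inv F hF]

lemma integral_inv {E : Type*} [NormedAddCommGroup E] [NormedSpace ℝ E] (F : K → E) :
    ∫ x, F x⁻¹ ∂D.mulHaar = ∫ x, F x ∂D.mulHaar :=
  hD.measurePreserving_inv.integral_comp (MeasurableEquiv.inv K).measurableEmbedding F

lemma integrable_inv {E : Type*} [NormedAddCommGroup E] [NormedSpace ℝ E] (F : K → E) :
    Integrable (fun x => F x⁻¹) D.mulHaar ↔ Integrable F D.mulHaar :=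
  hD.measurePreserving_inv.integrable_comp_emb (MeasurableEquiv.inv K).measurableEmbedding

end LocalFieldData.IsLocal

end framework


/-! ### Square integrable functions representing bounded functionals -/

section hilbert

variable {α : Type*} [MeasurableSpace α] {μ : Measure α}

lemma sq_eLpNorm_two {f : α → ℂ} (hf : MemLp f 2 μ) :
    (eLpNorm f 2 μ).toReal ^ 2 = ∫ x, ‖f x‖ ^ 2 ∂μ := by
  rw [hf.eLpNorm_eq_integral_rpow_norm two_ne_zero ENNReal.ofNat_ne_top]
  have h0 : 0 ≤ ∫ x, ‖f x‖ ^ 2 ∂μ := integral_nonneg fun x => by positivity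
  rw [ENNReal.toReal_ofReal (by positivity), ← Real.rpow_natCast, ← Real.rpow_mul (by positivity)]
  simp

lemma norm_integral_mul_le_two {f g : α → ℂ} (hf : MemLp f 2 μ) (hg : MemLp g 2 μ) :
    ‖∫ x, f x * g x ∂μ‖ ≤ (eLpNorm f 2 μ).toReal * (eLpNorm g 2 μ).toReal := by
  have h1 : eLpNorm (f • g) 1 μ ≤ eLpNorm f 2 μ * eLpNorm g 2 μ :=
    eLpNorm_smul_le_mul_eLpNorm hg.1 hf.1
  calc ‖∫ x, f x * g x ∂μ‖ ≤ (eLpNorm (f • g) 1 μ).toReal := by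
        rw [eLpNorm_one_eq_lintegral_enorm]
        refine (norm_integral_le_lintegral_norm _).trans (le_of_eq ?_)
        simp only [ofReal_norm, Pi.smul_apply', smul_eq_mul]
    _ ≤ (eLpNorm f 2 μ * eLpNorm g 2 μ).toReal :=
        ENNReal.toReal_mono (ENNReal.mul_ne_top hf.2.ne hg.2.ne) h1
    _ = _ := ENNReal.toReal_mul

/-- A linear functional on a space of square integrable functions which is bounded for the
`L²` norm is represented by a square integrable function. -/
lemma exists_memLp_two_of_bounded (S : Submodule ℂ (α → ℂ)) (hS : ∀ f ∈ S, MemLp f 2 μ)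
    (l : S →ₗ[ℂ] ℂ) {C : ℝ} (hC : 0 ≤ C)
    (hl : ∀ f : S, ‖l f‖ ≤ C * (eLpNorm (f : α → ℂ) 2 μ).toReal) :
    ∃ h : α → ℂ, MemLp h 2 μ ∧ (eLpNorm h 2 μ).toReal ≤ C ∧
      ∀ f : S, ∫ x, h x * (f : α → ℂ) x ∂μ = l f := by
  let T : S →ₗ[ℂ] Lp ℂ 2 μ :=
    { toFun := fun f => (hS f f.2).toLp f
      map_add' := fun f g => MemLp.toLp_add (hS f f.2) (hS g g.2)
      map_smul' := fun c f => MemLp.toLp_const_smul c (hS f f.2) }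
  have hTn : ∀ f : S, ‖T f‖ = (eLpNorm (f : α → ℂ) 2 μ).toReal := fun f => Lp.norm_toLp _ (hS f f.2)
  -- The bound makes `l` vanish on functions that are null almost everywhere, so it descends to the
  -- image of `S` in `L²`.
  have hker : LinearMap.ker T ≤ LinearMap.ker l := by
    intro f hf
    rw [LinearMap.mem_ker] at hf ⊢
    have := hl f
    rw [← hTn, hf, norm_zero, mul_zero] at this
    exact norm_le_zero_iff.1 this
  let m : LinearMap.range T →ₗ[ℂ] ℂ :=
    ((LinearMap.ker T).liftQ l hker).comp T.quotKerEquivRange.symm.toLinearMap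
  have hm : ∀ f : S, m ⟨T f, LinearMap.mem_range_self T f⟩ = l f := by
    intro f
    change (LinearMap.ker T).liftQ l hker (T.quotKerEquivRange.symm _) = _
    rw [LinearMap.quotKerEquivRange_symm_apply_image]
    rfl
  have hmb : ∀ x, ‖m x‖ ≤ C * ‖x‖ := by
    rintro ⟨-, f, rfl⟩
    have h1 : ‖m ⟨T f, LinearMap.mem_range_self T f⟩‖ ≤ C * ‖T f‖ := by
      rw [hm f, hTn]
      exact hl f
    exact h1
  -- Hahn–Banach avoids having to know that `S` is dense; Riesz then represents the extension. The
  -- conjugate of the representing vector is taken because the pairing here is bilinear, while the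
  -- inner product is conjugate linear in its first slot.
  obtain ⟨g, hg1, hg2⟩ := exists_extension_norm_eq (LinearMap.range T) (m.mkContinuous C hmb)
  set u := (InnerProductSpace.toDual ℂ (Lp ℂ 2 μ)).symm g with hu
  have hun : ‖u‖ ≤ C := by
    rw [hu, LinearIsometryEquiv.norm_map, hg2]
    exact LinearMap.mkContinuous_norm_le _ hC _
  refine ⟨fun x => (starRingEnd ℂ) (u x), ?_, ?_, ?_⟩
  · exact (Lp.memLp u).star
  · have : eLpNorm (fun x => (starRingEnd ℂ) (u x)) 2 μ = eLpNorm u 2 μ :=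
      eLpNorm_congr_norm_ae (ae_of_all _ fun x => by simp)
    rw [this, ← Lp.norm_def]
    exact hun
  · intro f
    have h1 : inner ℂ u (T f) = l f := by
      rw [hu, InnerProductSpace.toDual_symm_apply, ← hm f]
      exact hg1 ⟨T f, LinearMap.mem_range_self T f⟩
    rw [← h1, L2.inner_def]
    refine integral_congr_ae ?_
    filter_upwards [(hS f f.2).coeFn_toLp] with x hx
    have : (T f : α → ℂ) x = (f : α → ℂ) x := hx
    rw [this, RCLike.inner_apply']

end hilbert

/-! ### Convergence of Mellin integrals and the Fourier transform on `L²` -/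

section framework

variable {K : Type*} [NontriviallyNormedField K] [MeasurableSpace K]
  {D : LocalFieldData K} {d : ℕ}

/-- Functions on `Kˣ` that decay faster than any power at infinity and are bounded near `0`. -/
def RapidDecay (f : K → ℂ) : Prop :=
  ∀ N : ℕ, ∃ C : ℝ, ∀ x, x ≠ 0 → (1 + ‖x‖) ^ N * ‖f x‖ ≤ C

/-- The properties of the local data at a place on which the local functional equation rests. -/
structure LocalFieldData.IsTate (D : LocalFieldData K) (d : ℕ) : Prop extends D.IsLocal d where
  schwartz_continuous : ∀ f ∈ D.schwartz, Continuous f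
  schwartz_decay : ∀ f ∈ D.schwartz, RapidDecay f
  schwartz_add : ∀ f ∈ D.schwartz, ∀ g ∈ D.schwartz, f + g ∈ D.schwartz
  schwartz_smul : ∀ c : ℂ, ∀ f ∈ D.schwartz, c • f ∈ D.schwartz
  schwartz_comp_mul : ∀ a : K, a ≠ 0 → ∀ f ∈ D.schwartz, (fun x => f (a * x)) ∈ D.schwartz
  fourier_mem : ∀ f ∈ D.schwartz, D.fourier f ∈ D.schwartz
  fourier_fourier : ∀ f ∈ D.schwartz, ∀ x, D.fourier (D.fourier f) x = f (-x)
  ae_eq_zero : ∀ u : K → ℂ, LocallyIntegrable u D.vol →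
    (∀ f ∈ D.schwartz, HasCompactSupport f → ∫ x, u x * f x ∂D.vol = 0) → u =ᵐ[D.vol] 0
  exists_test : ∀ χ : Kˣ →ₜ* Circle, ∃ f ∈ D.schwartz, ∀ w : ℂ, 0 < w.re → w.re < 1 →
    ∫ x, D.mellinIntegrand f χ w x ∂D.vol ≠ 0 ∧
    ∫ x, D.mellinIntegrand (D.fourier f) χ⁻¹ (1 - w) x ∂D.vol =
      D.gamma w χ * ∫ x, D.mellinIntegrand f χ w x ∂D.vol
  gamma_meromorphic : ∀ (χ : Kˣ →ₜ* Circle) (z : ℂ), MeromorphicAt (fun w => D.gamma w χ) z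
  gamma_analytic : ∀ (χ : Kˣ →ₜ* Circle) (z : ℂ), z.re < 1 → AnalyticAt ℂ (fun w => D.gamma w χ) z

namespace LocalFieldData.IsLocal

variable (hD : D.IsLocal d) [BorelSpace K] [ProperSpace K]
include hD

/-- Off `0` the unit ball is a union of shells shrinking by the factor `‖t‖`. The shells may overlap
in their boundary spheres, which is why only an upper bound is claimed; it serves for geometric
series estimates. -/
lemma setLIntegral_ball_le_tsum {t : K} (ht : 1 < ‖t‖) (μ : Measure K) (hμ : μ {0} = 0)
    (F : K → ENNReal) :
    ∫⁻ x in {x | ‖x‖ ≤ 1}, F x ∂μ ≤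
      ∑' n : ℕ, ∫⁻ x in {x | ‖t‖⁻¹ ^ (n + 1) ≤ ‖x‖ ∧ ‖x‖ ≤ ‖t‖⁻¹ ^ n}, F x ∂μ := by
  have hsub : {x : K | ‖x‖ ≤ 1} ⊆
      {0} ∪ ⋃ n : ℕ, {x | ‖t‖⁻¹ ^ (n + 1) ≤ ‖x‖ ∧ ‖x‖ ≤ ‖t‖⁻¹ ^ n} := by
    intro x hx
    rcases eq_or_ne x 0 with rfl | h0
    · simp
    · right
      have hx0 : 0 < ‖x‖ := norm_pos_iff.2 h0
      obtain ⟨n, h1, h2⟩ := exists_nat_pow_near ((one_le_inv₀ hx0).2 hx) ht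
      refine Set.mem_iUnion.2 ⟨n, ?_, ?_⟩
      · rw [inv_pow]
        exact inv_le_of_inv_le₀ hx0 h2.le
      · rw [inv_pow]
        exact (le_inv_comm₀ (by positivity) hx0).1 h1
  calc ∫⁻ x in {x | ‖x‖ ≤ 1}, F x ∂μ ≤ ∫⁻ x in {0} ∪
        ⋃ n : ℕ, {x | ‖t‖⁻¹ ^ (n + 1) ≤ ‖x‖ ∧ ‖x‖ ≤ ‖t‖⁻¹ ^ n}, F x ∂μ :=
        lintegral_mono_set hsub
    _ ≤ ∫⁻ x in {0}, F x ∂μ + ∫⁻ x in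
        ⋃ n : ℕ, {x | ‖t‖⁻¹ ^ (n + 1) ≤ ‖x‖ ∧ ‖x‖ ≤ ‖t‖⁻¹ ^ n}, F x ∂μ :=
        lintegral_union_le _ _ _
    _ ≤ _ := by
        rw [setLIntegral_measure_zero _ _ hμ, zero_add]
        exact lintegral_iUnion_le _ _

lemma mulHaar_shell {t : K} (ht : 1 < ‖t‖) (n : ℕ) :
    D.mulHaar {x | ‖t‖⁻¹ ^ (n + 1) ≤ ‖x‖ ∧ ‖x‖ ≤ ‖t‖⁻¹ ^ n} =
      D.mulHaar {x | 1 ≤ ‖x‖ ∧ ‖x‖ ≤ ‖t‖} := by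
  have ht0 : t ≠ 0 := norm_pos_iff.1 (one_pos.trans ht)
  have htn : t ^ (n + 1) ≠ 0 := pow_ne_zero _ ht0
  rw [← (hD.measurePreserving_mul htn).measure_preimage_emb
    (MeasurableEquiv.mulLeft₀ _ htn).measurableEmbedding {x | 1 ≤ ‖x‖ ∧ ‖x‖ ≤ ‖t‖}]
  congr 1
  ext x
  have hp : 0 < ‖t‖ := one_pos.trans ht
  simp only [Set.mem_ofPred_eq, Set.mem_preimage, norm_mul, norm_pow, inv_pow]
  rw [inv_le_iff_one_le_mul₀' (by positivity)]
  refine and_congr_right fun _ => ?_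
  rw [← one_div, le_div_iff₀ (by positivity), pow_succ, mul_assoc, mul_comm ‖t‖, ← mul_assoc,
    mul_le_iff_le_one_left hp, mul_comm]


/-- All shells have the same measure and on the `n`-th one `|x|^σ ≤ |t|^{-nσ}`, so the integral is
bounded by a geometric series. -/
lemma integrableOn_abs_rpow_of_pos {σ : ℝ} (hσ : 0 < σ) :
    IntegrableOn (fun x => D.abs x ^ σ) {x | ‖x‖ ≤ 1} D.mulHaar := by
  have hm := hD.measurable_abs
  obtain ⟨t, ht0, ht, hta⟩ := hD.exists_one_lt_abs
  refine ⟨Measurable.aestronglyMeasurable (by fun_prop), ?_⟩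
  rw [hasFiniteIntegral_iff_enorm]
  have h0 : D.mulHaar {0} = 0 := withDensity_absolutelyContinuous _ _ hD.vol_singleton
  refine lt_of_le_of_lt (hD.setLIntegral_ball_le_tsum ht _ h0 _) ?_
  set c := D.mulHaar {x | 1 ≤ ‖x‖ ∧ ‖x‖ ≤ ‖t‖} with hc
  set r : ℝ := (D.abs t)⁻¹ ^ σ with hr
  have hr0 : 0 ≤ r := by have := hD.abs_nonneg t; positivity
  have hr1 : r < 1 := Real.rpow_lt_one (by have := hD.abs_nonneg t; positivity)
    (inv_lt_one_of_one_lt₀ hta) hσ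
  have hn : ∀ n : ℕ, ∫⁻ x in {x | ‖t‖⁻¹ ^ (n + 1) ≤ ‖x‖ ∧ ‖x‖ ≤ ‖t‖⁻¹ ^ n},
      ‖D.abs x ^ σ‖ₑ ∂D.mulHaar ≤ ENNReal.ofReal r ^ n * c := by
    intro n
    rw [hc, ← hD.mulHaar_shell ht n, ← setLIntegral_const]
    refine setLIntegral_mono measurable_const fun x hx => ?_
    have h1 : 0 ≤ D.abs x := hD.abs_nonneg x
    rw [Real.enorm_of_nonneg (by positivity), ← ENNReal.ofReal_pow hr0]
    refine ENNReal.ofReal_le_ofReal ?_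
    have h2 : D.abs x ≤ (D.abs t)⁻¹ ^ n := by
      rw [hD.abs_eq, hD.abs_eq, ← inv_pow, ← pow_mul, mul_comm, pow_mul]
      exact pow_le_pow_left₀ (norm_nonneg x) hx.2 d
    calc D.abs x ^ σ ≤ ((D.abs t)⁻¹ ^ n) ^ σ := Real.rpow_le_rpow h1 h2 hσ.le
      _ = r ^ n := by
        rw [hr, ← Real.rpow_natCast, ← Real.rpow_natCast, ← Real.rpow_mul (by
          have := hD.abs_nonneg t; positivity), ← Real.rpow_mul (by
          have := hD.abs_nonneg t; positivity), mul_comm]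
  refine lt_of_le_of_lt (ENNReal.tsum_le_tsum hn) ?_
  rw [ENNReal.tsum_mul_right, ENNReal.tsum_geometric]
  refine ENNReal.mul_lt_top ?_ (hD.mulHaar_annulus_lt_top one_pos)
  rw [ENNReal.inv_lt_top, tsub_pos_iff_lt]
  exact ENNReal.ofReal_lt_one.2 hr1

lemma measurableSet_le_norm (r : ℝ) : MeasurableSet {x : K | r ≤ ‖x‖} :=
  measurableSet_le measurable_const measurable_norm

lemma measurableSet_norm_le (r : ℝ) : MeasurableSet {x : K | ‖x‖ ≤ r} :=
  measurableSet_le measurable_norm measurable_const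

lemma integrableOn_abs_rpow_of_neg {σ : ℝ} (hσ : σ < 0) :
    IntegrableOn (fun x => D.abs x ^ σ) {x | 1 ≤ ‖x‖} D.mulHaar := by
  have h := hD.integrableOn_abs_rpow_of_pos (neg_pos.2 hσ)
  rw [← integrable_indicator_iff (hD.measurableSet_norm_le 1), ← hD.integrable_inv] at h
  rw [← integrable_indicator_iff (hD.measurableSet_le_norm 1)]
  refine h.congr ?_
  filter_upwards [hD.ae_mulHaar_ne_zero] with x hx
  have hx0 : 0 < ‖x‖ := norm_pos_iff.2 hx
  by_cases h1 : 1 ≤ ‖x‖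
  · rw [Set.indicator_of_mem (show x⁻¹ ∈ {x : K | ‖x‖ ≤ 1} by
      simpa using inv_le_one_of_one_le₀ h1), Set.indicator_of_mem (by exact h1), hD.abs_inv,
      Real.inv_rpow (hD.abs_nonneg x), Real.rpow_neg (hD.abs_nonneg x), inv_inv]
  · rw [Set.indicator_of_notMem, Set.indicator_of_notMem (by exact h1)]
    simpa using one_lt_inv₀ hx0 |>.2 (not_le.1 h1)

/-- A function on `Kˣ` bounded by `C |x|^a` near `0` and by `C |x|^b` near infinity is integrable
for `dx / |x|` if `b < 0 < a`. -/
lemma integrable_of_le_rpow {f : K → ℝ} (hf : AEStronglyMeasurable f D.mulHaar) {a b C : ℝ}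
    (ha : 0 < a) (hb : b < 0) (h0 : ∀ x, x ≠ 0 → ‖x‖ ≤ 1 → |f x| ≤ C * D.abs x ^ a)
    (h1 : ∀ x, 1 ≤ ‖x‖ → |f x| ≤ C * D.abs x ^ b) : Integrable f D.mulHaar := by
  have hu : {x : K | ‖x‖ ≤ 1} ∪ {x | 1 ≤ ‖x‖} = Set.univ := by
    ext x; simpa using le_total _ _
  rw [← integrableOn_univ, ← hu]
  refine IntegrableOn.union ?_ ?_
  · refine Integrable.mono' ((hD.integrableOn_abs_rpow_of_pos ha).const_mul C) hf.restrict ?_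
    rw [ae_restrict_iff' (hD.measurableSet_norm_le 1)]
    filter_upwards [hD.ae_mulHaar_ne_zero] with x hx hx1
    exact h0 x hx hx1
  · refine Integrable.mono' ((hD.integrableOn_abs_rpow_of_neg hb).const_mul C) hf.restrict ?_
    rw [ae_restrict_iff' (hD.measurableSet_le_norm 1)]
    exact ae_of_all _ h1

lemma rapidDecay_le {f : K → ℂ} (hf : RapidDecay f) (b : ℝ) :
    ∃ C : ℝ, 0 ≤ C ∧ (∀ x, x ≠ 0 → ‖f x‖ ≤ C) ∧ ∀ x, 1 ≤ ‖x‖ → ‖f x‖ ≤ C * D.abs x ^ (-b) := by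
  obtain ⟨N, hN⟩ := exists_nat_ge b
  -- Decay is stated in the norm, and `|x| = ‖x‖ ^ d`, so the exponent `N` for `|x|` costs `d * N`.
  obtain ⟨C, hC⟩ := hf (d * N)
  have hC0 : 0 ≤ C := le_trans (by positivity) (hC 1 one_ne_zero)
  refine ⟨C, hC0, fun x hx => ?_, fun x hx => ?_⟩
  · refine le_trans ?_ (hC x hx)
    exact le_mul_of_one_le_left (norm_nonneg _)
      (one_le_pow₀ (by linarith [norm_nonneg x]))
  · have hx0 : x ≠ 0 := norm_pos_iff.1 (one_pos.trans_le hx)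
    have hp := hD.abs_pos hx0
    rw [Real.rpow_neg hp.le, ← div_eq_mul_inv, le_div_iff₀ (by positivity), mul_comm]
    refine le_trans (mul_le_mul_of_nonneg_right ?_ (norm_nonneg _)) (hC x hx0)
    calc D.abs x ^ b ≤ D.abs x ^ (N : ℝ) :=
          Real.rpow_le_rpow_of_exponent_le ((hD.one_le_abs_iff x).2 hx) hN
      _ = ‖x‖ ^ (d * N) := by rw [Real.rpow_natCast, hD.abs_eq, pow_mul]
      _ ≤ _ := pow_le_pow_left₀ (norm_nonneg _) (by linarith) _

lemma mulHaar_absolutelyContinuous : D.mulHaar ≪ D.vol := withDensity_absolutelyContinuous _ _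

lemma aestronglyMeasurable_abs_rpow (σ : ℝ) (μ : Measure K) :
    AEStronglyMeasurable (fun x => D.abs x ^ σ) μ := by
  have := hD.measurable_abs
  exact Measurable.aestronglyMeasurable (by fun_prop)

lemma integrable_rapidDecay {f : K → ℂ} (hf : RapidDecay f) (hm : AEStronglyMeasurable f D.vol)
    {σ : ℝ} (hσ : 0 < σ) : Integrable (fun x => ‖f x‖ * D.abs x ^ σ) D.mulHaar := by
  obtain ⟨C, hC0, h1, h2⟩ := hD.rapidDecay_le hf (σ + 1)
  refine hD.integrable_of_le_rpow (a := σ) (b := -1) (C := C)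
    ((hm.mono_ac hD.mulHaar_absolutelyContinuous).norm.mul
      (hD.aestronglyMeasurable_abs_rpow σ _)) hσ (by norm_num) ?_ ?_
  · intro x hx _
    have := hD.abs_nonneg x
    rw [abs_of_nonneg (by positivity)]
    exact mul_le_mul_of_nonneg_right (h1 x hx) (by positivity)
  · intro x hx
    have hx0 : x ≠ 0 := norm_pos_iff.1 (one_pos.trans_le hx)
    have := hD.abs_pos hx0
    rw [abs_of_nonneg (by positivity)]
    calc ‖f x‖ * D.abs x ^ σ ≤ C * D.abs x ^ (-(σ + 1)) * D.abs x ^ σ :=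
          mul_le_mul_of_nonneg_right (h2 x hx) (by positivity)
      _ = _ := by rw [mul_assoc, ← Real.rpow_add this]; congr 2; ring

lemma integrable_norm_mul_abs_rpow_one {f : K → ℂ} (hm : AEStronglyMeasurable f D.vol) :
    Integrable (fun x => ‖f x‖ * D.abs x ^ (1 : ℝ)) D.mulHaar ↔ Integrable f D.vol := by
  rw [← integrable_norm_iff hm, hD.integrable_vol]
  refine integrable_congr (ae_of_all _ fun x => ?_)
  simp [mul_comm]

lemma integrable_mul_quasi_iff {f : K → ℂ} (hm : AEStronglyMeasurable f D.vol)
    (χ : Kˣ →ₜ* Circle) (w : ℂ) : Integrable (fun x => f x * D.quasi χ w x) D.mulHaar ↔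
      Integrable (fun x => ‖f x‖ * D.abs x ^ w.re) D.mulHaar := by
  have h : AEStronglyMeasurable (fun x => f x * D.quasi χ w x) D.mulHaar :=
    (hm.mono_ac hD.mulHaar_absolutelyContinuous).mul
      (hD.measurable_quasi χ w).aestronglyMeasurable
  rw [← integrable_norm_iff h]
  refine integrable_congr ?_
  filter_upwards [hD.ae_mulHaar_ne_zero] with x hx
  rw [norm_mul, hD.norm_quasi χ w hx]

lemma memLp_two_rapidDecay {f : K → ℂ} (hf : RapidDecay f) (hm : AEStronglyMeasurable f D.vol) :
    MemLp f 2 D.vol := by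
  rw [memLp_two_iff_integrable_sq_norm hm]
  have h1 : Integrable f D.vol :=
    (hD.integrable_norm_mul_abs_rpow_one hm).1 (hD.integrable_rapidDecay hf hm one_pos)
  obtain ⟨C, hC0, h2, -⟩ := hD.rapidDecay_le hf 0
  refine (h1.norm.const_mul C).mono' (by fun_prop) ?_
  filter_upwards [hD.ae_ne_zero] with x hx
  rw [Real.norm_of_nonneg (by positivity), sq]
  exact mul_le_mul_of_nonneg_right (h2 x hx) (norm_nonneg _)

lemma norm_fourier_le (f : K → ℂ) (y : K) : ‖D.fourier f y‖ ≤ ∫ x, ‖f x‖ ∂D.vol := by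
  refine (norm_integral_le_integral_norm _).trans (le_of_eq ?_)
  simp [hD.psi_norm]

lemma continuous_fourier {f : K → ℂ} (hf : Integrable f D.vol) : Continuous (D.fourier f) := by
  have hp := hD.psi_continuous
  refine continuous_of_dominated (bound := fun x => ‖f x‖) (fun y => ?_) (fun y => ?_) hf.norm ?_
  · exact hf.1.mul (by fun_prop)
  · exact ae_of_all _ fun x => by simp [hD.psi_norm]
  · exact ae_of_all _ fun x => by fun_prop

lemma integrable_prod_psi {f g : K → ℂ} (hf : Integrable f D.vol) (hg : Integrable g D.vol) :
    Integrable (Function.uncurry fun x y => f x * g y * D.psi (x * y)) (D.vol.prod D.vol) := by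
  have := hD.haar
  have hp := hD.measurable_psi
  refine (hf.mul_prod hg).mul_bdd (c := 1) (Measurable.aestronglyMeasurable (by fun_prop)) ?_
  exact ae_of_all _ fun x => (hD.psi_norm _).le

/-- The multiplication formula `∫ f̂ g = ∫ f ĝ`. -/
lemma integral_fourier_mul {f g : K → ℂ} (hf : Integrable f D.vol) (hg : Integrable g D.vol) :
    ∫ y, D.fourier f y * g y ∂D.vol = ∫ x, f x * D.fourier g x ∂D.vol := by
  have := hD.haar
  have h := integral_integral_swap (hD.integrable_prod_psi hf hg)
  simp only [fourier]
  have e1 : ∀ y, (∫ x, f x * D.psi (x * y) ∂D.vol) * g y =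
      ∫ x, f x * g y * D.psi (x * y) ∂D.vol := fun y => by
    rw [← integral_mul_const]
    exact integral_congr_ae (ae_of_all _ fun x => by ring)
  have e2 : ∀ x, f x * (∫ y, g y * D.psi (y * x) ∂D.vol) =
      ∫ y, f x * g y * D.psi (x * y) ∂D.vol := fun x => by
    rw [← integral_const_mul]
    exact integral_congr_ae (ae_of_all _ fun y => by simp only [mul_comm y x]; ring)
  simp only [e1, e2, h]

lemma integral_comp_mul {E : Type*} [NormedAddCommGroup E] [NormedSpace ℝ E]
    {a : K} (ha : a ≠ 0) (F : K → E) :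
    ∫ x, F (a * x) ∂D.vol = (D.abs a)⁻¹ • ∫ x, F x ∂D.vol := by
  rw [hD.integral_vol, hD.integral_vol F, ← hD.integral_mul_left ha fun x => D.abs x • F x,
    ← integral_smul]
  refine integral_congr_ae (ae_of_all _ fun x => ?_)
  simp only [hD.abs_mul, smul_smul]
  rw [← mul_assoc, inv_mul_cancel₀ (hD.abs_pos ha).ne', one_mul]

lemma integrable_comp_mul {E : Type*} [NormedAddCommGroup E] [NormedSpace ℝ E]
    {a : K} (ha : a ≠ 0) {F : K → E} (hF : Integrable F D.vol) :
    Integrable (fun x => F (a * x)) D.vol := by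
  rw [hD.integrable_vol] at hF ⊢
  have h := ((hD.integrable_mul_left ha fun x => D.abs x • F x).2 hF).smul (D.abs a)⁻¹
  refine h.congr (ae_of_all _ fun x => ?_)
  simp only [hD.abs_mul, Pi.smul_apply, smul_smul]
  rw [← mul_assoc, inv_mul_cancel₀ (hD.abs_pos ha).ne', one_mul]

lemma fourier_comp_mul {a : K} (ha : a ≠ 0) (f : K → ℂ) (y : K) :
    D.fourier (fun x => f (a * x)) y = ((D.abs a)⁻¹ : ℝ) • D.fourier f (a⁻¹ * y) := by
  rw [fourier, fourier, ← hD.integral_comp_mul ha]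
  refine integral_congr_ae (ae_of_all _ fun x => ?_)
  simp only
  congr 2
  field_simp

end LocalFieldData.IsLocal

namespace LocalFieldData.IsTate

variable (hD : D.IsTate d) [BorelSpace K] [ProperSpace K]
include hD

lemma schwartz_aesm {f : K → ℂ} (hf : f ∈ D.schwartz) (μ : Measure K) :
    AEStronglyMeasurable f μ :=
  (hD.schwartz_continuous f hf).aestronglyMeasurable

lemma schwartz_memLp {f : K → ℂ} (hf : f ∈ D.schwartz) : MemLp f 2 D.vol :=
  hD.memLp_two_rapidDecay (hD.schwartz_decay f hf) (hD.schwartz_aesm hf _)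

lemma schwartz_integrable_rpow {f : K → ℂ} (hf : f ∈ D.schwartz) {σ : ℝ} (hσ : 0 < σ) :
    Integrable (fun x => ‖f x‖ * D.abs x ^ σ) D.mulHaar :=
  hD.integrable_rapidDecay (hD.schwartz_decay f hf) (hD.schwartz_aesm hf _) hσ

lemma schwartz_integrable {f : K → ℂ} (hf : f ∈ D.schwartz) : Integrable f D.vol :=
  (hD.integrable_norm_mul_abs_rpow_one (hD.schwartz_aesm hf _)).1
    (hD.schwartz_integrable_rpow hf one_pos)

lemma schwartz_integrable_quasi {f : K → ℂ} (hf : f ∈ D.schwartz) (χ : Kˣ →ₜ* Circle) {w : ℂ}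
    (hw : 0 < w.re) : Integrable (fun x => f x * D.quasi χ w x) D.mulHaar :=
  (hD.integrable_mul_quasi_iff (hD.schwartz_aesm hf _) χ w).2 (hD.schwartz_integrable_rpow hf hw)

/-- The Schwartz space as a subspace of all functions. -/
def schwartzSubmodule (hD : D.IsTate d) : Submodule ℂ (K → ℂ) where
  carrier := D.schwartz
  add_mem' hf hg := hD.schwartz_add _ hf _ hg
  zero_mem' := by
    obtain ⟨f, hf, -⟩ := hD.exists_test 1
    simpa using hD.schwartz_smul 0 f hf
  smul_mem' c _ hf := hD.schwartz_smul c _ hf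

lemma fourier_add {f g : K → ℂ} (hf : Integrable f D.vol) (hg : Integrable g D.vol) (y : K) :
    D.fourier (f + g) y = D.fourier f y + D.fourier g y := by
  have hp := hD.psi_continuous
  have key : ∀ {k : K → ℂ}, Integrable k D.vol → Integrable (fun x => k x * D.psi (x * y)) D.vol :=
    fun hk => hk.mul_bdd (c := 1) (by fun_prop) (ae_of_all _ fun x => (hD.psi_norm _).le)
  simp only [fourier, Pi.add_apply, add_mul]
  exact integral_add (key hf) (key hg)

/-- Plancherel comes from the multiplication formula applied to `f` and the conjugate of `f̂`: by
Fourier inversion the transform of the latter is the conjugate of `f`. -/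
lemma integral_norm_sq_fourier {f : K → ℂ} (hf : f ∈ D.schwartz) :
    ∫ x, ‖D.fourier f x‖ ^ 2 ∂D.vol = ∫ x, ‖f x‖ ^ 2 ∂D.vol := by
  have hF := hD.schwartz_integrable (hD.fourier_mem f hf)
  have hg : Integrable (fun x => (starRingEnd ℂ) (D.fourier f x)) D.vol :=
    (memLp_one_iff_integrable.1 (memLp_one_iff_integrable.2 hF).star)
  have h := hD.integral_fourier_mul (hD.schwartz_integrable hf) hg
  have e : ∀ x, D.fourier (fun x => (starRingEnd ℂ) (D.fourier f x)) x =
      (starRingEnd ℂ) (f x) := by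
    intro x
    have h1 := hD.fourier_fourier f hf (-x)
    rw [neg_neg] at h1
    rw [← h1, fourier, fourier, ← integral_conj]
    refine integral_congr_ae (ae_of_all _ fun y => ?_)
    simp only [map_mul, mul_neg, hD.psi_neg, Complex.conj_conj]
  simp only [e, Complex.mul_conj, Complex.normSq_eq_norm_sq] at h
  rw [integral_complex_ofReal, integral_complex_ofReal] at h
  exact_mod_cast h

lemma eLpNorm_fourier {f : K → ℂ} (hf : f ∈ D.schwartz) :
    (eLpNorm (D.fourier f) 2 D.vol).toReal = (eLpNorm f 2 D.vol).toReal := by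
  have h := hD.integral_norm_sq_fourier hf
  rw [← sq_eLpNorm_two (hD.schwartz_memLp hf),
    ← sq_eLpNorm_two (hD.schwartz_memLp (hD.fourier_mem f hf))] at h
  exact (pow_left_inj₀ ENNReal.toReal_nonneg ENNReal.toReal_nonneg two_ne_zero).1 h

/-- The Fourier transform on `L²`, in its distributional form. -/
lemma exists_fourier_memLp_two {g : K → ℂ} (hg : MemLp g 2 D.vol) :
    ∃ h, MemLp h 2 D.vol ∧ (eLpNorm h 2 D.vol).toReal ≤ (eLpNorm g 2 D.vol).toReal ∧
      ∀ f ∈ D.schwartz, ∫ x, h x * f x ∂D.vol = ∫ x, g x * D.fourier f x ∂D.vol := by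
  have hint : ∀ f ∈ D.schwartz, Integrable (fun x => g x * D.fourier f x) D.vol := fun f hf =>
    hg.integrable_mul (hD.schwartz_memLp (hD.fourier_mem f hf))
  let l : hD.schwartzSubmodule →ₗ[ℂ] ℂ :=
    { toFun := fun f => ∫ x, g x * D.fourier (f : K → ℂ) x ∂D.vol
      map_add' := fun f k => by
        rw [← integral_add (hint f f.2) (hint k k.2)]
        refine integral_congr_ae (ae_of_all _ fun x => ?_)
        simp only [Submodule.coe_add]
        rw [hD.fourier_add (hD.schwartz_integrable f.2) (hD.schwartz_integrable k.2), mul_add]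
      map_smul' := fun c f => by
        simp only [RingHom.id_apply, smul_eq_mul, Submodule.coe_smul]
        rw [← integral_const_mul]
        refine integral_congr_ae (ae_of_all _ fun x => ?_)
        simp only [fourier, Pi.smul_apply, smul_eq_mul, mul_assoc, integral_const_mul]
        ring }
  obtain ⟨h, h1, h2, h3⟩ := exists_memLp_two_of_bounded hD.schwartzSubmodule
    (fun f hf => hD.schwartz_memLp hf) l ENNReal.toReal_nonneg (fun f => by
      refine (norm_integral_mul_le_two hg (hD.schwartz_memLp (hD.fourier_mem f f.2))).trans ?_
      rw [hD.eLpNorm_fourier f.2])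
  exact ⟨h, h1, h2, fun f hf => h3 ⟨f, hf⟩⟩

lemma exists_isHankelTransform {s : ℂ} {φ : K → ℂ} (h : MemLp (D.hankelSymbol s φ) 2 D.vol) :
    ∃ k, D.IsHankelTransform s φ k := by
  obtain ⟨k, h1, -, h3⟩ := hD.exists_fourier_memLp_two h
  exact ⟨k, h, h1, h3⟩

/-- The Fourier transform of an element of `L¹ ∩ L²` lies in `L²`. -/
lemma memLp_two_fourier {f : K → ℂ} (hf : Integrable f D.vol) (hf2 : MemLp f 2 D.vol) :
    MemLp (D.fourier f) 2 D.vol := by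
  have := hD.haar
  obtain ⟨h, h1, -, h3⟩ := hD.exists_fourier_memLp_two hf2
  have hc := hD.continuous_fourier hf
  -- The transform obtained by duality and the one given by the integral agree on all test
  -- functions, so they agree almost everywhere.
  have h4 : h - D.fourier f =ᵐ[D.vol] 0 := by
    refine hD.ae_eq_zero _ ((h1.locallyIntegrable one_le_two).sub hc.locallyIntegrable)
      fun k hk hkc => ?_
    simp only [Pi.sub_apply, sub_mul]
    have hk1 := hD.schwartz_integrable hk
    have i1 : Integrable (fun x => h x * k x) D.vol := h1.integrable_mul (hD.schwartz_memLp hk)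
    have i2 : Integrable (fun x => D.fourier f x * k x) D.vol :=
      hk1.bdd_mul (c := ∫ x, ‖f x‖ ∂D.vol) hc.aestronglyMeasurable
        (ae_of_all _ (hD.norm_fourier_le f))
    rw [integral_sub i1 i2, h3 k hk, hD.integral_fourier_mul hf hk1, sub_self]
  refine h1.ae_eq ?_
  filter_upwards [h4] with x hx
  exact sub_eq_zero.1 hx

end LocalFieldData.IsTate

end framework


/-! ### Tate's argument for general Fourier pairs -/

section framework

variable {K : Type*} [NontriviallyNormedField K] [MeasurableSpace K]
  {D : LocalFieldData K} {d : ℕ} [BorelSpace K] [ProperSpace K]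

/-- Apply `log r ≤ r - 1` to `t ^ δ` and to its inverse. The lemma absorbs every logarithm below
into a small change of exponent. -/
lemma abs_log_le {t δ : ℝ} (ht : 0 < t) (hδ : 0 < δ) :
    |Real.log t| ≤ δ⁻¹ * (t ^ (-δ) + t ^ δ) := by
  have e : δ * |Real.log t| ≤ t ^ (-δ) + t ^ δ := by
    have e0 : δ * |Real.log t| = |Real.log (t ^ δ)| := by
      rw [Real.log_rpow ht, abs_mul, abs_of_pos hδ]
    rw [e0, abs_le, Real.rpow_neg ht.le]
    have hp' : 0 < t ^ δ := by positivity
    have l1 := Real.log_le_sub_one_of_pos hp'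
    have l2 := Real.log_le_sub_one_of_pos (inv_pos.2 hp')
    rw [Real.log_inv] at l2
    have := inv_pos.2 hp'
    constructor <;> linarith
  rw [inv_mul_eq_div, le_div_iff₀ hδ, mul_comm]
  exact e

namespace LocalFieldData.IsLocal

variable (hD : D.IsLocal d)
include hD

/-- The measure preserving change of variables `(x, y) ↦ (x, x y)`. -/
lemma integrable_shear {A B : K → ℂ} (hA : Integrable A D.mulHaar) (hB : Integrable B D.mulHaar) :
    Integrable (fun p : K × K => A p.1 * B (p.1 * p.2)) (D.mulHaar.prod D.mulHaar) := by
  have := hD.sigmaFinite_mulHaar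
  have h : MeasurePreserving (fun p : K × K => (p.1, p.1 * p.2)) (D.mulHaar.prod D.mulHaar)
      (D.mulHaar.prod D.mulHaar) := by
    refine (MeasurePreserving.id D.mulHaar).skew_product (g := fun x y => x * y) (by fun_prop) ?_
    filter_upwards [hD.ae_mulHaar_ne_zero] with x hx
    exact (hD.measurePreserving_mul hx).map_eq
  exact h.integrable_comp_of_integrable (hA.mul_prod hB)

lemma abs_mul_quasi_inv (χ : Kˣ →ₜ* Circle) (w : ℂ) (x : K) :
    (D.abs x : ℂ) * (D.quasi χ⁻¹ (1 - w) x)⁻¹ = D.quasi χ w x := by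
  rcases eq_or_ne x 0 with rfl | hx
  · simp [hD.quasi_zero, hD.abs_zero]
  have h := hD.quasi_inv_char χ⁻¹ (1 - w) x
  rw [inv_inv] at h
  rw [← h]
  have h1 := hD.quasi_add χ (-(1 - w)) 1 x
  rw [Complex.cpow_one, mul_comm] at h1
  rw [← h1]
  congr 1
  ring

/-- The function `y ↦ ∫ a(x) b(yx) dx` is a multiplicative convolution, so its Mellin transform is a
product. Absolute convergence of the two factors justifies Fubini after the shear `(x, y) ↦ (x,
xy)`. -/
lemma integral_quasi_mul_integral {a b : K → ℂ} (χ : Kˣ →ₜ* Circle) (w : ℂ)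
    (ha : Integrable (fun x => a x * D.quasi χ w x) D.mulHaar)
    (hb : Integrable (fun x => b x * D.quasi χ⁻¹ (1 - w) x) D.mulHaar) :
    ∫ y, D.quasi χ⁻¹ (1 - w) y * ∫ x, a x * b (y * x) ∂D.vol ∂D.mulHaar =
      (∫ x, a x * D.quasi χ w x ∂D.mulHaar) *
        ∫ x, b x * D.quasi χ⁻¹ (1 - w) x ∂D.mulHaar := by
  have := hD.sigmaFinite_mulHaar
  set q := D.quasi χ⁻¹ (1 - w) with hq
  have hF : ∀ x y, x ≠ 0 → a x * D.quasi χ w x * (b (x * y) * q (x * y)) =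
      q y * (D.abs x • (a x * b (y * x))) := by
    intro x y hx
    rw [← hD.abs_mul_quasi_inv, ← hq, hq, hD.quasi_mul, ← hq, Complex.real_smul, mul_comm y x]
    have : q x ≠ 0 := hD.quasi_ne_zero _ _ hx
    field_simp
  have hi := hD.integrable_shear ha hb
  have e1 : ∫ y, q y * ∫ x, a x * b (y * x) ∂D.vol ∂D.mulHaar =
      ∫ y, ∫ x, a x * D.quasi χ w x * (b (x * y) * q (x * y)) ∂D.mulHaar ∂D.mulHaar := by
    refine integral_congr_ae (ae_of_all _ fun y => ?_)
    simp only
    rw [hD.integral_vol, ← integral_const_mul]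
    refine integral_congr_ae ?_
    filter_upwards [hD.ae_mulHaar_ne_zero] with x hx
    exact (hF x y hx).symm
  rw [e1, ← integral_integral_swap hi, ← integral_mul_const]
  refine integral_congr_ae ?_
  filter_upwards [hD.ae_mulHaar_ne_zero] with x hx
  rw [integral_const_mul, hD.integral_mul_left hx fun z => b z * q z]

/-- Mellin integrals are holomorphic in the interior of their strip of convergence. -/
lemma differentiableAt_integral_quasi {F : K → ℂ} (hF : AEStronglyMeasurable F D.vol)
    (χ : Kˣ →ₜ* Circle) {a b : ℝ}
    (h : ∀ σ, a < σ → σ < b → Integrable (fun x => ‖F x‖ * D.abs x ^ σ) D.mulHaar) {z : ℂ}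
    (ha : a < z.re) (hb : z.re < b) :
    DifferentiableAt ℂ (fun w => ∫ x, F x * D.quasi χ w x ∂D.mulHaar) z := by
  -- One `δ` of room pays for moving `w` in a disc around `z`, the other for the factor `log |x|` in
  -- the derivative.
  obtain ⟨δ, hδ, hδa, hδb⟩ : ∃ δ : ℝ, 0 < δ ∧ a < z.re - 2 * δ ∧ z.re + 2 * δ < b :=
    ⟨min (z.re - a) (b - z.re) / 4, by
      have := lt_min (sub_pos.2 ha) (sub_pos.2 hb); linarith, by
      have := min_le_left (z.re - a) (b - z.re); linarith, by
      have := min_le_right (z.re - a) (b - z.re); linarith⟩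
  have hF' : AEStronglyMeasurable F D.mulHaar := hF.mono_ac hD.mulHaar_absolutelyContinuous
  have hm := hD.measurable_abs
  have hbound : Integrable (fun x => δ⁻¹ * (‖F x‖ * D.abs x ^ (z.re - 2 * δ) +
      ‖F x‖ * D.abs x ^ (z.re) + ‖F x‖ * D.abs x ^ (z.re) +
      ‖F x‖ * D.abs x ^ (z.re + 2 * δ))) D.mulHaar :=
    (((((h _ hδa (by linarith)).add (h _ ha hb)).add (h _ ha hb)).add
      (h _ (by linarith) hδb)).const_mul _)
  have hq : AEStronglyMeasurable (fun x => F x * (D.quasi χ z x * Real.log (D.abs x)))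
      D.mulHaar := by
    refine hF'.mul (((hD.measurable_quasi χ z).mul ?_).aestronglyMeasurable)
    fun_prop
  refine (hasDerivAt_integral_of_dominated_loc_of_deriv_le (Metric.ball_mem_nhds z hδ)
    (F := fun w x => F x * D.quasi χ w x)
    (F' := fun w x => F x * (D.quasi χ w x * Real.log (D.abs x)))
    (Eventually.of_forall fun w => hF'.mul (hD.measurable_quasi χ w).aestronglyMeasurable)
    ((hD.integrable_mul_quasi_iff hF χ z).2 (h _ ha hb)) hq ?_ hbound ?_).2.differentiableAt
  · filter_upwards [hD.ae_mulHaar_ne_zero] with x hx w hw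
    have hp := hD.abs_pos hx
    have hre : |w.re - z.re| < δ := by
      rw [← Complex.sub_re]
      refine lt_of_le_of_lt (Complex.abs_re_le_norm _) ?_
      rwa [← dist_eq_norm]
    rw [abs_lt] at hre
    rw [norm_mul, norm_mul, hD.norm_quasi χ w hx, Complex.norm_real, Real.norm_eq_abs]
    have h1 : D.abs x ^ w.re ≤ D.abs x ^ (z.re - δ) + D.abs x ^ (z.re + δ) := by
      rcases le_total 1 (D.abs x) with h1 | h1
      · exact le_add_of_nonneg_of_le (by positivity)
          (Real.rpow_le_rpow_of_exponent_le h1 (by linarith))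
      · exact le_add_of_le_of_nonneg
          (Real.rpow_le_rpow_of_exponent_ge hp h1 (by linarith)) (by positivity)
    have h2 := abs_log_le hp hδ
    calc ‖F x‖ * (D.abs x ^ w.re * |Real.log (D.abs x)|)
        ≤ ‖F x‖ * ((D.abs x ^ (z.re - δ) + D.abs x ^ (z.re + δ)) *
          (δ⁻¹ * (D.abs x ^ (-δ) + D.abs x ^ δ))) := by gcongr
      _ = _ := by
        have r1 : D.abs x ^ (z.re - 2 * δ) = D.abs x ^ (z.re - δ) * D.abs x ^ (-δ) := by
          rw [← Real.rpow_add hp]; congr 1; ring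
        have r2 : D.abs x ^ (z.re + 2 * δ) = D.abs x ^ (z.re + δ) * D.abs x ^ δ := by
          rw [← Real.rpow_add hp]; congr 1; ring
        have r3 : D.abs x ^ z.re = D.abs x ^ (z.re - δ) * D.abs x ^ δ := by
          rw [← Real.rpow_add hp]; congr 1; ring
        have r4 : D.abs x ^ (z.re - δ) * D.abs x ^ δ = D.abs x ^ (z.re + δ) * D.abs x ^ (-δ) := by
          rw [← Real.rpow_add hp, ← Real.rpow_add hp]; congr 1; ring
        rw [r1, r2, r3]
        linear_combination δ⁻¹ * ‖F x‖ * (-r4)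
  · filter_upwards [hD.ae_mulHaar_ne_zero] with x hx w _
    have hp : (D.abs x : ℂ) ≠ 0 := by exact_mod_cast (hD.abs_pos hx).ne'
    have h1 : HasDerivAt (fun w : ℂ => (D.abs x : ℂ) ^ w)
        ((D.abs x : ℂ) ^ w * Complex.log (D.abs x)) w := by
      simpa using (hasDerivAt_id w).const_cpow (c := (D.abs x : ℂ)) (Or.inl hp)
    have h2 := (h1.const_mul (charExt χ x)).const_mul (F x)
    rw [← Complex.ofReal_log (hD.abs_nonneg x), ← mul_assoc (charExt χ x)] at h2
    exact h2

end LocalFieldData.IsLocal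

namespace LocalFieldData.IsTate

variable (hD : D.IsTate d)
include hD

/-- The global form of Tate's argument: if `u` is the Fourier transform of `v` in the sense of
distributions, then their Mellin transforms are proportional to those of a Schwartz function and
of its Fourier transform. -/
lemma mellin_mul_mellin {u v f : K → ℂ} (hf : f ∈ D.schwartz)
    (huv : ∀ k ∈ D.schwartz, ∫ x, u x * k x ∂D.vol = ∫ x, v x * D.fourier k x ∂D.vol)
    (χ : Kˣ →ₜ* Circle) {w : ℂ} (hw0 : 0 < w.re) (hw1 : w.re < 1)
    (hu : Integrable (fun x => u x * D.quasi χ⁻¹ (1 - w) x) D.mulHaar)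
    (hv : Integrable (fun x => v x * D.quasi χ w x) D.mulHaar) :
    (∫ x, u x * D.quasi χ⁻¹ (1 - w) x ∂D.mulHaar) * ∫ x, f x * D.quasi χ w x ∂D.mulHaar =
      (∫ x, v x * D.quasi χ w x ∂D.mulHaar) *
        ∫ x, D.fourier f x * D.quasi χ⁻¹ (1 - w) x ∂D.mulHaar := by
  rw [mul_comm, ← hD.integral_quasi_mul_integral χ w (hD.schwartz_integrable_quasi hf χ hw0) hu,
    ← hD.integral_quasi_mul_integral χ w hv (hD.schwartz_integrable_quasi (hD.fourier_mem f hf) χ⁻¹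
      (by simpa using hw1))]
  refine integral_congr_ae ?_
  filter_upwards [hD.ae_mulHaar_ne_zero] with y hy
  congr 1
  -- Testing the Fourier relation against `x ↦ f(y⁻¹ x)` gives `∫ f(x) u(yx) dx = ∫ v(x) f̂(yx) dx`:
  -- the two Jacobian factors `|y|` cancel.
  have hk := hD.schwartz_comp_mul y⁻¹ (inv_ne_zero hy) f hf
  have h1 := huv _ hk
  have h2 := hD.integral_comp_mul hy fun x => u x * f (y⁻¹ * x)
  rw [h1] at h2
  simp only [← mul_assoc, inv_mul_cancel₀ hy, one_mul] at h2
  rw [integral_congr_ae (ae_of_all _ fun x => mul_comm (f x) (u (y * x))), h2, ← integral_smul]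
  refine integral_congr_ae (ae_of_all _ fun x => ?_)
  simp only
  rw [hD.fourier_comp_mul (inv_ne_zero hy), hD.abs_inv, inv_inv, inv_inv, Complex.real_smul,
    Complex.real_smul]
  have : (D.abs y : ℂ) ≠ 0 := by exact_mod_cast (hD.abs_pos hy).ne'
  push_cast
  field_simp

/-- Taking for `f` the test function of the place in `mellin_mul_mellin` and cancelling its nonzero
zeta integral. Neither `u` nor `v` has to be a Schwartz function, which is what allows a second use
for the pair `(h, g)`. -/
lemma mellin_eq_gamma_mul {u v : K → ℂ}
    (huv : ∀ k ∈ D.schwartz, ∫ x, u x * k x ∂D.vol = ∫ x, v x * D.fourier k x ∂D.vol)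
    (χ : Kˣ →ₜ* Circle) {w : ℂ} (hw0 : 0 < w.re) (hw1 : w.re < 1)
    (hu : Integrable (fun x => u x * D.quasi χ⁻¹ (1 - w) x) D.mulHaar)
    (hv : Integrable (fun x => v x * D.quasi χ w x) D.mulHaar) :
    ∫ x, u x * D.quasi χ⁻¹ (1 - w) x ∂D.mulHaar =
      D.gamma w χ * ∫ x, v x * D.quasi χ w x ∂D.mulHaar := by
  obtain ⟨f, hf, h⟩ := hD.exists_test χ
  obtain ⟨h1, h2⟩ := h w hw0 hw1
  rw [hD.integral_mellinIntegrand] at h1 h2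
  rw [hD.integral_mellinIntegrand] at h2
  have h3 := hD.mellin_mul_mellin hf huv χ hw0 hw1 hu hv
  rw [h2] at h3
  refine mul_right_cancel₀ h1 (h3.trans ?_)
  ring

/-- If `γ(w, χ) = 0`, the zeta integral of `f̂` vanishes; a second application of the functional
equation then kills that of `x ↦ f(-x)`, which is `χ(-1)` times the nonzero zeta integral of `f`. -/
lemma gamma_ne_zero (χ : Kˣ →ₜ* Circle) {w : ℂ} (hw0 : 0 < w.re) (hw1 : w.re < 1) :
    D.gamma w χ ≠ 0 := by
  obtain ⟨f, hf, h⟩ := hD.exists_test χ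
  obtain ⟨h1, h2⟩ := h w hw0 hw1
  rw [hD.integral_mellinIntegrand] at h1 h2
  rw [hD.integral_mellinIntegrand] at h2
  intro h0
  rw [h0, zero_mul] at h2
  have hF := hD.fourier_mem f hf
  have hFF := hD.fourier_mem _ hF
  have h3 := hD.mellin_eq_gamma_mul (u := D.fourier (D.fourier f)) (v := D.fourier f)
    (fun k hk => hD.integral_fourier_mul (hD.schwartz_integrable hF) (hD.schwartz_integrable hk))
    χ⁻¹ (w := 1 - w) (by simpa using hw1) (by simpa using hw0)
    (by rw [sub_sub_cancel, inv_inv]; exact hD.schwartz_integrable_quasi hFF χ hw0)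
    (hD.schwartz_integrable_quasi hF _ (by simpa using hw1))
  rw [h2, mul_zero, sub_sub_cancel, inv_inv,
    ← hD.integral_mul_left (neg_ne_zero.2 (one_ne_zero (α := K)))] at h3
  have h4 : ∀ x, D.fourier (D.fourier f) (-1 * x) * D.quasi χ w (-1 * x) =
      D.quasi χ w (-1) * (f x * D.quasi χ w x) := by
    intro x
    rw [hD.quasi_mul, neg_one_mul, hD.fourier_fourier f hf, neg_neg]
    ring
  simp only [h4] at h3
  rw [integral_const_mul] at h3
  exact mul_ne_zero (hD.quasi_ne_zero χ w (neg_ne_zero.2 one_ne_zero)) h1 h3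

end LocalFieldData.IsTate

end framework


/-! ### Behaviour near `0` of the Fourier transform of a function that is `O(1/|x|)` -/

section framework

variable {K : Type*} [NontriviallyNormedField K] [MeasurableSpace K]
  {D : LocalFieldData K} {d : ℕ} [BorelSpace K] [ProperSpace K]

namespace LocalFieldData.IsTate

variable (hD : D.IsTate d)
include hD

lemma memLp_indicator_one {S : Set K} (hS : MeasurableSet S) (hb : Bornology.IsBounded S) :
    MemLp (S.indicator (1 : K → ℂ)) 2 D.vol := by
  have := hD.haar
  exact memLp_indicator_const 2 hS 1 (Or.inr hb.measure_lt_top.ne)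

lemma sq_eLpNorm_indicator_one {S : Set K} (hS : MeasurableSet S)
    (hb : Bornology.IsBounded S) :
    (eLpNorm (S.indicator (1 : K → ℂ)) 2 D.vol).toReal ^ 2 = D.vol.real S := by
  rw [sq_eLpNorm_two (hD.memLp_indicator_one hS hb), ← integral_indicator_one hS]
  refine integral_congr_ae (ae_of_all _ fun x => ?_)
  by_cases hx : x ∈ S <;> simp [hx]

/-- Cauchy–Schwarz against the indicator of `S`. -/
lemma setIntegral_norm_le {h : K → ℂ} (hh : MemLp h 2 D.vol) {S : Set K} (hS : MeasurableSet S)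
    (hb : Bornology.IsBounded S) :
    ∫ x in S, ‖h x‖ ∂D.vol ≤ (eLpNorm h 2 D.vol).toReal * √(D.vol.real S) := by
  have h1 : MemLp (fun x => (‖h x‖ : ℂ)) 2 D.vol := hh.norm.ofReal
  have h2 := norm_integral_mul_le_two h1 (hD.memLp_indicator_one hS hb)
  have h3 : (eLpNorm (S.indicator (1 : K → ℂ)) 2 D.vol).toReal = √(D.vol.real S) := by
    rw [← hD.sq_eLpNorm_indicator_one hS hb, Real.sqrt_sq ENNReal.toReal_nonneg]
  have h4 : eLpNorm (fun x => (‖h x‖ : ℂ)) 2 D.vol = eLpNorm h 2 D.vol :=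
    eLpNorm_congr_norm_ae (ae_of_all _ fun x => by simp)
  rw [h3, h4] at h2
  refine le_trans (le_of_eq ?_) h2
  have h5 : ∀ x, (‖h x‖ : ℂ) * S.indicator (1 : K → ℂ) x =
      ((S.indicator (fun x => ‖h x‖) x : ℝ) : ℂ) := by
    intro x
    by_cases hx : x ∈ S <;> simp [hx]
  simp only [h5]
  rw [integral_complex_ofReal, integral_indicator hS, Complex.norm_real, Real.norm_of_nonneg]
  exact integral_nonneg fun x => norm_nonneg _

lemma integrableOn_of_memLp_two {h : K → ℂ} (hh : MemLp h 2 D.vol) {S : Set K}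
    (hb : Bornology.IsBounded S) : IntegrableOn h S D.vol := by
  have := hD.haar
  have : IsFiniteMeasure (D.vol.restrict S) := ⟨by simpa using hb.measure_lt_top⟩
  exact (hh.restrict S).integrable one_le_two

lemma volReal_ball_mul {a : K} (ha : a ≠ 0) :
    D.vol.real {x | ‖a * x‖ ≤ 1} = (D.abs a)⁻¹ * D.vol.real {x | ‖x‖ ≤ 1} := by
  have hm : MeasurableSet {x : K | ‖a * x‖ ≤ 1} :=
    measurableSet_le (by fun_prop) measurable_const
  have h := hD.integral_comp_mul ha (Set.indicator {x : K | ‖x‖ ≤ 1} (1 : K → ℝ))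
  rw [integral_indicator_one (hD.measurableSet_norm_le 1)] at h
  rw [← integral_indicator_one hm, ← smul_eq_mul, ← h]
  rfl

lemma isBounded_ball_mul {a : K} (ha : a ≠ 0) : Bornology.IsBounded {x : K | ‖a * x‖ ≤ 1} := by
  refine (Metric.isBounded_closedBall (x := (0 : K)) (r := ‖a‖⁻¹)).subset fun x hx => ?_
  have h : ‖a‖ * ‖x‖ ≤ 1 := by simpa using hx
  simpa using (le_inv_mul_iff₀ (norm_pos_iff.2 ha)).2 h

/-- If `g` is square integrable and `O(1 / |x|)` at infinity, then the mean of its Fourier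
transform over small balls grows slower than any power of the inverse radius. -/
lemma setIntegral_ball_le_of_fourier {g h : K → ℂ} (hg : MemLp g 2 D.vol) (hh : MemLp h 2 D.vol)
    {C : ℝ} (hC : ∀ x, 1 ≤ ‖x‖ → ‖g x‖ ≤ C * (D.abs x)⁻¹)
    (hgh : ∀ f ∈ D.schwartz, ∫ x, h x * f x ∂D.vol = ∫ x, g x * D.fourier f x ∂D.vol)
    {ε : ℝ} (hε0 : 0 < ε) (hε1 : ε < 1) :
    ∃ M : ℝ, ∀ a : K, 1 ≤ ‖a‖ →
      ∫ x in {x | ‖a * x‖ ≤ 1}, ‖h x‖ ∂D.vol ≤ M * D.abs a ^ (ε - 1) := by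
  have := hD.haar
  have hmabs := hD.measurable_abs
  have hC0 : 0 ≤ C := by
    have h1 := hC 1 (by simp)
    rw [hD.abs_one, inv_one, mul_one] at h1
    exact (norm_nonneg _).trans h1
  set U : Set K := {x | 1 ≤ ‖x‖} with hU
  set B : Set K := {x | ‖x‖ ≤ 1} with hB
  have hUm : MeasurableSet U := hD.measurableSet_le_norm 1
  have hBm : MeasurableSet B := hD.measurableSet_norm_le 1
  have hBb : Bornology.IsBounded B := by simpa using hD.isBounded_ball_mul (one_ne_zero)
  -- An integrable majorant that just misses `1 / |x|`. For `1 ≤ |x| ≤ R` one has `1/|x| ≤ R^ε p`,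
  -- and for `|x| > R` one has `1/|x|² ≤ R^{ε-1} p`; these control the two halves of `g`.
  set p : K → ℝ := U.indicator fun x => D.abs x ^ (-ε - 1) with hp
  have hpint : Integrable p D.vol := by
    have h1 := hD.integrableOn_abs_rpow_of_neg (neg_lt_zero.2 hε0)
    rw [← integrable_indicator_iff hUm] at h1
    rw [hp, hD.integrable_vol]
    refine h1.congr ?_
    filter_upwards [hD.ae_mulHaar_ne_zero] with x hx
    by_cases hxU : x ∈ U
    · rw [Set.indicator_of_mem hxU, Set.indicator_of_mem hxU,
        Real.rpow_sub_one (hD.abs_pos hx).ne', smul_eq_mul, mul_div_cancel₀ _ (hD.abs_pos hx).ne']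
    · rw [Set.indicator_of_notMem hxU, Set.indicator_of_notMem hxU, smul_zero]
  have hp0 : ∀ x, 0 ≤ p x := fun x => Set.indicator_nonneg (fun x _ => by
    have := hD.abs_nonneg x; positivity) x
  set I := ∫ x, p x ∂D.vol with hI
  have hI0 : 0 ≤ I := integral_nonneg hp0
  have hgB : Integrable (B.indicator fun x => ‖g x‖) D.vol := by
    rw [integrable_indicator_iff hBm]
    exact (hD.integrableOn_of_memLp_two hg hBb).norm
  set J := ∫ x, B.indicator (fun x => ‖g x‖) x ∂D.vol with hJ
  have hJ0 : 0 ≤ J := integral_nonneg fun x => Set.indicator_nonneg (fun _ _ => norm_nonneg _) x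
  set V := D.vol.real B with hV
  have hV0 : 0 ≤ V := measureReal_nonneg
  refine ⟨(J + C * I) * V + √(C ^ 2 * I * V), fun a ha => ?_⟩
  have ha0 : a ≠ 0 := norm_pos_iff.1 (one_pos.trans_le ha)
  set R := D.abs a with hR
  have hR1 : 1 ≤ R := (hD.one_le_abs_iff a).2 ha
  have hR0 : 0 < R := one_pos.trans_le hR1
  set S : Set K := {x | ‖a * x‖ ≤ 1} with hS
  have hSm : MeasurableSet S := measurableSet_le (by fun_prop) measurable_const
  have hSb : Bornology.IsBounded S := hD.isBounded_ball_mul ha0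
  have hSV : D.vol.real S = R⁻¹ * V := hD.volReal_ball_mul ha0
  -- The cut is placed at `R = |a|`, the inverse of the size of the ball `S`.
  set A : Set K := {x | D.abs x ≤ R} with hA
  have hAm : MeasurableSet A := measurableSet_le hmabs measurable_const
  set g₁ := A.indicator g with hg₁
  set g₂ := Aᶜ.indicator g with hg₂
  have hgm := hg.1
  have b1 : ∀ x, ‖g₁ x‖ ≤ B.indicator (fun x => ‖g x‖) x + C * R ^ ε * p x := by
    intro x
    have hn1 : 0 ≤ B.indicator (fun x => ‖g x‖) x :=
      Set.indicator_nonneg (fun _ _ => norm_nonneg _) x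
    have hn2 : 0 ≤ C * R ^ ε * p x := mul_nonneg (by positivity) (hp0 x)
    by_cases hxA : x ∈ A
    · rw [hg₁, Set.indicator_of_mem hxA]
      rcases le_total ‖x‖ 1 with hx | hx
      · rw [Set.indicator_of_mem (show x ∈ B from hx)]
        exact le_add_of_nonneg_right hn2
      · refine le_add_of_nonneg_of_le hn1 ((hC x hx).trans ?_)
        have hx0 : x ≠ 0 := norm_pos_iff.1 (one_pos.trans_le hx)
        have hxp := hD.abs_pos hx0
        rw [hp, Set.indicator_of_mem (show x ∈ U from hx), mul_assoc]
        refine mul_le_mul_of_nonneg_left ?_ hC0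
        rw [Real.rpow_sub_one hxp.ne', Real.rpow_neg hxp.le, ← mul_div_assoc, ← div_eq_mul_inv,
          inv_eq_one_div]
        refine div_le_div_of_nonneg_right ?_ hxp.le
        rw [one_le_div (by positivity)]
        exact Real.rpow_le_rpow hxp.le hxA hε0.le
    · rw [hg₁, Set.indicator_of_notMem hxA, norm_zero]
      positivity
  have hg₁int : Integrable g₁ D.vol := by
    refine (hgB.add (hpint.const_mul (C * R ^ ε))).mono' (hgm.indicator hAm)
      (ae_of_all _ b1)
  have hM1 : ∫ x, ‖g₁ x‖ ∂D.vol ≤ J + C * R ^ ε * I := by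
    rw [hJ, hI, ← integral_const_mul, ← integral_add hgB (hpint.const_mul _)]
    exact integral_mono hg₁int.norm (hgB.add (hpint.const_mul _)) b1
  have hg₂mem : MemLp g₂ 2 D.vol := hg.indicator hAm.compl
  have b2 : ∀ x, ‖g₂ x‖ ^ 2 ≤ C ^ 2 * R ^ (ε - 1) * p x := by
    intro x
    by_cases hxA : x ∈ Aᶜ
    · have hRx : R < D.abs x := not_le.1 hxA
      have hx : 1 ≤ ‖x‖ := (hD.one_le_abs_iff x).1 (hR1.trans hRx.le)
      have hx0 : x ≠ 0 := norm_pos_iff.1 (one_pos.trans_le hx)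
      have hxp := hD.abs_pos hx0
      rw [hg₂, Set.indicator_of_mem hxA, hp, Set.indicator_of_mem (show x ∈ U from hx)]
      calc ‖g x‖ ^ 2 ≤ (C * (D.abs x)⁻¹) ^ 2 := pow_le_pow_left₀ (norm_nonneg _) (hC x hx) 2
        _ = C ^ 2 * D.abs x ^ (ε - 1) * D.abs x ^ (-ε - 1) := by
          rw [mul_assoc, ← Real.rpow_add hxp, mul_pow, ← Real.rpow_neg_one, ← Real.rpow_mul_natCast
            hxp.le]
          congr 2
          push_cast
          ring
        _ ≤ _ := by
          refine mul_le_mul_of_nonneg_right (mul_le_mul_of_nonneg_left ?_ (by positivity))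
            (by positivity)
          exact Real.rpow_le_rpow_of_nonpos hR0 hRx.le (by linarith)
    · rw [hg₂, Set.indicator_of_notMem hxA, norm_zero]
      have := hp0 x
      rw [zero_pow two_ne_zero]
      positivity
  have hM2 : (eLpNorm g₂ 2 D.vol).toReal ≤ √(C ^ 2 * R ^ (ε - 1) * I) := by
    refine Real.le_sqrt_of_sq_le ?_
    rw [sq_eLpNorm_two hg₂mem, hI, ← integral_const_mul]
    exact integral_mono ((memLp_two_iff_integrable_sq_norm hg₂mem.1).1 hg₂mem)
      (hpint.const_mul _) b2
  obtain ⟨h₂, hh₂, hh₂n, hh₂f⟩ := hD.exists_fourier_memLp_two hg₂mem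
  have hc := hD.continuous_fourier hg₁int
  -- `h` splits as a bounded continuous function plus a function of small `L²` norm.
  have hsum : h - D.fourier g₁ - h₂ =ᵐ[D.vol] 0 := by
    refine hD.ae_eq_zero _ (((hh.locallyIntegrable one_le_two).sub hc.locallyIntegrable).sub
      (hh₂.locallyIntegrable one_le_two)) fun k hk _ => ?_
    simp only [Pi.sub_apply, sub_mul]
    have hk1 := hD.schwartz_integrable hk
    have hk2 := hD.schwartz_memLp hk
    have hK := hD.fourier_mem k hk
    have i1 : Integrable (fun x => h x * k x) D.vol := hh.integrable_mul hk2
    have i2 : Integrable (fun x => D.fourier g₁ x * k x) D.vol :=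
      hk1.bdd_mul (c := ∫ x, ‖g₁ x‖ ∂D.vol) hc.aestronglyMeasurable
        (ae_of_all _ (hD.norm_fourier_le g₁))
    have i3 : Integrable (fun x => h₂ x * k x) D.vol := hh₂.integrable_mul hk2
    have j1 : Integrable (fun x => g₁ x * D.fourier k x) D.vol :=
      (hg.indicator hAm).integrable_mul (hD.schwartz_memLp hK)
    have j2 : Integrable (fun x => g₂ x * D.fourier k x) D.vol :=
      hg₂mem.integrable_mul (hD.schwartz_memLp hK)
    have i12 : Integrable (fun x => h x * k x - D.fourier g₁ x * k x) D.vol := i1.sub i2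
    rw [integral_sub i12 i3, integral_sub i1 i2, hgh k hk, hh₂f k hk,
      hD.integral_fourier_mul hg₁int hk1, sub_sub, ← integral_add j1 j2, sub_eq_zero]
    refine integral_congr_ae (ae_of_all _ fun x => ?_)
    simp only [← add_mul]
    congr 1
    exact (congrFun (Set.indicator_self_add_compl A g) x).symm
  have hle : ∫ x in S, ‖h x‖ ∂D.vol ≤ ∫ x in S, ((J + C * R ^ ε * I) + ‖h₂ x‖) ∂D.vol := by
    have i2 : IntegrableOn (fun x => ‖h₂ x‖) S D.vol := (hD.integrableOn_of_memLp_two hh₂ hSb).norm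
    have i0 : IntegrableOn (fun _ : K => J + C * R ^ ε * I) S D.vol :=
      integrableOn_const hSb.measure_lt_top.ne
    refine integral_mono_ae (hD.integrableOn_of_memLp_two hh hSb).norm (i0.add i2) ?_
    refine ae_restrict_of_ae ?_
    filter_upwards [hsum] with x hx
    have hx' : h x = D.fourier g₁ x + h₂ x := by
      simp only [Pi.sub_apply, Pi.zero_apply] at hx
      linear_combination hx
    rw [hx']
    refine (norm_add_le _ _).trans (add_le_add_left ((hD.norm_fourier_le g₁ x).trans hM1) _)
  have i2 : IntegrableOn (fun x => ‖h₂ x‖) S D.vol := (hD.integrableOn_of_memLp_two hh₂ hSb).norm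
  have i0 : IntegrableOn (fun _ : K => J + C * R ^ ε * I) S D.vol :=
    integrableOn_const hSb.measure_lt_top.ne
  rw [integral_add i0 i2, setIntegral_const, smul_eq_mul, hSV] at hle
  have h2 := hD.setIntegral_norm_le hh₂ hSm hSb
  rw [hSV] at h2
  have hRε : R ^ (ε - 1) = R⁻¹ * R ^ ε := by rw [Real.rpow_sub_one hR0.ne']; field_simp
  have hRε1 : 1 ≤ R ^ ε := Real.one_le_rpow hR1 hε0.le
  have c1 : R⁻¹ * V * (J + C * R ^ ε * I) ≤ (J + C * I) * V * R ^ (ε - 1) := by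
    rw [hRε]
    have : J ≤ J * R ^ ε := le_mul_of_one_le_right hJ0 hRε1
    have hR' : 0 ≤ R⁻¹ * V := by positivity
    nlinarith [mul_le_mul_of_nonneg_left this hR']
  -- Cauchy–Schwarz yields `√(R^{ε-1} R⁻¹)`, and `R⁻¹ ≤ R^{ε-1}` because `R ≥ 1`.
  have c2 : (eLpNorm h₂ 2 D.vol).toReal * √(R⁻¹ * V) ≤ √(C ^ 2 * I * V) * R ^ (ε - 1) := by
    calc (eLpNorm h₂ 2 D.vol).toReal * √(R⁻¹ * V)
        ≤ √(C ^ 2 * R ^ (ε - 1) * I) * √(R⁻¹ * V) :=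
          mul_le_mul_of_nonneg_right (hh₂n.trans hM2) (Real.sqrt_nonneg _)
      _ = √(C ^ 2 * I * V * (R ^ (ε - 1) * R⁻¹)) := by
          rw [← Real.sqrt_mul (by positivity)]; congr 1; ring
      _ ≤ √(C ^ 2 * I * V * (R ^ (ε - 1)) ^ 2) := by
          refine Real.sqrt_le_sqrt (mul_le_mul_of_nonneg_left ?_ (by positivity))
          rw [sq]
          refine mul_le_mul_of_nonneg_left ?_ (by positivity)
          rw [hRε]
          exact le_mul_of_one_le_right (by positivity) hRε1
      _ = _ := by rw [Real.sqrt_mul (by positivity), Real.sqrt_sq (by positivity)]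
  linarith

/-- Apply the bound on balls with `ε = m / 2`. On the `n`-th shell the weight `|x|^{m-1}` is at most
`|t|^{(n+1)(1-m)}` and the integral of `‖h‖` is `O(|t|^{n(m/2-1)})`, so the shells contribute a
geometric series of ratio `|t|^{-m/2}`. -/
lemma integrableOn_ball_of_fourier {g h : K → ℂ} (hg : MemLp g 2 D.vol) (hh : MemLp h 2 D.vol)
    {C : ℝ} (hC : ∀ x, 1 ≤ ‖x‖ → ‖g x‖ ≤ C * (D.abs x)⁻¹)
    (hgh : ∀ f ∈ D.schwartz, ∫ x, h x * f x ∂D.vol = ∫ x, g x * D.fourier f x ∂D.vol)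
    {m : ℝ} (hm0 : 0 < m) (hm1 : m < 1) :
    IntegrableOn (fun x => ‖h x‖ * D.abs x ^ m) {x | ‖x‖ ≤ 1} D.mulHaar := by
  have hmabs := hD.measurable_abs
  obtain ⟨M, hM⟩ := hD.setIntegral_ball_le_of_fourier hg hh hC hgh (half_pos hm0) (by linarith)
  obtain ⟨t, ht0, ht, hta⟩ := hD.exists_one_lt_abs
  have hta0 : 0 < D.abs t := one_pos.trans hta
  refine ⟨((hh.1.mono_ac hD.mulHaar_absolutelyContinuous).norm.mul
    (hD.aestronglyMeasurable_abs_rpow m _)).restrict, ?_⟩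
  rw [hasFiniteIntegral_iff_enorm]
  have h0 : D.mulHaar {0} = 0 := withDensity_absolutelyContinuous _ _ hD.vol_singleton
  refine lt_of_le_of_lt (hD.setLIntegral_ball_le_tsum ht _ h0 _) ?_
  set r : ℝ := D.abs t ^ (-(m / 2)) with hr
  have hr0 : 0 ≤ r := by positivity
  have hr1 : r < 1 := Real.rpow_lt_one_of_one_lt_of_neg hta (by linarith)
  set c : ℝ := D.abs t ^ (1 - m) with hc
  have hn : ∀ n : ℕ, ∫⁻ x in {x | ‖t‖⁻¹ ^ (n + 1) ≤ ‖x‖ ∧ ‖x‖ ≤ ‖t‖⁻¹ ^ n},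
      ‖‖h x‖ * D.abs x ^ m‖ₑ ∂D.mulHaar ≤ ENNReal.ofReal r ^ n * ENNReal.ofReal (c * M) := by
    intro n
    set T : Set K := {x | ‖t‖⁻¹ ^ (n + 1) ≤ ‖x‖ ∧ ‖x‖ ≤ ‖t‖⁻¹ ^ n} with hT
    set S : Set K := {x | ‖t ^ n * x‖ ≤ 1} with hS
    have htn : t ^ n ≠ 0 := pow_ne_zero _ ht0
    have hTm : MeasurableSet T := (measurableSet_le measurable_const measurable_norm).inter
      (measurableSet_le measurable_norm measurable_const)
    have hTS : T ⊆ S := by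
      intro x hx
      have h1 : ‖x‖ ≤ ‖t‖⁻¹ ^ n := hx.2
      rw [inv_pow] at h1
      have : ‖t‖ ^ n * ‖x‖ ≤ 1 := (le_inv_mul_iff₀ (by positivity)).1 (by simpa using h1)
      simpa [hS] using this
    have hSint := hD.integrableOn_of_memLp_two hh (hD.isBounded_ball_mul htn)
    rw [← lintegral_indicator hTm, hD.lintegral_mulHaar]
    have hb : ∀ x, ENNReal.ofReal (D.abs x)⁻¹ * T.indicator (fun x => ‖‖h x‖ * D.abs x ^ m‖ₑ) x ≤
        T.indicator (fun x => ENNReal.ofReal (D.abs t ^ ((n + 1 : ℝ) * (1 - m))) * ‖h x‖ₑ) x := by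
      intro x
      by_cases hx : x ∈ T
      · rw [Set.indicator_of_mem hx, Set.indicator_of_mem hx]
        have hxn : 0 < ‖x‖ := lt_of_lt_of_le (by positivity) hx.1
        have hxp := hD.abs_pos (norm_pos_iff.1 hxn)
        rw [enorm_mul, enorm_norm, Real.enorm_of_nonneg (by positivity), mul_comm ‖h x‖ₑ,
          ← mul_assoc, ← ENNReal.ofReal_mul (by positivity)]
        refine mul_le_mul_left (ENNReal.ofReal_le_ofReal ?_) _
        have h1 : (D.abs x)⁻¹ ≤ D.abs t ^ (n + 1 : ℝ) := by
          have : (D.abs t)⁻¹ ^ (n + 1) ≤ D.abs x := by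
            rw [hD.abs_eq, hD.abs_eq, ← inv_pow, ← pow_mul, mul_comm, pow_mul]
            exact pow_le_pow_left₀ (by positivity) hx.1 d
          rw [inv_pow] at this
          rw [← Nat.cast_add_one, Real.rpow_natCast]
          exact inv_le_of_inv_le₀ (by positivity) this
        calc (D.abs x)⁻¹ * D.abs x ^ m = (D.abs x)⁻¹ ^ (1 - m) := by
              rw [Real.inv_rpow hxp.le, Real.rpow_sub hxp, Real.rpow_one, inv_div]
              ring
          _ ≤ (D.abs t ^ (n + 1 : ℝ)) ^ (1 - m) :=
              Real.rpow_le_rpow (by positivity) h1 (by linarith)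
          _ = _ := by rw [← Real.rpow_mul hta0.le]
      · rw [Set.indicator_of_notMem hx, Set.indicator_of_notMem hx, mul_zero]
    have hMn := hM (t ^ n) (by rw [norm_pow]; exact one_le_pow₀ ht.le)
    have habs : D.abs (t ^ n) = D.abs t ^ n := by
      have := hD.abs_zpow t n
      simpa using this
    calc _ ≤ ∫⁻ x, T.indicator
          (fun x => ENNReal.ofReal (D.abs t ^ ((n + 1 : ℝ) * (1 - m))) * ‖h x‖ₑ) x ∂D.vol :=
          lintegral_mono hb
      _ = ENNReal.ofReal (D.abs t ^ ((n + 1 : ℝ) * (1 - m))) * ∫⁻ x in T, ‖h x‖ₑ ∂D.vol := by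
          rw [lintegral_indicator hTm, lintegral_const_mul' _ _ ENNReal.ofReal_ne_top]
      _ ≤ ENNReal.ofReal (D.abs t ^ ((n + 1 : ℝ) * (1 - m))) * ∫⁻ x in S, ‖h x‖ₑ ∂D.vol := by
          gcongr
      _ = ENNReal.ofReal (D.abs t ^ ((n + 1 : ℝ) * (1 - m)) * ∫ x in S, ‖h x‖ ∂D.vol) := by
          rw [ENNReal.ofReal_mul (by positivity), ofReal_integral_norm_eq_lintegral_enorm hSint]
      _ ≤ ENNReal.ofReal (D.abs t ^ ((n + 1 : ℝ) * (1 - m)) * (M * (D.abs t ^ n) ^ (m / 2 - 1))) := by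
          rw [habs] at hMn
          refine ENNReal.ofReal_le_ofReal (mul_le_mul_of_nonneg_left hMn (by positivity))
      _ = ENNReal.ofReal (r ^ n * (c * M)) := by
          congr 1
          rw [hr, hc, ← Real.rpow_natCast, ← Real.rpow_natCast, ← Real.rpow_mul hta0.le,
            ← Real.rpow_mul hta0.le]
          rw [show D.abs t ^ ((n + 1 : ℝ) * (1 - m)) * (M * D.abs t ^ ((n : ℝ) * (m / 2 - 1))) =
            M * (D.abs t ^ ((n + 1 : ℝ) * (1 - m)) * D.abs t ^ ((n : ℝ) * (m / 2 - 1))) by ring,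
            show D.abs t ^ (-(m / 2) * n) * (D.abs t ^ (1 - m) * M) =
            M * (D.abs t ^ (-(m / 2) * n) * D.abs t ^ (1 - m)) by ring,
            ← Real.rpow_add hta0, ← Real.rpow_add hta0]
          congr 2
          ring
      _ = _ := by rw [ENNReal.ofReal_mul (by positivity), ENNReal.ofReal_pow hr0]
  refine lt_of_le_of_lt (ENNReal.tsum_le_tsum hn) ?_
  rw [ENNReal.tsum_mul_right, ENNReal.tsum_geometric]
  refine ENNReal.mul_lt_top ?_ ENNReal.ofReal_lt_top
  rw [ENNReal.inv_lt_top, tsub_pos_iff_lt]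
  exact ENNReal.ofReal_lt_one.2 hr1

end LocalFieldData.IsTate

end framework


/-! ### The functional equation of the Hankel transform, and when it is defined -/

section framework

variable {K : Type*} [NontriviallyNormedField K] [MeasurableSpace K]
  {D : LocalFieldData K} {d : ℕ} [BorelSpace K] [ProperSpace K]

namespace LocalFieldData.IsLocal

variable (hD : D.IsLocal d)
include hD

/-- At infinity, factor `|f| |x|^a` as `(|f| |x|^b) · |x|^{a-b}`: both factors are square integrable
there because `a < b`. -/
lemma integrable_of_integrableOn_ball_of_sq {f : K → ℂ} (hf : AEStronglyMeasurable f D.vol)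
    {a b : ℝ} (hab : a < b)
    (h1 : IntegrableOn (fun x => ‖f x‖ * D.abs x ^ a) {x | ‖x‖ ≤ 1} D.mulHaar)
    (h2 : IntegrableOn (fun x => ‖f x‖ ^ 2 * D.abs x ^ (2 * b)) {x | 1 ≤ ‖x‖} D.mulHaar) :
    Integrable (fun x => ‖f x‖ * D.abs x ^ a) D.mulHaar := by
  have hu : {x : K | ‖x‖ ≤ 1} ∪ {x | 1 ≤ ‖x‖} = Set.univ := by
    ext x; simpa using le_total _ _
  rw [← integrableOn_univ, ← hu]
  refine h1.union ?_
  have h3 := hD.integrableOn_abs_rpow_of_neg (show 2 * (a - b) < 0 by linarith)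
  refine (h2.add h3).mono' ((hf.mono_ac hD.mulHaar_absolutelyContinuous).norm.mul
    (hD.aestronglyMeasurable_abs_rpow a _)).restrict ?_
  refine (ae_restrict_of_ae ?_)
  filter_upwards [hD.ae_mulHaar_ne_zero] with x hx
  have hp := hD.abs_pos hx
  have e1 : D.abs x ^ a = D.abs x ^ b * D.abs x ^ (a - b) := by
    rw [← Real.rpow_add hp]; congr 1; ring
  have e2 : D.abs x ^ (2 * b) = (D.abs x ^ b) ^ 2 := by
    rw [← Real.rpow_mul_natCast hp.le]; congr 1; push_cast; ring
  have e3 : D.abs x ^ (2 * (a - b)) = (D.abs x ^ (a - b)) ^ 2 := by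
    rw [← Real.rpow_mul_natCast hp.le]; congr 1; push_cast; ring
  rw [Real.norm_of_nonneg (by positivity), Pi.add_apply, e1, e2, e3]
  nlinarith [sq_nonneg (‖f x‖ * D.abs x ^ b - D.abs x ^ (a - b)),
    sq_nonneg (‖f x‖ * D.abs x ^ b), sq_nonneg (D.abs x ^ (a - b))]

lemma norm_hankelSymbol (s : ℂ) (φ : K → ℂ) {x : K} (hx : x ≠ 0) :
    ‖D.hankelSymbol s φ x‖ = D.abs x ^ (2 * s.re - 2) * ‖D.fourier φ x⁻¹‖ := by
  rw [hankelSymbol, norm_mul, Complex.norm_cpow_eq_rpow_re_of_pos (hD.abs_pos hx)]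
  simp

lemma aestronglyMeasurable_hankelSymbol (s : ℂ) {φ : K → ℂ} (hφ : Integrable φ D.vol) :
    AEStronglyMeasurable (D.hankelSymbol s φ) D.vol := by
  have h1 := (hD.continuous_fourier hφ).measurable
  have h2 := hD.measurable_abs
  have h3 : Measurable (D.hankelSymbol s φ) := by
    unfold hankelSymbol
    fun_prop
  exact h3.aestronglyMeasurable

/-- Substitute `y = 1/x`. The exponent `3 - 4 Re s` is written as twice `3/2 - 2 Re s`, the upper
limit of the exponents that Cauchy–Schwarz will reach. -/
lemma integrable_sq_hankelSymbol_iff (s : ℂ) (φ : K → ℂ) :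
    Integrable (fun x => ‖D.hankelSymbol s φ x‖ ^ 2) D.vol ↔
      Integrable (fun y => ‖D.fourier φ y‖ ^ 2 * D.abs y ^ (2 * (3 / 2 - 2 * s.re))) D.mulHaar := by
  rw [hD.integrable_vol, ← hD.integrable_inv fun y => ‖D.fourier φ y‖ ^ 2 * D.abs y ^ _]
  refine integrable_congr ?_
  filter_upwards [hD.ae_mulHaar_ne_zero] with x hx
  have hp := hD.abs_pos hx
  rw [hD.norm_hankelSymbol s φ hx, hD.abs_inv, Real.inv_rpow hp.le, ← Real.rpow_neg hp.le, mul_pow,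
    smul_eq_mul, ← mul_assoc, mul_comm (‖_‖ ^ 2)]
  congr 1
  have e : ∀ r : ℝ, D.abs x * D.abs x ^ r = D.abs x ^ (1 + r) := fun r => by
    rw [Real.rpow_add hp, Real.rpow_one]
  rw [← Real.rpow_mul_natCast hp.le, e]
  congr 1
  push_cast
  ring

lemma hankelSymbol_mul_quasi (s : ℂ) (φ : K → ℂ) (χ : Kˣ →ₜ* Circle) (μ : ℂ) (x : K) :
    D.hankelSymbol s φ x * D.quasi χ⁻¹ (1 - μ) x =
      D.fourier φ x⁻¹ * D.quasi χ (1 - 2 * s + μ) x⁻¹ := by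
  have h := hD.quasi_add χ⁻¹ (1 - μ) (2 * s - 2) x
  rw [hD.quasi_inv, show -(1 - 2 * s + μ) = 1 - μ + (2 * s - 2) by ring, h, hankelSymbol]
  ring

end LocalFieldData.IsLocal

namespace LocalFieldData.IsTate

variable (hD : D.IsTate d)
include hD

/-- On the connected half plane `Re w < 1` the factor is analytic and it does not vanish at `1/2`,
so its zeros are isolated. -/
lemma gamma_eventually_ne_zero (χ : Kˣ →ₜ* Circle) {z : ℂ} (hz : z.re < 1) :
    ∀ᶠ w in 𝓝[≠] z, D.gamma w χ ≠ 0 := by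
  have hH : IsPreconnected {w : ℂ | w.re < 1} :=
    (convex_halfSpace_re_lt 1).isPreconnected
  have han : AnalyticOnNhd ℂ (fun w => D.gamma w χ) {w : ℂ | w.re < 1} :=
    fun w hw => hD.gamma_analytic χ w hw
  by_contra h
  have h1 : ∃ᶠ w in 𝓝[≠] z, D.gamma w χ = 0 := by
    exact (Filter.not_eventually.1 h).mono fun w hw => not_not.1 hw
  have h2 := han.eqOn_zero_of_preconnected_of_frequently_eq_zero hH hz h1
  refine hD.gamma_ne_zero χ (w := 1 / 2) (by norm_num) (by norm_num) (h2 ?_)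
  norm_num

lemma isOpen_strip (s : ℂ) : IsOpen (strip s) :=
  (isOpen_lt continuous_const Complex.continuous_re).inter
    (isOpen_lt Complex.continuous_re continuous_const)

/-- The local functional equation of the Hankel transform. -/
theorem mellinIdentity {s : ℂ} (hs : s.re ≤ 1 / 2) {φ h : K → ℂ}
    (hφm : AEStronglyMeasurable φ D.vol)
    (hφ : ∀ m : ℝ, 0 < m → Integrable (fun x => ‖φ x‖ * D.abs x ^ m) D.mulHaar)
    (χ : Kˣ →ₜ* Circle) (hh : D.IsHankelTransform s φ h) : D.MellinIdentity s φ χ h := by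
  obtain ⟨hg, hh2, hgh⟩ := hh
  set F := D.fourier φ with hF
  set g := D.hankelSymbol s φ with hgdef
  have hφ1 : Integrable φ D.vol := (hD.integrable_norm_mul_abs_rpow_one hφm).1 (hφ 1 one_pos)
  have hFc : Continuous F := hD.continuous_fourier hφ1
  have hFm : AEStronglyMeasurable F D.vol := hFc.aestronglyMeasurable
  set M := ∫ x, ‖φ x‖ ∂D.vol with hM
  have hM0 : 0 ≤ M := integral_nonneg fun _ => norm_nonneg _
  have hFM : ∀ y, ‖F y‖ ≤ M := hD.norm_fourier_le φ
  have hF2 : Integrable (fun y => ‖F y‖ ^ 2 * D.abs y ^ (2 * (3 / 2 - 2 * s.re))) D.mulHaar :=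
    (hD.integrable_sq_hankelSymbol_iff s φ).1 ((memLp_two_iff_integrable_sq_norm hg.1).1 hg)
  -- With `κ = 1 - 2 Re s + Re μ` this range is exactly the strip for `μ`. Boundedness of `F` serves
  -- near `0`, square integrability of `g` at infinity.
  have hFint : ∀ κ : ℝ, 0 < κ → κ < 3 / 2 - 2 * s.re →
      Integrable (fun y => ‖F y‖ * D.abs y ^ κ) D.mulHaar := by
    intro κ h0 h1
    refine hD.integrable_of_integrableOn_ball_of_sq hFm h1 ?_ hF2.integrableOn
    refine ((hD.integrableOn_abs_rpow_of_pos h0).const_mul M).mono'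
      ((hFm.mono_ac hD.mulHaar_absolutelyContinuous).norm.mul
      (hD.aestronglyMeasurable_abs_rpow κ _)).restrict (ae_of_all _ fun y => ?_)
    have := hD.abs_nonneg y
    rw [Real.norm_of_nonneg (by positivity)]
    exact mul_le_mul_of_nonneg_right (hFM y) (by positivity)
  -- The hypothesis `Re s ≤ 1/2` enters here: `|x|^{2 Re s - 2} ≤ |x|⁻¹` for `|x| ≥ 1`.
  have hgC : ∀ x, 1 ≤ ‖x‖ → ‖g x‖ ≤ M * (D.abs x)⁻¹ := by
    intro x hx
    have hx0 : x ≠ 0 := norm_pos_iff.1 (one_pos.trans_le hx)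
    rw [hgdef, hD.norm_hankelSymbol s φ hx0, mul_comm, ← Real.rpow_neg_one]
    have h1 := (hD.one_le_abs_iff x).2 hx
    exact mul_le_mul (hFM _) (Real.rpow_le_rpow_of_exponent_le h1 (by linarith))
      (by positivity) hM0
  have hhint : ∀ m : ℝ, 0 < m → m < 1 / 2 →
      Integrable (fun x => ‖h x‖ * D.abs x ^ m) D.mulHaar := by
    intro m h0 h1
    refine hD.integrable_of_integrableOn_ball_of_sq hh2.1 h1
      (hD.integrableOn_ball_of_fourier hg hh2 hgC hgh h0 (by linarith)) ?_
    have h2 := (memLp_two_iff_integrable_sq_norm hh2.1).1 hh2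
    rw [hD.integrable_vol] at h2
    refine (h2.congr (ae_of_all _ fun x => ?_)).integrableOn
    simp only [mul_one_div_cancel (two_ne_zero (α := ℝ)), Real.rpow_one, smul_eq_mul, mul_comm]
  set γ : ℂ → ℂ := fun z => D.gamma z χ⁻¹ with hγ
  -- `G` links the two functional equations; it is an absolutely convergent integral on the whole
  -- strip, also where the integrals of `h` or of `φ` diverge.
  set G : ℂ → ℂ := fun μ => ∫ y, F y * D.quasi χ (1 - 2 * s + μ) y ∂D.mulHaar with hG
  have hre : ∀ μ : ℂ, (1 - 2 * s + μ).re = 1 - 2 * s.re + μ.re := fun μ => by simp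
  have hGd : DifferentiableOn ℂ G (strip s) := by
    intro μ hμ
    have h1 := hD.differentiableAt_integral_quasi hFm χ hFint (z := 1 - 2 * s + μ)
      (by rw [hre]; linarith [hμ.1]) (by rw [hre]; linarith [hμ.2])
    exact (h1.comp μ ((differentiableAt_const _).add differentiableAt_id)).differentiableWithinAt
  have hGa : ∀ μ ∈ strip s, AnalyticAt ℂ G μ := fun μ hμ =>
    hGd.analyticAt ((hD.isOpen_strip s).mem_nhds hμ)
  have hI : ∀ μ ∈ strip s, 0 < μ.re → Integrable (fun x => h x * D.quasi χ μ x) D.mulHaar ∧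
      ∫ x, h x * D.quasi χ μ x ∂D.mulHaar = γ (1 - μ) * G μ := by
    intro μ hμ h0
    have i1 : Integrable (fun x => h x * D.quasi χ μ x) D.mulHaar :=
      (hD.integrable_mul_quasi_iff hh2.1 χ μ).2 (hhint _ h0 hμ.2)
    have i2 : Integrable (fun y => F y * D.quasi χ (1 - 2 * s + μ) y) D.mulHaar :=
      (hD.integrable_mul_quasi_iff hFm χ _).2 (hFint _ (by rw [hre]; linarith [hμ.1])
        (by rw [hre]; linarith [hμ.2]))
    have eg : (fun x => g x * D.quasi χ⁻¹ (1 - μ) x) =ᵐ[D.mulHaar]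
        fun x => F x⁻¹ * D.quasi χ (1 - 2 * s + μ) x⁻¹ := ae_of_all _ (hD.hankelSymbol_mul_quasi s φ χ μ)
    have i3 : Integrable (fun x => g x * D.quasi χ⁻¹ (1 - μ) x) D.mulHaar :=
      (integrable_congr eg).2 ((hD.integrable_inv fun y => F y * D.quasi χ _ y).2 i2)
    have h1 := hD.mellin_eq_gamma_mul hgh χ⁻¹ (w := 1 - μ) (by simp; linarith [hμ.2])
      (by simpa using h0) (by rwa [inv_inv, sub_sub_cancel]) i3
    rw [inv_inv, sub_sub_cancel, integral_congr_ae eg,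
      hD.integral_inv fun y => F y * D.quasi χ _ y] at h1
    exact ⟨i1, h1⟩
  have hII : ∀ w : ℂ, 2 * s - w ∈ strip s → 0 < w.re →
      Integrable (fun x => φ x * D.quasi χ⁻¹ w x) D.mulHaar ∧
      G (2 * s - w) = γ w * ∫ x, φ x * D.quasi χ⁻¹ w x ∂D.mulHaar := by
    intro w hw h0
    have hw1 : 2 * s.re - 1 < 2 * s.re - w.re := by simpa using hw.1
    have hw2 : 2 * s.re - w.re < 1 / 2 := by simpa using hw.2
    have i1 : Integrable (fun x => φ x * D.quasi χ⁻¹ w x) D.mulHaar :=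
      (hD.integrable_mul_quasi_iff hφm χ⁻¹ w).2 (hφ _ h0)
    have i2 : Integrable (fun y => F y * D.quasi χ (1 - w) y) D.mulHaar :=
      (hD.integrable_mul_quasi_iff hFm χ _).2 (hFint _ (by simp; linarith) (by simp; linarith))
    have h1 := hD.mellin_eq_gamma_mul (u := F) (v := φ)
      (fun k hk => hD.integral_fourier_mul hφ1 (hD.schwartz_integrable hk)) χ⁻¹ (w := w) h0
      (by linarith) (by rwa [inv_inv]) i1
    rw [inv_inv] at h1
    refine ⟨i1, ?_⟩
    rw [← h1, hG]
    simp only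
    rw [show 1 - 2 * s + (2 * s - w) = 1 - w by ring]
  have hγan : ∀ z : ℂ, z.re < 1 → AnalyticAt ℂ γ z := hD.gamma_analytic χ⁻¹
  have hγm : ∀ z, MeromorphicAt γ z := hD.gamma_meromorphic χ⁻¹
  have hsub : ∀ c z : ℂ, AnalyticAt ℂ (fun w => c - w) z := fun c z =>
    analyticAt_const.sub analyticAt_id
  -- The continuations are defined from `G`. Passing to the meromorphic normal form only prescribes
  -- the values at removable singularities and poles, and changes nothing at points of analyticity
  -- (`hval`).
  set A₀ : ℂ → ℂ := fun μ => γ (1 - μ) * G μ with hA₀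
  have hA₀m : MeromorphicOn A₀ (strip s) := fun μ hμ =>
    ((hγm (1 - μ)).comp_analyticAt (hsub 1 μ)).mul (hGa μ hμ).meromorphicAt
  set U : Set ℂ := {w | 2 * s - w ∈ strip s} with hU
  set B₀ : ℂ → ℂ := fun w => G (2 * s - w) / γ w with hB₀
  have hGU : ∀ w ∈ U, AnalyticAt ℂ (fun w => G (2 * s - w)) w := fun w hw =>
    (hGa _ hw).fun_comp (hsub _ w)
  have hB₀m : MeromorphicOn B₀ U := fun w hw =>
    (hGU w hw).meromorphicAt.div (hγm w)
  have hUre : ∀ w ∈ U, w.re < 1 := fun w hw => by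
    have : 2 * s.re - 1 < 2 * s.re - w.re := by simpa using hw.1
    linarith
  have hval : ∀ {f : ℂ → ℂ} {V : Set ℂ} {z : ℂ}, MeromorphicOn f V → z ∈ V → AnalyticAt ℂ f z →
      toMeromorphicNFOn f V z = f z := fun hf hz ha => by
    rw [toMeromorphicNFOn_eq_toMeromorphicNFAt hf hz, toMeromorphicNFAt_eq_self.2 ha.meromorphicNFAt]
  set A := toMeromorphicNFOn A₀ (strip s) with hA
  set B := toMeromorphicNFOn B₀ U with hB
  -- A punctured neighbourhood is needed because `B` was obtained by dividing by `γ`, which may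
  -- vanish at isolated points.
  have hGB : ∀ μ ∈ strip s, ∀ᶠ ν in 𝓝[≠] μ, G ν = γ (2 * s - ν) * B (2 * s - ν) := by
    intro μ hμ
    have hμU : 2 * s - μ ∈ U := by simpa [hU] using hμ
    have ht : Tendsto (fun ν => 2 * s - ν) (𝓝[≠] μ) (𝓝[≠] (2 * s - μ)) := by
      refine tendsto_nhdsWithin_iff.2 ⟨?_, ?_⟩
      · exact ((hsub (2 * s) μ).continuousAt.tendsto).mono_left nhdsWithin_le_nhds
      · filter_upwards [self_mem_nhdsWithin] with ν hν
        intro h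
        exact hν (sub_right_injective h)
    filter_upwards [ht.eventually (hB₀m.toMeromorphicNFOn_eq_self_on_nhdsNE hμU),
      ht.eventually (hD.gamma_eventually_ne_zero χ⁻¹ (hUre _ hμU))] with ν h1 h2
    rw [hB, h1, hB₀]
    simp only [sub_sub_cancel]
    rw [mul_div_cancel₀ _ h2]
  refine ⟨A, B, ⟨meromorphicNFOn_toMeromorphicNFOn _ _, ?_⟩,
    ⟨meromorphicNFOn_toMeromorphicNFOn _ _, ?_⟩, ?_, ?_⟩
  · intro μ hμ h0
    obtain ⟨h1, h2⟩ := hI μ hμ h0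
    rw [hD.integrable_mellinIntegrand, hD.integral_mellinIntegrand]
    refine ⟨h1, ?_⟩
    rw [h2, hA, hval hA₀m hμ]
    exact ((hγan (1 - μ) (by simpa using h0)).fun_comp (hsub 1 μ)).mul (hGa μ hμ)
  · intro w hw h0
    obtain ⟨h1, h2⟩ := hII w hw h0
    rw [hD.integrable_mellinIntegrand, hD.integral_mellinIntegrand]
    refine ⟨h1, ?_⟩
    have hne : γ w ≠ 0 := hD.gamma_ne_zero χ⁻¹ h0 (hUre w hw)
    rw [hB, hval hB₀m hw, hB₀]
    · simp only
      rw [h2, mul_div_cancel_left₀ _ hne]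
    · exact (hGU w hw).div (hγan w (hUre w hw)) hne
  · intro μ hμ
    filter_upwards [hA₀m.toMeromorphicNFOn_eq_self_on_nhdsNE hμ, hGB μ hμ] with ν h1 h2
    rw [hA, h1, hA₀]
    simp only
    rw [h2]
    ring
  · intro μ hμ h1 h2
    have hμU : 2 * s - μ ∈ U := by simpa [hU] using hμ
    have e1 : A μ = γ (1 - μ) * G μ := by
      rw [hA, hval hA₀m hμ]
      exact (h1.fun_comp (hsub 1 μ)).mul (hGa μ hμ)
    have c1 : ContinuousAt (fun ν => γ (2 * s - ν) * B (2 * s - ν)) μ :=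
      (((hγan _ (hUre _ hμU)).fun_comp (hsub _ μ)).mul (h2.fun_comp (hsub _ μ))).continuousAt
    -- Both sides are continuous at `μ` and agree nearby. The factor `γ(2s - μ)` never has a pole
    -- here since `Re (2s - μ) < 1` on the strip.
    have e2 : G μ = γ (2 * s - μ) * B (2 * s - μ) :=
      tendsto_nhds_unique_of_eventuallyEq
        ((hGa μ hμ).continuousAt.tendsto.mono_left nhdsWithin_le_nhds)
        (c1.tendsto.mono_left nhdsWithin_le_nhds) (hGB μ hμ)
    rw [e1, e2]
    ring

/-- The integral of `|φ̂|² |y|^{3 - 4 Re s}` for `dy/|y|` converges near `0` by boundedness of `φ̂`;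
at infinity the integrand is `O(|y|^{1 - 4 Re s - 2b})`, and the exponent is negative exactly when
`b > 1/2 - 2 Re s`. -/
lemma memLp_hankelSymbol_of_decay {s : ℂ} (hs : s.re ≤ 1 / 2) {φ : K → ℂ}
    (hφ : Integrable φ D.vol) {b C : ℝ} (hb : 1 / 2 - 2 * s.re < b)
    (hC : ∀ y, 1 ≤ ‖y‖ → ‖D.fourier φ y‖ ≤ C * D.abs y ^ (-1 - b)) :
    MemLp (D.hankelSymbol s φ) 2 D.vol := by
  rw [memLp_two_iff_integrable_sq_norm (hD.aestronglyMeasurable_hankelSymbol s hφ),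
    hD.integrable_sq_hankelSymbol_iff]
  set M := ∫ x, ‖φ x‖ ∂D.vol
  have hFc := hD.continuous_fourier hφ
  refine hD.integrable_of_le_rpow (a := 3 - 4 * s.re) (b := 1 - 4 * s.re - 2 * b)
    (C := M ^ 2 + C ^ 2) ((hFc.norm.pow 2).aestronglyMeasurable.mul
      (hD.aestronglyMeasurable_abs_rpow _ _)) (by linarith) (by linarith) ?_ ?_
  · intro y hy _
    have hp := hD.abs_pos hy
    rw [abs_of_nonneg (by positivity), show 2 * (3 / 2 - 2 * s.re) = 3 - 4 * s.re by ring]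
    refine mul_le_mul_of_nonneg_right ?_ (by positivity)
    have := pow_le_pow_left₀ (norm_nonneg _) (hD.norm_fourier_le φ y) 2
    nlinarith [sq_nonneg C]
  · intro y hy
    have hp := hD.abs_pos (norm_pos_iff.1 (one_pos.trans_le hy))
    rw [abs_of_nonneg (by positivity)]
    have h1 := pow_le_pow_left₀ (norm_nonneg _) (hC y hy) 2
    rw [mul_pow, ← Real.rpow_mul_natCast hp.le] at h1
    calc ‖D.fourier φ y‖ ^ 2 * D.abs y ^ (2 * (3 / 2 - 2 * s.re))
        ≤ C ^ 2 * D.abs y ^ ((-1 - b) * (2 : ℕ)) * D.abs y ^ (2 * (3 / 2 - 2 * s.re)) :=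
          mul_le_mul_of_nonneg_right h1 (by positivity)
      _ = C ^ 2 * D.abs y ^ (1 - 4 * s.re - 2 * b) := by
          rw [mul_assoc, ← Real.rpow_add hp]
          congr 2
          push_cast
          ring
      _ ≤ _ := mul_le_mul_of_nonneg_right (by nlinarith [sq_nonneg M]) (by positivity)

/-- On this line `|y|^{3 - 4 Re s} dy/|y|` is `dy`, so the claim is that `φ̂` is square integrable.
-/
lemma memLp_hankelSymbol_of_memLp_two {s : ℂ} (hs : s.re = 1 / 2) {φ : K → ℂ}
    (hφ : Integrable φ D.vol) (hφ2 : MemLp φ 2 D.vol) :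
    MemLp (D.hankelSymbol s φ) 2 D.vol := by
  have h := hD.memLp_two_fourier hφ hφ2
  rw [memLp_two_iff_integrable_sq_norm h.1, hD.integrable_vol] at h
  rw [memLp_two_iff_integrable_sq_norm (hD.aestronglyMeasurable_hankelSymbol s hφ),
    hD.integrable_sq_hankelSymbol_iff]
  refine h.congr (ae_of_all _ fun x => ?_)
  simp only [hs, show 2 * (3 / 2 - 2 * (1 / 2)) = (1 : ℝ) by norm_num, Real.rpow_one, smul_eq_mul,
    mul_comm]

section rho

variable {T : Set (K → ℂ)} (hT : ∀ f ∈ T, AEStronglyMeasurable f D.vol ∧ RapidDecay f) {s : ℂ}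
  (hs : s.re ≤ 1 / 2)
include hT

lemma integrable_log_mul_rpow {f : K → ℂ} (hf : f ∈ T) {m : ℝ} (hm : 0 < m) :
    Integrable (fun x => ‖(Real.log (D.abs x) : ℂ) * f x‖ * D.abs x ^ m) D.mulHaar := by
  have hmabs := hD.measurable_abs
  obtain ⟨h1, h2⟩ := hT f hf
  have hlog : Measurable fun x => (Real.log (D.abs x) : ℂ) := by fun_prop
  have i1 := hD.integrable_rapidDecay h2 h1 (half_pos hm)
  have i2 := hD.integrable_rapidDecay h2 h1 (show 0 < m + m / 2 by linarith)
  refine ((i1.add i2).const_mul (m / 2)⁻¹).mono'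
    (((hlog.aestronglyMeasurable.mul (h1.mono_ac hD.mulHaar_absolutelyContinuous)).norm).mul
      (hD.aestronglyMeasurable_abs_rpow _ _)) ?_
  filter_upwards [hD.ae_mulHaar_ne_zero] with x hx
  have hp := hD.abs_pos hx
  rw [Real.norm_of_nonneg (by positivity), norm_mul, Complex.norm_real, Real.norm_eq_abs]
  calc |Real.log (D.abs x)| * ‖f x‖ * D.abs x ^ m
      ≤ (m / 2)⁻¹ * (D.abs x ^ (-(m / 2)) + D.abs x ^ (m / 2)) * ‖f x‖ * D.abs x ^ m := by
        gcongr
        exact abs_log_le hp (half_pos hm)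
    _ = _ := by
        have e1 : D.abs x ^ (m / 2) * D.abs x ^ (m / 2) = D.abs x ^ m := by
          rw [← Real.rpow_add hp]; congr 1; ring
        have e2 : D.abs x ^ (-(m / 2)) * D.abs x ^ (m / 2) = 1 := by
          rw [← Real.rpow_add hp]; simp
        simp only [Pi.add_apply]
        rw [Real.rpow_add hp, ← e1]
        linear_combination (m / 2)⁻¹ * ‖f x‖ * D.abs x ^ (m / 2) * e2

include hs

lemma aestronglyMeasurable_of_mem_rhoSpace {φ : K → ℂ} (hφ : φ ∈ D.rhoSpace T s) :
    AEStronglyMeasurable φ D.vol := by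
  classical
  have hmabs := hD.measurable_abs
  obtain ⟨f₁, hf₁, f₂, hf₂, hφ⟩ := hφ
  have hm : Measurable fun x => (if 1 - 2 * s ≠ 0 then (D.abs x : ℂ) ^ (1 - 2 * s)
      else (Real.log (D.abs x) : ℂ)) := by
    split_ifs <;> fun_prop
  refine ((hT f₁ hf₁).1.add (hm.aestronglyMeasurable.mul (hT f₂ hf₂).1)).congr ?_
  filter_upwards [hD.ae_ne_zero] with x hx
  rw [hφ x hx]
  rfl

lemma integrable_of_mem_rhoSpace {φ : K → ℂ} (hφ : φ ∈ D.rhoSpace T s) {m : ℝ} (hm : 0 < m) :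
    Integrable (fun x => ‖φ x‖ * D.abs x ^ m) D.mulHaar := by
  have hφm := hD.aestronglyMeasurable_of_mem_rhoSpace hT hs hφ
  obtain ⟨f₁, hf₁, f₂, hf₂, hφ⟩ := hφ
  have i1 := hD.integrable_rapidDecay (hT f₁ hf₁).2 (hT f₁ hf₁).1 hm
  have hmeas : AEStronglyMeasurable (fun x => ‖φ x‖ * D.abs x ^ m) D.mulHaar :=
    (hφm.mono_ac hD.mulHaar_absolutelyContinuous).norm.mul (hD.aestronglyMeasurable_abs_rpow _ _)
  by_cases hc : 1 - 2 * s ≠ 0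
  · have i2 := hD.integrable_rapidDecay (hT f₂ hf₂).2 (hT f₂ hf₂).1
      (show 0 < (1 - 2 * s.re) + m by linarith)
    refine (i1.add i2).mono' hmeas ?_
    filter_upwards [hD.ae_mulHaar_ne_zero] with x hx
    have hp := hD.abs_pos hx
    rw [Real.norm_of_nonneg (by positivity), hφ x hx, if_pos hc, Pi.add_apply, Real.rpow_add hp]
    refine (mul_le_mul_of_nonneg_right (norm_add_le _ _) (by positivity)).trans (le_of_eq ?_)
    rw [norm_mul, Complex.norm_cpow_eq_rpow_re_of_pos hp]
    simp
    ring
  · have i2 := hD.integrable_log_mul_rpow hT hf₂ hm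
    refine (i1.add i2).mono' hmeas ?_
    filter_upwards [hD.ae_mulHaar_ne_zero] with x hx
    have hp := hD.abs_pos hx
    rw [Real.norm_of_nonneg (by positivity), hφ x hx, if_neg hc, Pi.add_apply, ← add_mul]
    exact mul_le_mul_of_nonneg_right (norm_add_le _ _) (by positivity)

omit hs in
-- For `Re s = 1/2` the factor `|x|^{1-2s}` has absolute value one, and at `s = 1/2` the logarithm
-- is harmless for square integrability.
lemma memLp_two_of_mem_rhoSpace (hs' : s.re = 1 / 2) {φ : K → ℂ} (hφ : φ ∈ D.rhoSpace T s) :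
    MemLp φ 2 D.vol := by
  have hmabs := hD.measurable_abs
  obtain ⟨f₁, hf₁, f₂, hf₂, hφ⟩ := hφ
  have m1 := hD.memLp_two_rapidDecay (hT f₁ hf₁).2 (hT f₁ hf₁).1
  have hf2m := (hT f₂ hf₂).1
  suffices h : MemLp (fun x => (if 1 - 2 * s ≠ 0 then (D.abs x : ℂ) ^ (1 - 2 * s)
      else (Real.log (D.abs x) : ℂ)) * f₂ x) 2 D.vol by
    refine (m1.add h).ae_eq ?_
    filter_upwards [hD.ae_ne_zero] with x hx
    rw [hφ x hx]
    rfl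
  by_cases hc : 1 - 2 * s ≠ 0
  · simp only [if_pos hc]
    have hm : Measurable fun x => (D.abs x : ℂ) ^ (1 - 2 * s) := by fun_prop
    refine (hD.memLp_two_rapidDecay (hT f₂ hf₂).2 hf2m).congr_norm
      (hm.aestronglyMeasurable.mul hf2m) ?_
    filter_upwards [hD.ae_ne_zero] with x hx
    rw [norm_mul, Complex.norm_cpow_eq_rpow_re_of_pos (hD.abs_pos hx)]
    simp [hs']
  · simp only [if_neg hc]
    have hm : Measurable fun x => (Real.log (D.abs x) : ℂ) := by fun_prop
    have hm2 : AEStronglyMeasurable (fun x => (Real.log (D.abs x) : ℂ) * f₂ x) D.vol :=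
      hm.aestronglyMeasurable.mul hf2m
    rw [memLp_two_iff_integrable_sq_norm hm2, hD.integrable_vol]
    obtain ⟨C, hC0, hC, -⟩ := hD.rapidDecay_le (hT f₂ hf₂).2 0
    -- One of the two factors `L` in `L²` is bounded by a multiple of `|x|^{-1/4} + |x|^{1/4}`; with
    -- `|x|` from the measure this leaves the exponents `3/4` and `5/4`.
    have i1 := hD.integrable_log_mul_rpow hT hf₂ (show (0 : ℝ) < 3 / 4 by norm_num)
    have i2 := hD.integrable_log_mul_rpow hT hf₂ (show (0 : ℝ) < 5 / 4 by norm_num)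
    refine ((i1.add i2).const_mul (4 * C)).mono'
      ((hD.continuous_abs.aestronglyMeasurable).smul
        ((hm2.mono_ac hD.mulHaar_absolutelyContinuous).norm.pow 2)) ?_
    filter_upwards [hD.ae_mulHaar_ne_zero] with x hx
    have hp := hD.abs_pos hx
    rw [smul_eq_mul, Real.norm_of_nonneg (by positivity)]
    set L := ‖(Real.log (D.abs x) : ℂ) * f₂ x‖ with hL
    have e1 : D.abs x ^ (3 / 4 : ℝ) = D.abs x * D.abs x ^ (-(1 / 4) : ℝ) := by
      rw [← Real.rpow_one_add' hp.le (by norm_num)]; norm_num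
    have e2 : D.abs x ^ (5 / 4 : ℝ) = D.abs x * D.abs x ^ (1 / 4 : ℝ) := by
      rw [← Real.rpow_one_add' hp.le (by norm_num)]; norm_num
    have hLle : L ≤ 4 * (D.abs x ^ (-(1 / 4) : ℝ) + D.abs x ^ (1 / 4 : ℝ)) * C := by
      rw [hL, norm_mul, Complex.norm_real, Real.norm_eq_abs]
      have h1 := abs_log_le hp (show (0 : ℝ) < 1 / 4 by norm_num)
      rw [show ((1 : ℝ) / 4)⁻¹ = 4 by norm_num] at h1
      exact mul_le_mul h1 (hC x hx) (norm_nonneg _) (by positivity)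
    have hL0 : 0 ≤ L := norm_nonneg _
    rw [Pi.add_apply, e1, e2]
    calc D.abs x * L ^ 2 = D.abs x * L * L := by ring
      _ ≤ D.abs x * L * (4 * (D.abs x ^ (-(1 / 4) : ℝ) + D.abs x ^ (1 / 4 : ℝ)) * C) :=
        mul_le_mul_of_nonneg_left hLle (by positivity)
      _ = _ := by ring

/-- The Mellin transform identities for all functions built from rapidly decreasing functions. -/
lemma mellinIdentity_of_mem_rhoSpace {φ h : K → ℂ} (hφ : φ ∈ D.rhoSpace T s)
    (χ : Kˣ →ₜ* Circle) (hh : D.IsHankelTransform s φ h) : D.MellinIdentity s φ χ h :=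
  hD.mellinIdentity hs (hD.aestronglyMeasurable_of_mem_rhoSpace hT hs hφ)
    (fun _ hm => hD.integrable_of_mem_rhoSpace hT hs hφ hm) χ hh

/-- The Hankel transform is defined on `T + |x|^{1-2s} T` as soon as the Fourier transforms of the
two summands decay sufficiently fast. -/
lemma exists_hankel_of_mem_rhoSpace {b : ℝ} (hb : 1 / 2 - 2 * s.re < b)
    (hdec : s.re < 1 / 2 → ∀ f ∈ T, ∀ β : ℂ, (β = 0 ∨ β = 1 - 2 * s) →
      ∃ C, ∀ y, 1 ≤ ‖y‖ →
        ‖D.fourier (fun x => (D.abs x : ℂ) ^ β * f x) y‖ ≤ C * D.abs y ^ (-1 - b))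
    {φ : K → ℂ} (hφ : φ ∈ D.rhoSpace T s) : ∃ h, D.IsHankelTransform s φ h := by
  have hφm := hD.aestronglyMeasurable_of_mem_rhoSpace hT hs hφ
  have hφ1 : Integrable φ D.vol := (hD.integrable_norm_mul_abs_rpow_one hφm).1
    (hD.integrable_of_mem_rhoSpace hT hs hφ one_pos)
  refine hD.exists_isHankelTransform ?_
  -- The logarithmic case `s = 1/2` lies on the line `Re s = 1/2`, where Plancherel suffices; below
  -- it only the power `|x|^{1-2s}` occurs.
  rcases hs.eq_or_lt with hs' | hs'
  · exact hD.memLp_hankelSymbol_of_memLp_two hs' hφ1 (hD.memLp_two_of_mem_rhoSpace hT hs' hφ)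
  have hmabs := hD.measurable_abs
  obtain ⟨f₁, hf₁, f₂, hf₂, hφ⟩ := hφ
  have hc : 1 - 2 * s ≠ 0 := by
    intro h
    have := congrArg Complex.re h
    simp at this
    linarith
  obtain ⟨C₁, hC₁⟩ := hdec hs' f₁ hf₁ 0 (Or.inl rfl)
  obtain ⟨C₂, hC₂⟩ := hdec hs' f₂ hf₂ _ (Or.inr rfl)
  refine hD.memLp_hankelSymbol_of_decay hs hφ1 hb (C := C₁ + C₂) fun y hy => ?_
  have hint : ∀ f ∈ T, ∀ β : ℂ, 0 ≤ β.re →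
      Integrable (fun x => (D.abs x : ℂ) ^ β * f x) D.vol := by
    intro f hf β hβ
    have hm : AEStronglyMeasurable (fun x => (D.abs x : ℂ) ^ β * f x) D.vol :=
      Measurable.aestronglyMeasurable (by fun_prop) |>.mul (hT f hf).1
    refine (hD.integrable_norm_mul_abs_rpow_one hm).1 ?_
    refine (hD.integrable_rapidDecay (hT f hf).2 (hT f hf).1
      (show 0 < β.re + 1 by linarith)).congr ?_
    filter_upwards [hD.ae_mulHaar_ne_zero] with x hx
    have hp := hD.abs_pos hx
    rw [norm_mul, Complex.norm_cpow_eq_rpow_re_of_pos hp, Real.rpow_add hp]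
    ring
  have e : D.fourier φ y = D.fourier (fun x => (D.abs x : ℂ) ^ (0 : ℂ) * f₁ x) y +
      D.fourier (fun x => (D.abs x : ℂ) ^ (1 - 2 * s) * f₂ x) y := by
    rw [← hD.fourier_add (hint f₁ hf₁ 0 (by simp)) (hint f₂ hf₂ _ (by simp; linarith))]
    refine integral_congr_ae ?_
    filter_upwards [hD.ae_ne_zero] with x hx
    rw [hφ x hx, if_pos hc]
    simp
  rw [e, add_mul]
  exact (norm_add_le _ _).trans (add_le_add (hC₁ y hy) (hC₂ y hy))

end rho

lemma schwartzUnits_rapidDecay {f : K → ℂ} (hf : f ∈ D.schwartzUnits) :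
    AEStronglyMeasurable f D.vol ∧ RapidDecay f := by
  obtain ⟨g, hg, hfg⟩ := hf
  refine ⟨(hD.schwartz_aesm hg D.vol).congr ?_, fun N => ?_⟩
  · filter_upwards [hD.ae_ne_zero] with x hx
    exact (hfg x hx).symm
  · obtain ⟨C, hC⟩ := hD.schwartz_decay g hg N
    exact ⟨C, fun x hx => by rw [hfg x hx]; exact hC x hx⟩

/-- The local functional equation on the `ρ`-Schwartz space, given the decay of the Fourier
transforms of the functions `|x|^β f(x)`. -/
theorem hankel_of_schwartzRho
    (hdec : ∀ f ∈ D.schwartz, ∀ β : ℂ, 0 < β.re → ∃ C, ∀ y, 1 ≤ ‖y‖ →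
      ‖D.fourier (fun x => (D.abs x : ℂ) ^ β * f x) y‖ ≤ C * D.abs y ^ (-1 - β.re))
    (s : ℂ) (hs : s.re ≤ 1 / 2) (φ : K → ℂ) (hφ : φ ∈ D.schwartzRho s) :
    (∃ h, D.IsHankelTransform s φ h) ∧ ∀ (h : K → ℂ) (χ : Kˣ →ₜ* Circle),
      D.IsHankelTransform s φ h → D.MellinIdentity s φ χ h := by
  have hT : ∀ f ∈ D.schwartzUnits, AEStronglyMeasurable f D.vol ∧ RapidDecay f :=
    fun f hf => hD.schwartzUnits_rapidDecay hf
  refine ⟨?_, fun h χ hh => hD.mellinIdentity_of_mem_rhoSpace hT hs hφ χ hh⟩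
  -- This is the decay supplied by the singular summand `|x|^{1-2s} f`; it exceeds the required `1/2
  -- - 2 Re s` by `1/2`. The Schwartz summand decays faster than any power.
  refine hD.exists_hankel_of_mem_rhoSpace hT hs (b := 1 - 2 * s.re) (by linarith) ?_ hφ
  intro hs' f hf β hβ
  obtain ⟨g, hg, hfg⟩ := hf
  have e : ∀ y, D.fourier (fun x => (D.abs x : ℂ) ^ β * f x) y =
      D.fourier (fun x => (D.abs x : ℂ) ^ β * g x) y := by
    intro y
    refine integral_congr_ae ?_
    filter_upwards [hD.ae_ne_zero] with x hx
    rw [hfg x hx]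
  simp only [e]
  rcases hβ with rfl | rfl
  · obtain ⟨C, -, -, hC⟩ := hD.rapidDecay_le (hD.schwartz_decay _ (hD.fourier_mem g hg))
      (1 + (1 - 2 * s.re))
    refine ⟨C, fun y hy => ?_⟩
    simp only [Complex.cpow_zero, one_mul]
    refine (hC y hy).trans (le_of_eq ?_)
    congr 2
    ring
  · obtain ⟨C, hC⟩ := hdec g hg (1 - 2 * s) (by simp; linarith)
    refine ⟨C, fun y hy => ?_⟩
    simpa using hC y hy

end LocalFieldData.IsTate

end framework


/-! ### Nonarchimedean fields: value group, conductors, module of Haar measure -/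

section nonarchField

variable {K : Type*} [NontriviallyNormedField K] [IsUltrametricDist K]

lemma IsNormalizedUniformizer.one_lt_resCard {ϖ : Kˣ} (h : IsNormalizedUniformizer ϖ) :
    1 < resCard K := by
  have h0 : resCard K ≠ 0 := by
    intro h0
    have := h.1
    rw [h0, Nat.cast_zero, inv_zero, norm_eq_zero] at this
    exact ϖ.ne_zero this
  have : Finite 𝓀[K] := Nat.finite_of_card_ne_zero h0
  exact Finite.one_lt_card

lemma IsNormalizedUniformizer.one_lt_q {ϖ : Kˣ} (h : IsNormalizedUniformizer ϖ) :
    (1 : ℝ) < resCard K := by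
  exact_mod_cast h.one_lt_resCard

lemma IsNormalizedUniformizer.norm_zpow {ϖ : Kˣ} (h : IsNormalizedUniformizer ϖ) (n : ℤ) :
    ‖(ϖ : K) ^ n‖ = (resCard K : ℝ) ^ (-n) := by
  rw [_root_.norm_zpow, h.1, inv_zpow']

lemma IsNormalizedUniformizer.exists_norm_eq {ϖ : Kˣ} (h : IsNormalizedUniformizer ϖ) {x : K}
    (hx : x ≠ 0) : ∃ n : ℤ, ‖x‖ = (resCard K : ℝ) ^ n := by
  have hq := h.one_lt_q
  have hq0 : (0 : ℝ) < resCard K := one_pos.trans hq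
  obtain ⟨n, h1, h2⟩ := exists_mem_Ico_zpow (norm_pos_iff.2 hx) hq
  refine ⟨n, le_antisymm ?_ h1⟩
  have h3 := h.2 (x * (ϖ : K) ^ (n + 1)) (by
    rw [norm_mul, h.norm_zpow, zpow_neg, ← div_eq_mul_inv, div_lt_one (by positivity)]
    exact h2)
  rw [norm_mul, h.norm_zpow, h.1, zpow_neg, ← div_eq_mul_inv, div_le_iff₀ (by positivity),
    zpow_add_one₀ hq0.ne', mul_comm, mul_assoc, mul_inv_cancel₀ hq0.ne', mul_one] at h3
  exact h3

lemma IsNormalizedUniformizer.norm_le_zpow_sub_one {ϖ : Kˣ} (h : IsNormalizedUniformizer ϖ)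
    {x : K} {n : ℤ} (hx : ‖x‖ ≤ (resCard K : ℝ) ^ n) (hn : ‖x‖ ≠ (resCard K : ℝ) ^ n) :
    ‖x‖ ≤ (resCard K : ℝ) ^ (n - 1) := by
  have hq := h.one_lt_q
  rcases eq_or_ne x 0 with rfl | hx0
  · rw [norm_zero]; positivity
  obtain ⟨m, hm⟩ := h.exists_norm_eq hx0
  rw [hm] at hx hn ⊢
  have h1 : m ≤ n := (zpow_le_zpow_iff_right₀ hq).1 hx
  have h2 : m ≠ n := fun e => hn (by rw [e])
  exact (zpow_le_zpow_iff_right₀ hq).2 (by omega)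

lemma norm_add_le_of_le {x y : K} {r : ℝ} (hx : ‖x‖ ≤ r) (hy : ‖y‖ ≤ r) : ‖x + y‖ ≤ r :=
  (IsUltrametricDist.norm_add_le_max x y).trans (max_le hx hy)

lemma norm_add_eq_of_lt {x a : K} (h : ‖a‖ < ‖x‖) : ‖x + a‖ = ‖x‖ := by
  rw [IsUltrametricDist.norm_add_eq_max_of_norm_ne_norm h.ne', max_eq_left h.le]

lemma norm_add_le_iff {x a : K} {r : ℝ} (ha : ‖a‖ ≤ r) : ‖x + a‖ ≤ r ↔ ‖x‖ ≤ r := by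
  refine ⟨fun h => ?_, fun h => norm_add_le_of_le h ha⟩
  have := norm_add_le_of_le h (show ‖-a‖ ≤ r by rwa [norm_neg])
  rwa [add_neg_cancel_right] at this

/-- The circle has no small subgroups. -/
lemma circle_eq_one_of_forall_pow {z : Circle} (h : ∀ n : ℕ, ‖((z ^ n : Circle) : ℂ) - 1‖ ≤ 1 / 2) :
    z = 1 := by
  -- Squaring multiplies the distance to `1` by `|w + 1|`, which is at least `3/2` as long as `w`
  -- stays within `1/2` of `1`.
  have key : ∀ k : ℕ, (3 / 2 : ℝ) ^ k * ‖(z : ℂ) - 1‖ ≤ ‖((z ^ 2 ^ k : Circle) : ℂ) - 1‖ := by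
    intro k
    induction k with
    | zero => simp
    | succ k ih =>
      set w : ℂ := ((z ^ 2 ^ k : Circle) : ℂ) with hw
      have e : ((z ^ 2 ^ (k + 1) : Circle) : ℂ) - 1 = (w - 1) * (w + 1) := by
        rw [pow_succ, pow_mul, Circle.coe_pow, ← hw]
        ring
      have h1 : 3 / 2 ≤ ‖w + 1‖ := by
        have h2 := h (2 ^ k)
        rw [← hw] at h2
        have h3 := norm_sub_norm_le (2 : ℂ) (1 - w)
        rw [show (2 : ℂ) - (1 - w) = w + 1 by ring, norm_sub_rev 1 w] at h3
        have : ‖(2 : ℂ)‖ = 2 := by simp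
        linarith
      rw [e, norm_mul, pow_succ]
      calc (3 / 2 : ℝ) ^ k * (3 / 2) * ‖(z : ℂ) - 1‖
          = ((3 / 2 : ℝ) ^ k * ‖(z : ℂ) - 1‖) * (3 / 2) := by ring
        _ ≤ ‖w - 1‖ * ‖w + 1‖ := mul_le_mul ih h1 (by norm_num) (norm_nonneg _)
  by_contra hz
  have hz' : 0 < ‖(z : ℂ) - 1‖ := by
    rw [norm_pos_iff, sub_ne_zero]
    intro h
    exact hz (Circle.ext (by simpa using h))
  obtain ⟨k, hk⟩ := pow_unbounded_of_one_lt (‖(z : ℂ) - 1‖⁻¹) (show (1 : ℝ) < 3 / 2 by norm_num)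
  have h1 := key k
  have h2 := h (2 ^ k)
  have h3 : 1 < (3 / 2 : ℝ) ^ k * ‖(z : ℂ) - 1‖ := by
    rwa [inv_lt_iff_one_lt_mul₀ hz'] at hk
  linarith

section character

variable {ϖ : Kˣ} (hϖ : IsNormalizedUniformizer ϖ) {ψ : AddChar K Circle} (hψ : Continuous ψ)
  (hψ1 : ψ ≠ 1)
include hϖ hψ hψ1

/-- A supremum of integers is meaningful only for a nonempty bounded set. It is nonempty because
small balls are additive subgroups and the circle has no small subgroups; it is bounded because `ψ`
is nontrivial. -/
lemma addConductor_spec :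
    (∀ x : K, ‖x‖ ≤ (resCard K : ℝ) ^ addConductor ψ → ψ x = 1) ∧
    ∃ x : K, ‖x‖ ≤ (resCard K : ℝ) ^ (addConductor ψ + 1) ∧ ψ x ≠ 1 := by
  have hq := hϖ.one_lt_q
  set S : Set ℤ := {n : ℤ | ∀ x : K, ‖x‖ ≤ (resCard K : ℝ) ^ n → ψ x = 1} with hS
  have hne : S.Nonempty := by
    have hc : ContinuousAt (fun x => ((ψ x : Circle) : ℂ)) 0 :=
      (continuous_subtype_val.comp hψ).continuousAt
    obtain ⟨δ, hδ, h⟩ := Metric.continuousAt_iff.1 hc (1 / 2) (by norm_num)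
    obtain ⟨n, hn⟩ := exists_pow_lt_of_lt_one hδ (inv_lt_one_of_one_lt₀ hq)
    refine ⟨-(n : ℤ), fun x hx => circle_eq_one_of_forall_pow fun k => ?_⟩
    have hk : ‖(k • x : K)‖ ≤ ‖x‖ := by
      rw [nsmul_eq_mul, norm_mul]
      exact mul_le_of_le_one_left (norm_nonneg _) (IsUltrametricDist.norm_natCast_le_one K k)
    have h1 := h (x := k • x) (by
      rw [dist_zero_right]
      refine lt_of_le_of_lt (hk.trans hx) ?_
      rwa [zpow_neg, zpow_natCast, ← inv_pow])
    rw [dist_eq_norm, AddChar.map_nsmul_eq_pow, AddChar.map_zero_eq_one] at h1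
    exact h1.le
  have hbdd : BddAbove S := by
    obtain ⟨x, hx⟩ : ∃ x, ψ x ≠ 1 := by
      by_contra! h
      exact hψ1 (by ext x; simp [h x])
    obtain ⟨N, hN⟩ := pow_unbounded_of_one_lt ‖x‖ hq
    refine ⟨N, fun n hn => ?_⟩
    by_contra! h
    refine hx (hn x (hN.le.trans ?_))
    rw [← zpow_natCast]
    exact zpow_le_zpow_right₀ hq.le h.le
  have hmem : addConductor ψ ∈ S := Int.csSup_mem hne hbdd
  refine ⟨hmem, ?_⟩
  have h2 : addConductor ψ + 1 ∉ S := fun h => by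
    have := le_csSup hbdd h
    change addConductor ψ + 1 ≤ addConductor ψ at this
    omega
  simpa [hS] using h2

lemma psi_eq_one {x : K} (hx : ‖x‖ ≤ (resCard K : ℝ) ^ addConductor ψ) : ψ x = 1 :=
  (addConductor_spec hϖ hψ hψ1).1 x hx

lemma exists_psi_ne_one : ∃ x : K, ‖x‖ = (resCard K : ℝ) ^ (addConductor ψ + 1) ∧ ψ x ≠ 1 := by
  obtain ⟨x, hx, h⟩ := (addConductor_spec hϖ hψ hψ1).2
  refine ⟨x, ?_, h⟩
  by_contra hne
  have := hϖ.norm_le_zpow_sub_one hx hne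
  rw [add_sub_cancel_right] at this
  exact h (psi_eq_one hϖ hψ hψ1 this)

lemma exists_psi_mul_ne_one {n : ℤ} {y : K} (hy : (resCard K : ℝ) ^ (addConductor ψ - n) < ‖y‖) :
    ∃ a : K, ‖a‖ ≤ (resCard K : ℝ) ^ n ∧ ψ (a * y) ≠ 1 := by
  have hq := hϖ.one_lt_q
  have hq0 : (0 : ℝ) < resCard K := one_pos.trans hq
  obtain ⟨x, hx, h⟩ := exists_psi_ne_one hϖ hψ hψ1
  have hy0 : y ≠ 0 := norm_pos_iff.1 (lt_trans (by positivity) hy)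
  refine ⟨x / y, ?_, by rwa [div_mul_cancel₀ _ hy0]⟩
  obtain ⟨m, hm⟩ := hϖ.exists_norm_eq hy0
  rw [hm] at hy
  have h1 : addConductor ψ - n < m := (zpow_lt_zpow_iff_right₀ hq).1 hy
  rw [norm_div, hx, hm, ← zpow_sub₀ hq0.ne']
  exact zpow_le_zpow_right₀ hq.le (by omega)

end character

section mulCharacter

variable {ϖ : Kˣ} (hϖ : IsNormalizedUniformizer ϖ) (χ : Kˣ →ₜ* Circle)

lemma mulConductor_inv : mulConductor χ⁻¹ = mulConductor χ := by
  have h : ∀ u, χ⁻¹ u = 1 ↔ χ u = 1 := fun u => inv_eq_one (a := χ u)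
  simp only [mulConductor, h]

include hϖ

/-- The infimum is attained only if the defining set is nonempty, the value on the empty set being
`0`. Powers of a unit close to `1` stay as close to `1`, so the absence of small subgroups in the
circle applies again. -/
lemma mulConductor_spec (u : Kˣ) (h1 : ‖(u : K)‖ = 1)
    (h2 : ‖(u : K) - 1‖ ≤ (resCard K : ℝ) ^ (-(mulConductor χ : ℤ))) : χ u = 1 := by
  have hq := hϖ.one_lt_q
  set S : Set ℕ := {n : ℕ | ∀ u : Kˣ, ‖(u : K)‖ = 1 →
    ‖(u : K) - 1‖ ≤ (resCard K : ℝ) ^ (-(n : ℤ)) → χ u = 1} with hS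
  suffices hne : S.Nonempty from Nat.sInf_mem hne u h1 h2
  have hc : ContinuousAt (charExt χ) 1 :=
    (continuousOn_charExt χ).continuousAt (isOpen_compl_singleton.mem_nhds one_ne_zero)
  have hone : charExt χ (1 : K) = 1 := by
    have := charExt_unit χ (1 : Kˣ)
    simpa using this
  obtain ⟨δ, hδ, h⟩ := Metric.continuousAt_iff.1 hc (1 / 2) (by norm_num)
  obtain ⟨n, hn⟩ := exists_pow_lt_of_lt_one hδ (inv_lt_one_of_one_lt₀ hq)
  refine ⟨n, fun u h1 h2 => circle_eq_one_of_forall_pow fun k => ?_⟩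
  have hk : ‖(u : K) ^ k - 1‖ ≤ ‖(u : K) - 1‖ := by
    induction k with
    | zero => simp
    | succ k ih =>
      rw [show (u : K) ^ (k + 1) - 1 = (u : K) ^ k * (u - 1) + (u ^ k - 1) by ring]
      refine norm_add_le_of_le ?_ ih
      rw [norm_mul, norm_pow, h1, one_pow, one_mul]
  have h3 := h (x := (u : K) ^ k) (by
    rw [dist_eq_norm]
    refine lt_of_le_of_lt (hk.trans h2) ?_
    rwa [zpow_neg, zpow_natCast, ← inv_pow])
  rw [hone, dist_eq_norm, ← Units.val_pow_eq_pow_val, charExt_unit, map_pow] at h3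
  exact h3.le

omit hϖ in
lemma exists_char_ne_one (hc : mulConductor χ ≠ 0) : ∃ u : Kˣ, ‖(u : K)‖ = 1 ∧
    ‖(u : K) - 1‖ ≤ (resCard K : ℝ) ^ (1 - (mulConductor χ : ℤ)) ∧ χ u ≠ 1 := by
  have h : mulConductor χ - 1 ∉ {n : ℕ | ∀ u : Kˣ, ‖(u : K)‖ = 1 →
      ‖(u : K) - 1‖ ≤ (resCard K : ℝ) ^ (-(n : ℤ)) → χ u = 1} :=
    Nat.notMem_of_lt_sInf (by unfold mulConductor at hc ⊢; omega)
  simp only [Set.mem_ofPred_eq, not_forall] at h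
  obtain ⟨u, h1, h2, h3⟩ := h
  refine ⟨u, h1, ?_, h3⟩
  rwa [Nat.cast_sub (Nat.one_le_iff_ne_zero.2 hc), Nat.cast_one, neg_sub] at h2

end mulCharacter

section haar

variable [ProperSpace K] [MeasurableSpace K] [BorelSpace K]
  {ϖ : Kˣ} (hϖ : IsNormalizedUniformizer ϖ) (vol : Measure K) [vol.IsAddHaarMeasure]

include hϖ in
-- The ring of integers is the disjoint union of `q` translates of its maximal ideal. The measure is
-- pulled back to `O`, where the index formula for subgroups applies.
lemma card_mul_measure_maximalIdeal :
    (resCard K : ENNReal) * vol (Metric.closedBall 0 ‖(ϖ : K)‖) = vol (Metric.closedBall 0 1) := by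
  have hq := hϖ.one_lt_resCard
  set m : Measure 𝒪[K] := vol.comap Subtype.val with hm
  have hOm : MeasurableSet (𝒪[K] : Set K) := by
    have : (𝒪[K] : Set K) = Metric.closedBall 0 1 := by
      ext x
      rw [SetLike.mem_coe, Valued.integer.mem_iff, mem_closedBall_zero_iff]
    rw [this]
    exact Metric.isClosed_closedBall.measurableSet
  have hemb : MeasurableEmbedding (Subtype.val : 𝒪[K] → K) := MeasurableEmbedding.subtype_coe hOm
  have hma : ∀ s : Set 𝒪[K], m s = vol (Subtype.val '' s) := fun s => hemb.comap_apply vol s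
  have hinv : m.IsAddLeftInvariant := by
    refine ⟨fun g => ?_⟩
    have hgm : Measurable fun x : 𝒪[K] => g + x :=
      ((measurable_const_add (g : K)).comp measurable_subtype_coe).subtype_mk
    refine Measure.ext fun s hs => ?_
    have himg : Subtype.val '' ((fun x : 𝒪[K] => g + x) ⁻¹' s) =
        (fun x : K => (g : K) + x) ⁻¹' (Subtype.val '' s) := by
      ext x
      constructor
      · rintro ⟨y, hy, rfl⟩
        exact ⟨g + y, hy, rfl⟩
      · rintro ⟨y, hy, hyx⟩
        have : x = ((y - g : 𝒪[K]) : K) := by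
          change x = (y : K) - (g : K)
          rw [hyx]; ring
        exact ⟨y - g, by simpa using hy, this.symm⟩
    rw [Measure.map_apply hgm hs, hma, hma, himg, measure_preimage_add]
  set H : AddSubgroup 𝒪[K] := (IsLocalRing.maximalIdeal 𝒪[K]).toAddSubgroup with hH
  have hindex : H.index = resCard K := rfl
  have hfin : H.FiniteIndex := ⟨by rw [hindex]; omega⟩
  have hmem : ∀ x : 𝒪[K], x ∈ H ↔ ‖(x : K)‖ ≤ ‖(ϖ : K)‖ := by
    intro x
    change x ∈ IsLocalRing.maximalIdeal 𝒪[K] ↔ _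
    rw [IsLocalRing.mem_maximalIdeal, mem_nonunits_iff, Valued.integer.isUnit_iff_norm_eq_one]
    have hx : ‖(x : K)‖ ≤ 1 := Valued.integer.mem_iff.1 x.2
    change ‖(x : K)‖ ≠ 1 ↔ _
    refine ⟨fun h => hϖ.2 _ (lt_of_le_of_ne hx h), fun h => ?_⟩
    rw [hϖ.1] at h
    exact (h.trans_lt (inv_lt_one_of_one_lt₀ hϖ.one_lt_q)).ne
  have hϖ1 : ‖(ϖ : K)‖ ≤ 1 := by
    rw [hϖ.1]; exact (inv_lt_one_of_one_lt₀ hϖ.one_lt_q).le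
  have himg : Subtype.val '' (H : Set 𝒪[K]) = Metric.closedBall (0 : K) ‖(ϖ : K)‖ := by
    ext x
    rw [mem_closedBall_zero_iff]
    constructor
    · rintro ⟨y, hy, rfl⟩
      exact (hmem y).1 hy
    · intro hx
      exact ⟨⟨x, Valued.integer.mem_iff.2 (hx.trans hϖ1)⟩, (hmem _).2 hx, rfl⟩
  have hHm : MeasurableSet (H : Set 𝒪[K]) := by
    have := hemb.measurableSet_image (s := (H : Set 𝒪[K]))
    rw [← this, himg]
    exact Metric.isClosed_closedBall.measurableSet
  have hmain := H.index_mul_measure hHm m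
  rw [hindex, hma, hma, himg, Set.image_univ, Subtype.range_coe] at hmain
  rw [hmain]
  congr 1
  ext x
  rw [SetLike.mem_coe, Valued.integer.mem_iff, mem_closedBall_zero_iff]

open scoped Pointwise in
include hϖ in
-- The module of Haar measure is multiplicative in `a`, so it is determined by units of `O`, which
-- preserve `O`, and by `ϖ`, which maps `O` onto a subgroup of index `q`.
lemma measure_map_mul {a : K} (ha : a ≠ 0) :
    ENNReal.ofReal ‖a‖ • vol.map (a * ·) = vol := by
  have hq := hϖ.one_lt_q
  have hq0 : (0 : ℝ) < resCard K := one_pos.trans hq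
  set O : Set K := Metric.closedBall 0 1 with hO
  have hO0 : vol O ≠ 0 := (Metric.measure_closedBall_pos vol 0 one_pos).ne'
  have hOt : vol O ≠ ⊤ := (isCompact_closedBall (0 : K) 1).measure_lt_top.ne
  have hdist : ∀ u : Kˣ, (distribHaarChar K u : ℝ) = ‖(u : K)‖ := by
    have h1 : ∀ u : Kˣ, ‖(u : K)‖ = 1 → distribHaarChar K u = 1 := by
      intro u hu
      refine distribHaarChar_eq_of_measure_smul_eq_mul (μ := vol) hO0 hOt ?_
      rw [ENNReal.coe_one, one_mul]
      congr 1
      ext x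
      rw [Set.mem_smul_set_iff_inv_smul_mem, hO, mem_closedBall_zero_iff, mem_closedBall_zero_iff,
        Units.smul_def, smul_eq_mul, norm_mul, Units.val_inv_eq_inv_val, norm_inv, hu, inv_one,
        one_mul]
    have h2 : distribHaarChar K ϖ = (resCard K : NNReal)⁻¹ := by
      refine distribHaarChar_eq_of_measure_smul_eq_mul (μ := vol) hO0 hOt ?_
      have h3 : ϖ • O = Metric.closedBall 0 ‖(ϖ : K)‖ := by
        ext x
        rw [Set.mem_smul_set_iff_inv_smul_mem, hO, mem_closedBall_zero_iff,
          mem_closedBall_zero_iff, Units.smul_def, smul_eq_mul, norm_mul, Units.val_inv_eq_inv_val,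
          norm_inv, inv_mul_le_iff₀ (norm_pos_iff.2 ϖ.ne_zero), mul_one]
      have hqn : (resCard K : ENNReal) ≠ 0 := by
        have := hϖ.one_lt_resCard
        exact_mod_cast (by omega : resCard K ≠ 0)
      rw [h3, ← card_mul_measure_maximalIdeal hϖ vol, ENNReal.coe_inv (by
        have := hϖ.one_lt_resCard
        exact_mod_cast (by omega : resCard K ≠ 0)), ← mul_assoc, ENNReal.coe_natCast,
        ENNReal.inv_mul_cancel hqn (ENNReal.natCast_ne_top _), one_mul]
    intro u
    obtain ⟨n, hn⟩ := hϖ.exists_norm_eq u.ne_zero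
    have h4 : u = (u * ϖ ^ n) * ϖ ^ (-n) := by rw [mul_assoc, ← zpow_add]; simp
    rw [h4, map_mul, h1, map_zpow, h2, one_mul, ← h4, hn]
    · push_cast
      rw [inv_zpow', neg_neg]
    · rw [Units.val_mul, norm_mul, hn, Units.val_zpow_eq_zpow_val, hϖ.norm_zpow, ← zpow_add₀ hq0.ne']
      simp
  refine Measure.ext fun s hs => ?_
  rw [Measure.smul_apply, Measure.map_apply (by fun_prop) hs, smul_eq_mul]
  have h1 := distribHaarChar_mul (μ := vol) (Units.mk0 a ha) ((a * ·) ⁻¹' s)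
  have h2 : ENNReal.ofReal ‖a‖ = (distribHaarChar K (Units.mk0 a ha) : ENNReal) := by
    have h3 := hdist (Units.mk0 a ha)
    rw [Units.val_mk0] at h3
    rw [← h3, ENNReal.ofReal_coe_nnreal]
  rw [h2, h1]
  congr 1
  ext x
  rw [Set.mem_smul_set_iff_inv_smul_mem, Set.mem_preimage, Units.smul_def, smul_eq_mul,
    Units.val_inv_eq_inv_val, Units.val_mk0, mul_inv_cancel_left₀ ha]

end haar

end nonarchField


/-! ### Nonarchimedean Fourier analysis through step functions -/

section nonarchTate

variable {K : Type*} [NontriviallyNormedField K] [IsUltrametricDist K] [ProperSpace K]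
  [MeasurableSpace K] [BorelSpace K]

/-- A uniformizer, a nontrivial continuous additive character, and the Haar measure which is
self-dual for this character. -/
structure IsNonarchSetup (ϖ : Kˣ) (ψ : AddChar K Circle) (vol : Measure K) : Prop where
  uniformizer : IsNormalizedUniformizer ϖ
  psi_continuous : Continuous ψ
  psi_ne_one : ψ ≠ 1
  haar : vol.IsAddHaarMeasure
  vol_closedBall : vol (Metric.closedBall 0 1) =
    ENNReal.ofReal ((resCard K : ℝ) ^ (-(addConductor ψ : ℝ) / 2))

/-- `f` is invariant under translation by `‖a‖ ≤ q ^ n` and supported in `‖x‖ ≤ q ^ m`. -/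
def IsStep (n m : ℤ) (f : K → ℂ) : Prop :=
  (∀ x a, ‖a‖ ≤ (resCard K : ℝ) ^ n → f (x + a) = f x) ∧ ∀ x, (resCard K : ℝ) ^ m < ‖x‖ → f x = 0

namespace IsNonarchSetup

variable {ϖ : Kˣ} {ψ : AddChar K Circle} {vol : Measure K} (h : IsNonarchSetup ϖ ψ vol)
include h

lemma isLocal : (nonarchData ϖ ψ vol).IsLocal 1 where
  pos := one_pos
  abs_eq x := (pow_one _).symm
  haar := h.haar
  map_mul a ha := by
    have := h.haar
    exact measure_map_mul h.uniformizer vol ha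
  psi_continuous := continuous_subtype_val.comp h.psi_continuous
  psi_add x y := by simp [nonarchData, AddChar.map_add_eq_mul]
  psi_norm x := Circle.norm_coe _

lemma q_pos : (0 : ℝ) < resCard K := one_pos.trans h.uniformizer.one_lt_q

lemma real_closedBall (n : ℤ) : vol.real (Metric.closedBall 0 ((resCard K : ℝ) ^ n)) =
    (resCard K : ℝ) ^ n * (resCard K : ℝ) ^ (-(addConductor ψ : ℝ) / 2) := by
  have := h.haar
  have hq0 := h.q_pos
  have h1 : vol (Metric.closedBall 0 1) = ENNReal.ofReal ((resCard K : ℝ) ^ (-n)) *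
      vol (Metric.closedBall 0 ((resCard K : ℝ) ^ n)) := by
    conv_lhs => rw [← measure_map_mul h.uniformizer vol (a := (ϖ : K) ^ n)
      (zpow_ne_zero _ ϖ.ne_zero)]
    rw [Measure.smul_apply, Measure.map_apply (by fun_prop) Metric.isClosed_closedBall.measurableSet,
      h.uniformizer.norm_zpow, smul_eq_mul]
    congr 2
    ext x
    rw [Set.mem_preimage, mem_closedBall_zero_iff, mem_closedBall_zero_iff, norm_mul,
      h.uniformizer.norm_zpow, zpow_neg, inv_mul_le_iff₀ (by positivity), mul_one]
  rw [h.vol_closedBall] at h1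
  have h2 := congrArg ENNReal.toReal h1
  rw [ENNReal.toReal_mul, ENNReal.toReal_ofReal (by positivity), ENNReal.toReal_ofReal
    (by positivity), zpow_neg] at h2
  rw [h2, ← mul_assoc, mul_inv_cancel₀ (by positivity), one_mul]
  rfl

lemma continuous_of_isStep {n m : ℤ} {f : K → ℂ} (hf : IsStep n m f) : IsLocallyConstant f := by
  have hq0 := h.q_pos
  rw [IsLocallyConstant.iff_eventually_eq]
  intro x
  filter_upwards [Metric.ball_mem_nhds x (show (0 : ℝ) < (resCard K : ℝ) ^ n by positivity)]
    with y hy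
  rw [← add_sub_cancel x y]
  exact hf.1 x (y - x) (by rw [← dist_eq_norm]; exact (Metric.mem_ball.1 hy).le)

/-- A locally constant function on a compact set is uniformly locally constant, by the Lebesgue
number lemma. The two integers make the Fourier transform computable. -/
lemma mem_schwartz_iff {f : K → ℂ} :
    f ∈ (nonarchData ϖ ψ vol).schwartz ↔ ∃ n m : ℤ, IsStep n m f := by
  have hq := h.uniformizer.one_lt_q
  have hq0 := h.q_pos
  constructor
  · rintro ⟨hl, hc⟩
    obtain ⟨δ, hδ, hδf⟩ := lebesgue_number_lemma_of_metric (c := fun i : ℂ => f ⁻¹' {i}) hc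
      (fun i => hl _) (fun x _ => Set.mem_iUnion.2 ⟨f x, rfl⟩)
    have key : ∀ x ∈ tsupport f, ∀ a, ‖a‖ < δ → f (x + a) = f x := by
      intro x hx a ha
      obtain ⟨i, hi⟩ := hδf x hx
      have h1 : f x = i := hi (Metric.mem_ball_self hδ)
      have h2 : f (x + a) = i := hi (by simpa [Metric.mem_ball, dist_eq_norm] using ha)
      rw [h1, h2]
    obtain ⟨n, hn⟩ := exists_pow_lt_of_lt_one hδ (inv_lt_one_of_one_lt₀ hq)
    obtain ⟨R, hR⟩ := hc.isBounded.subset_closedBall 0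
    obtain ⟨m, hm⟩ := pow_unbounded_of_one_lt R hq
    refine ⟨-n, m, fun x a ha => ?_, fun x hx => ?_⟩
    · have ha' : ‖a‖ < δ := by
        refine ha.trans_lt ?_
        rwa [zpow_neg, zpow_natCast, ← inv_pow]
      by_cases hx : x ∈ tsupport f
      · exact key x hx a ha'
      by_cases hx' : x + a ∈ tsupport f
      · have := key (x + a) hx' (-a) (by rwa [norm_neg])
        rw [add_neg_cancel_right] at this
        exact this.symm
      · rw [image_eq_zero_of_notMem_tsupport hx, image_eq_zero_of_notMem_tsupport hx']
    · refine image_eq_zero_of_notMem_tsupport fun hxs => ?_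
      have := mem_closedBall_zero_iff.1 (hR hxs)
      rw [zpow_natCast] at hx
      linarith
  · rintro ⟨n, m, hf⟩
    refine ⟨h.continuous_of_isStep hf, ?_⟩
    refine HasCompactSupport.of_support_subset_isCompact
      (isCompact_closedBall (0 : K) ((resCard K : ℝ) ^ m)) fun x hx => ?_
    rw [mem_closedBall_zero_iff]
    by_contra! hlt
    exact hx (hf.2 x hlt)

lemma integrable_schwartz {f : K → ℂ} (hf : f ∈ (nonarchData ϖ ψ vol).schwartz) :
    Integrable f vol := by
  have := h.haar
  exact hf.1.continuous.integrable_of_hasCompactSupport hf.2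

lemma fourier_comp_add (f : K → ℂ) (a y : K) :
    (nonarchData ϖ ψ vol).fourier (fun x => f (x + a)) y =
      ((ψ (-(a * y)) : Circle) : ℂ) * (nonarchData ϖ ψ vol).fourier f y := by
  have := h.haar
  simp only [LocalFieldData.fourier, nonarchData]
  rw [← integral_const_mul, ← integral_add_right_eq_self
    (fun x => ((ψ (-(a * y)) : Circle) : ℂ) * (f x * ((ψ (x * y) : Circle) : ℂ))) a]
  refine integral_congr_ae (ae_of_all _ fun x => ?_)
  simp only [add_mul, AddChar.map_add_eq_mul, AddChar.map_neg_eq_inv, Circle.coe_mul,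
    Circle.coe_inv]
  have := Circle.coe_ne_zero (ψ (a * y))
  field_simp

lemma fourier_eq_zero {f : K → ℂ} {a y : K} (hf : ∀ x, f (x + a) = f x) (ha : ψ (a * y) ≠ 1) :
    (nonarchData ϖ ψ vol).fourier f y = 0 := by
  have h1 := h.fourier_comp_add f a y
  simp only [hf] at h1
  by_contra h0
  apply ha
  have h2 : ((ψ (-(a * y)) : Circle) : ℂ) = 1 := by
    apply mul_right_cancel₀ h0
    rw [one_mul, ← h1]
  rw [AddChar.map_neg_eq_inv] at h2
  exact inv_eq_one.1 (Circle.ext (by simpa using h2))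

/-- Support and invariance are exchanged: `ψ(xb) = 1` for `x` in the support and `b` small, while
for large `y` some period `a` of `f` has `ψ(ay) ≠ 1`, which forces the transform to vanish at `y`.
-/
lemma isStep_fourier {n m : ℤ} {f : K → ℂ} (hf : IsStep n m f) :
    IsStep (addConductor ψ - m) (addConductor ψ - n) ((nonarchData ϖ ψ vol).fourier f) := by
  have hq0 := h.q_pos
  refine ⟨fun y b hb => ?_, fun y hy => ?_⟩
  · refine integral_congr_ae (ae_of_all _ fun x => ?_)
    simp only [nonarchData]
    rcases le_or_gt ‖x‖ ((resCard K : ℝ) ^ m) with hx | hx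
    · rw [mul_add, AddChar.map_add_eq_mul, psi_eq_one h.uniformizer h.psi_continuous h.psi_ne_one
        (x := x * b), mul_one]
      rw [norm_mul]
      refine (mul_le_mul hx hb (norm_nonneg _) (by positivity)).trans (le_of_eq ?_)
      rw [← zpow_add₀ hq0.ne']
      ring_nf
    · rw [hf.2 x hx]; simp
  · obtain ⟨a, ha, ha'⟩ := exists_psi_mul_ne_one h.uniformizer h.psi_continuous h.psi_ne_one hy
    exact h.fourier_eq_zero (fun x => hf.1 x a ha) ha'

lemma isStep_indicator {n m : ℤ} (hnm : n ≤ m) {x₀ : K} (hx₀ : ‖x₀‖ ≤ (resCard K : ℝ) ^ m) :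
    IsStep n m ((Metric.closedBall x₀ ((resCard K : ℝ) ^ n)).indicator fun _ => (1 : ℂ)) := by
  have hq := h.uniformizer.one_lt_q
  constructor
  · intro x a ha
    have : x + a ∈ Metric.closedBall x₀ ((resCard K : ℝ) ^ n) ↔
        x ∈ Metric.closedBall x₀ ((resCard K : ℝ) ^ n) := by
      rw [Metric.mem_closedBall, Metric.mem_closedBall, dist_eq_norm, dist_eq_norm,
        add_sub_right_comm, norm_add_le_iff ha]
    by_cases hx : x ∈ Metric.closedBall x₀ ((resCard K : ℝ) ^ n)
    · rw [Set.indicator_of_mem hx, Set.indicator_of_mem (this.2 hx)]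
    · rw [Set.indicator_of_notMem hx, Set.indicator_of_notMem (mt this.1 hx)]
  · intro x hx
    refine Set.indicator_of_notMem (fun hmem => ?_) _
    rw [Metric.mem_closedBall, dist_eq_norm] at hmem
    have h1 := norm_add_le_of_le (hmem.trans (zpow_le_zpow_right₀ hq.le hnm)) hx₀
    rw [sub_add_cancel] at h1
    linarith

lemma fourier_indicator (n : ℤ) (y : K) : (nonarchData ϖ ψ vol).fourier
    ((Metric.closedBall 0 ((resCard K : ℝ) ^ n)).indicator fun _ => (1 : ℂ)) y =
      (Metric.closedBall 0 ((resCard K : ℝ) ^ (addConductor ψ - n))).indicator (fun _ =>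
        (((resCard K : ℝ) ^ n * (resCard K : ℝ) ^ (-(addConductor ψ : ℝ) / 2) : ℝ) : ℂ)) y := by
  have hq0 := h.q_pos
  have hstep := h.isStep_indicator le_rfl (x₀ := 0)
    (by rw [norm_zero]; positivity : ‖(0 : K)‖ ≤ (resCard K : ℝ) ^ n)
  by_cases hy : ‖y‖ ≤ (resCard K : ℝ) ^ (addConductor ψ - n)
  · rw [Set.indicator_of_mem (by rwa [mem_closedBall_zero_iff])]
    have e : ∀ x, (Metric.closedBall 0 ((resCard K : ℝ) ^ n)).indicator (fun _ => (1 : ℂ)) x *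
        ((ψ (x * y) : Circle) : ℂ) =
          (Metric.closedBall 0 ((resCard K : ℝ) ^ n)).indicator (fun _ => (1 : ℂ)) x := by
      intro x
      by_cases hx : ‖x‖ ≤ (resCard K : ℝ) ^ n
      · rw [psi_eq_one h.uniformizer h.psi_continuous h.psi_ne_one, Circle.coe_one, mul_one]
        rw [norm_mul]
        refine (mul_le_mul hx hy (norm_nonneg _) (by positivity)).trans (le_of_eq ?_)
        rw [← zpow_add₀ hq0.ne']
        ring_nf
      · rw [Set.indicator_of_notMem (by rwa [mem_closedBall_zero_iff]), zero_mul]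
    simp only [LocalFieldData.fourier, nonarchData, e]
    rw [integral_indicator_const _ Metric.isClosed_closedBall.measurableSet, h.real_closedBall]
    simp
  · rw [Set.indicator_of_notMem (by rwa [mem_closedBall_zero_iff])]
    exact (h.isStep_fourier hstep).2 y (not_le.1 hy)

lemma q_rpow_sq : ((resCard K : ℝ) ^ (-(addConductor ψ : ℝ) / 2)) ^ 2 =
    (resCard K : ℝ) ^ (-addConductor ψ) := by
  rw [← Real.rpow_natCast, ← Real.rpow_mul h.q_pos.le, ← Real.rpow_intCast]
  congr 1
  push_cast
  ring

/-- Since `f̂` is supported in a ball, the indicator of that ball may be inserted in the outer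
integral. By the multiplication formula `f` is then integrated against a multiple of the indicator
of the ball of radius `q^n` about `-x`, on which `f` is constant. -/
lemma fourier_fourier {f : K → ℂ} (hf : f ∈ (nonarchData ϖ ψ vol).schwartz) (x : K) :
    (nonarchData ϖ ψ vol).fourier ((nonarchData ϖ ψ vol).fourier f) x = f (-x) := by
  have := h.haar
  have hq0 := h.q_pos
  have hfi := h.integrable_schwartz hf
  obtain ⟨n, m, hs⟩ := h.mem_schwartz_iff.1 hf
  set D := nonarchData ϖ ψ vol with hD
  set N := addConductor ψ - n with hN
  set χ : K → ℂ := (Metric.closedBall 0 ((resCard K : ℝ) ^ N)).indicator fun _ => (1 : ℂ) with hχ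
  set g : K → ℂ := fun y => χ y * D.psi (y * x) with hg
  have hgi : Integrable g vol := by
    have hχi : Integrable χ vol := h.integrable_schwartz (h.mem_schwartz_iff.2 ⟨N, N,
      h.isStep_indicator le_rfl (by rw [norm_zero]; positivity)⟩)
    have hp := h.isLocal.psi_continuous
    refine hχi.norm.mono' (hχi.1.mul ?_) (ae_of_all _ fun y => ?_)
    · exact (hp.comp (continuous_id.mul continuous_const)).aestronglyMeasurable
    · rw [hg, norm_mul, h.isLocal.psi_norm, mul_one]
  have h1 : D.fourier (D.fourier f) x = ∫ y, D.fourier f y * g y ∂vol := by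
    refine integral_congr_ae (ae_of_all _ fun y => ?_)
    simp only [hg, hχ]
    rcases le_or_gt ‖y‖ ((resCard K : ℝ) ^ N) with hy | hy
    · rw [Set.indicator_of_mem (by rwa [mem_closedBall_zero_iff]), one_mul]
    · rw [(h.isStep_fourier hs).2 y hy]
      simp
  have h1' : ∫ y, D.fourier f y * g y ∂vol = ∫ x, f x * D.fourier g x ∂vol :=
    h.isLocal.integral_fourier_mul hfi hgi
  rw [h1, h1']
  have h2 : ∀ z, D.fourier g z = D.fourier χ (x + z) := by
    intro z
    refine integral_congr_ae (ae_of_all _ fun y => ?_)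
    simp only [hg]
    rw [mul_add, h.isLocal.psi_add, mul_assoc]
  set V : ℝ := (resCard K : ℝ) ^ (-(addConductor ψ : ℝ) / 2) with hV
  have h3 : ∀ z, f z * D.fourier g z = (Metric.closedBall (-x) ((resCard K : ℝ) ^ n)).indicator
      (fun _ => f (-x) * ((((resCard K : ℝ) ^ N * V : ℝ)) : ℂ)) z := by
    intro z
    have e : z ∈ Metric.closedBall (-x) ((resCard K : ℝ) ^ n) ↔
        x + z ∈ Metric.closedBall 0 ((resCard K : ℝ) ^ (addConductor ψ - N)) := by
      rw [mem_closedBall_zero_iff, Metric.mem_closedBall, dist_eq_norm, sub_neg_eq_add, add_comm,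
        hN, sub_sub_cancel]
    rw [h2, h.fourier_indicator N]
    by_cases hz : z ∈ Metric.closedBall (-x) ((resCard K : ℝ) ^ n)
    · rw [Set.indicator_of_mem hz, Set.indicator_of_mem (e.1 hz)]
      congr 1
      rw [Metric.mem_closedBall, dist_eq_norm] at hz
      have := hs.1 (-x) (z - -x) hz
      rwa [add_sub_cancel] at this
    · rw [Set.indicator_of_notMem hz, Set.indicator_of_notMem (fun h' => hz (e.2 h')), mul_zero]
  simp only [h3]
  rw [integral_indicator_const _ Metric.isClosed_closedBall.measurableSet]
  have h4 : vol.real (Metric.closedBall (-x) ((resCard K : ℝ) ^ n)) = (resCard K : ℝ) ^ n * V := by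
    rw [← h.real_closedBall n, Measure.real, Measure.real,
      ← measure_preimage_add_right vol (-x) (Metric.closedBall (-x) _)]
    congr 2
    ext z
    simp [dist_eq_norm]
  -- This is where self-duality of the measure is used: `V² = q^{-e}` and `n + N = e`.
  have h5 : ((resCard K : ℝ) ^ n * V) * ((resCard K : ℝ) ^ N * V) = 1 := by
    have h6 := h.q_rpow_sq
    rw [← hV] at h6
    calc ((resCard K : ℝ) ^ n * V) * ((resCard K : ℝ) ^ N * V)
        = (resCard K : ℝ) ^ n * (resCard K : ℝ) ^ N * V ^ 2 := by ring
      _ = 1 := by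
        rw [h6, ← zpow_add₀ hq0.ne', ← zpow_add₀ hq0.ne', hN]
        ring_nf
        simp
  rw [h4, Complex.real_smul, mul_left_comm, ← Complex.ofReal_mul, h5, Complex.ofReal_one, mul_one]

/-- A compact set is the decreasing intersection of its neighbourhoods of radius `q^{-n}`, whose
indicators are step functions. Hence all integrals of `u` over compact sets vanish. -/
lemma ae_eq_zero {u : K → ℂ} (hu : LocallyIntegrable u vol)
    (hz : ∀ f ∈ (nonarchData ϖ ψ vol).schwartz, HasCompactSupport f → ∫ x, u x * f x ∂vol = 0) :
    u =ᵐ[vol] 0 := by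
  have := h.haar
  have hq := h.uniformizer.one_lt_q
  have hq0 := h.q_pos
  refine ae_eq_zero_of_forall_setIntegral_isCompact_eq_zero' hu fun K₀ hK₀ => ?_
  obtain ⟨R, hR⟩ := hK₀.isBounded.subset_closedBall 0
  obtain ⟨m, hm⟩ := pow_unbounded_of_one_lt R hq
  set U : ℕ → Set K := fun n => {x | ∃ k ∈ K₀, ‖x - k‖ ≤ (resCard K : ℝ) ^ (-(n : ℤ))} with hU
  have hstep : ∀ n : ℕ, IsStep (-(n : ℤ)) m ((U n).indicator fun _ => (1 : ℂ)) := by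
    intro n
    constructor
    · intro x a ha
      have : x + a ∈ U n ↔ x ∈ U n := by
        simp only [hU, Set.mem_ofPred_eq, add_sub_right_comm, norm_add_le_iff ha]
      by_cases hx : x ∈ U n
      · rw [Set.indicator_of_mem hx, Set.indicator_of_mem (this.2 hx)]
      · rw [Set.indicator_of_notMem hx, Set.indicator_of_notMem (mt this.1 hx)]
    · intro x hx
      refine Set.indicator_of_notMem (fun hxU => ?_) _
      obtain ⟨k, hk, hkx⟩ : x ∈ U n := hxU
      have h1 : ‖x - k‖ ≤ (resCard K : ℝ) ^ (m : ℤ) :=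
        hkx.trans (zpow_le_zpow_right₀ hq.le (by omega))
      have h2 : ‖k‖ ≤ (resCard K : ℝ) ^ (m : ℤ) := by
        rw [zpow_natCast]
        exact (mem_closedBall_zero_iff.1 (hR hk)).trans hm.le
      have h3 := norm_add_le_of_le h1 h2
      rw [sub_add_cancel] at h3
      linarith
  have hmem : ∀ n, (U n).indicator (fun _ => (1 : ℂ)) ∈ (nonarchData ϖ ψ vol).schwartz :=
    fun n => h.mem_schwartz_iff.2 ⟨_, _, hstep n⟩
  have hms : ∀ n, MeasurableSet (U n) := by
    intro n
    have h1 : U n = (U n).indicator (fun _ => (1 : ℂ)) ⁻¹' {1} := by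
      ext x
      by_cases hx : x ∈ U n <;> simp [hx]
    rw [h1]
    exact ((hmem n).1 {1}).measurableSet
  have hzero : ∀ n, ∫ x in U n, u x ∂vol = 0 := by
    intro n
    rw [← hz _ (hmem n) (hmem n).2, ← integral_indicator (hms n)]
    refine integral_congr_ae (ae_of_all _ fun x => ?_)
    by_cases hx : x ∈ U n <;> simp [hx]
  have hanti : Antitone U := fun a b hab x ⟨k, hk, hkx⟩ =>
    ⟨k, hk, hkx.trans (zpow_le_zpow_right₀ hq.le (by omega))⟩
  have hint : IntegrableOn u (U 0) vol := by
    refine (hu.integrableOn_isCompact (hmem 0).2).mono_set fun x hx => subset_tsupport _ ?_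
    simp [hx]
  have hlim := tendsto_setIntegral_of_antitone hms hanti ⟨0, hint⟩
  simp only [hzero] at hlim
  have hK : ⋂ n, U n = K₀ := by
    ext x
    rw [Set.mem_iInter]
    constructor
    · intro hx
      rw [← hK₀.isClosed.closure_eq, Metric.mem_closure_iff]
      intro ε hε
      obtain ⟨n, hn⟩ := exists_pow_lt_of_lt_one hε (inv_lt_one_of_one_lt₀ hq)
      obtain ⟨k, hk, hkx⟩ := hx n
      refine ⟨k, hk, ?_⟩
      rw [dist_eq_norm]
      refine hkx.trans_lt ?_
      rwa [zpow_neg, zpow_natCast, ← inv_pow]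
    · intro hx n
      exact ⟨x, hx, by rw [sub_self, norm_zero]; positivity⟩
  rw [hK] at hlim
  exact tendsto_nhds_unique hlim tendsto_const_nhds

/-- Translate by `a = -x₀/y` with `ψ(x₀) ≠ 1`, so that `(ψ(x₀) - 1) F̂(y)` is the transform of `F(x
+ a) - F(x)`. If `a` is a period of `f`, this difference vanishes for `‖x‖ > ‖a‖`, where `‖x + a‖ =
‖x‖`; what remains is of size `‖a‖^{Re β}` on a ball of volume proportional to `‖a‖`. Otherwise `y`
is bounded and the trivial bound suffices. -/
lemma fourier_abs_cpow_mul_le {f : K → ℂ} (hf : f ∈ (nonarchData ϖ ψ vol).schwartz) {β : ℂ}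
    (hβ : 0 < β.re) : ∃ C, ∀ y, 1 ≤ ‖y‖ →
      ‖(nonarchData ϖ ψ vol).fourier (fun x => (‖x‖ : ℂ) ^ β * f x) y‖ ≤ C * ‖y‖ ^ (-1 - β.re) := by
  have := h.haar
  have hq0 := h.q_pos
  obtain ⟨n, m, hs⟩ := h.mem_schwartz_iff.1 hf
  obtain ⟨x₀, hx₀, hx₀'⟩ := exists_psi_ne_one h.uniformizer h.psi_continuous h.psi_ne_one
  set D := nonarchData ϖ ψ vol with hD
  set F : K → ℂ := fun x => (‖x‖ : ℂ) ^ β * f x with hF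
  set q : ℝ := ((resCard K : ℕ) : ℝ) with hq
  set e := addConductor ψ with he
  have hFc : Continuous F :=
    ((Complex.continuous_ofReal_cpow_const hβ).comp continuous_norm).mul hf.1.continuous
  have hFi : Integrable F vol := hFc.integrable_of_hasCompactSupport hf.2.mul_left
  obtain ⟨B, hB⟩ := hf.2.exists_bound_of_continuous hf.1.continuous
  have hB0 : 0 ≤ B := (norm_nonneg _).trans (hB 0)
  set δ : ℝ := ‖((ψ x₀ : Circle) : ℂ) - 1‖ with hδ
  have hδ0 : 0 < δ := by
    rw [hδ, norm_pos_iff, sub_ne_zero]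
    exact fun h' => hx₀' (Circle.ext (by simpa using h'))
  set V : ℝ := q ^ (-(e : ℝ) / 2) with hV
  have hV0 : 0 < V := by positivity
  set M : ℝ := ∫ x, ‖F x‖ ∂vol with hM
  have hM0 : 0 ≤ M := integral_nonneg fun _ => norm_nonneg _
  set T : ℝ := q ^ (e + 1) with hT
  have hT0 : 0 < T := by positivity
  refine ⟨2 * B * V * T ^ (1 + β.re) / δ + M * (q ^ (e + 1 - n)) ^ (1 + β.re), fun y hy => ?_⟩
  have hy0 : 0 < ‖y‖ := one_pos.trans_le hy
  rw [add_mul]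
  rcases lt_or_ge (T / ‖y‖) (q ^ n) with hc | hc
  · refine le_add_of_le_of_nonneg ?_ (by positivity)
    set a : K := -(x₀ / y) with ha
    have hna : ‖a‖ = T / ‖y‖ := by rw [ha, norm_neg, norm_div, hx₀]
    have ha0 : 0 < ‖a‖ := by rw [hna]; positivity
    have hay : -(a * y) = x₀ := by
      rw [ha, neg_mul, neg_neg, div_mul_cancel₀ _ (norm_pos_iff.1 hy0)]
    have h1 : (((ψ x₀ : Circle) : ℂ) - 1) * D.fourier F y =
        D.fourier (fun x => F (x + a) - F x) y := by
      rw [sub_mul, one_mul, ← hay, ← h.fourier_comp_add, LocalFieldData.fourier,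
        LocalFieldData.fourier, LocalFieldData.fourier]
      simp only [sub_mul]
      have hi : ∀ {G : K → ℂ}, Integrable G vol → Integrable (fun x => G x * D.psi (x * y)) vol := by
        intro G hG
        refine hG.norm.mono' (hG.1.mul ?_) (ae_of_all _ fun x => ?_)
        · exact (h.isLocal.psi_continuous.comp
            (continuous_id.mul continuous_const)).aestronglyMeasurable
        · rw [norm_mul, h.isLocal.psi_norm, mul_one]
      exact (integral_sub (hi (hFi.comp_add_right a)) (hi hFi)).symm
    have h2 : ∀ x, ‖F (x + a) - F x‖ ≤
        (Metric.closedBall 0 ‖a‖).indicator (fun _ => 2 * B * ‖a‖ ^ β.re) x := by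
      intro x
      by_cases hx : ‖x‖ ≤ ‖a‖
      · rw [Set.indicator_of_mem (by rwa [mem_closedBall_zero_iff])]
        have h3 : ∀ z : K, ‖z‖ ≤ ‖a‖ → ‖F z‖ ≤ B * ‖a‖ ^ β.re := by
          intro z hz
          rw [hF, norm_mul, mul_comm]
          refine mul_le_mul (hB z) ?_ (norm_nonneg _) hB0
          rcases eq_or_ne z 0 with rfl | hz0
          · have hβ0 : β ≠ 0 := fun h' => by simp [h'] at hβ
            rw [norm_zero, Complex.ofReal_zero, Complex.zero_cpow hβ0, norm_zero]
            positivity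
          · rw [Complex.norm_cpow_eq_rpow_re_of_pos (norm_pos_iff.2 hz0)]
            exact Real.rpow_le_rpow (norm_nonneg _) hz hβ.le
        have h4 := norm_sub_le (F (x + a)) (F x)
        have h5 := h3 _ (norm_add_le_of_le hx le_rfl)
        have h6 := h3 _ hx
        linarith
      · rw [Set.indicator_of_notMem (by rwa [mem_closedBall_zero_iff])]
        have h7 : F (x + a) = F x := by
          simp only [hF]
          rw [norm_add_eq_of_lt (not_le.1 hx), hs.1 x a (by rw [hna]; exact hc.le)]
        rw [h7, sub_self, norm_zero]
    have h3 : ‖D.fourier (fun x => F (x + a) - F x) y‖ ≤ 2 * B * ‖a‖ ^ β.re * (‖a‖ * V) := by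
      refine (h.isLocal.norm_fourier_le _ y).trans ?_
      change ∫ x, ‖F (x + a) - F x‖ ∂vol ≤ _
      refine (integral_mono ((hFi.comp_add_right a).sub hFi).norm ?_ h2).trans (le_of_eq ?_)
      · exact (integrable_indicator_iff Metric.isClosed_closedBall.measurableSet).2
          (integrableOn_const (isCompact_closedBall (0 : K) _).measure_lt_top.ne)
      · obtain ⟨k, hk⟩ := h.uniformizer.exists_norm_eq (norm_pos_iff.1 ha0)
        rw [integral_indicator_const _ Metric.isClosed_closedBall.measurableSet, hk,
          h.real_closedBall k, smul_eq_mul]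
        ring
    rw [← h1, norm_mul, ← hδ, mul_comm, ← le_div_iff₀ hδ0] at h3
    refine h3.trans (le_of_eq ?_)
    rw [hna, show (-1 - β.re) = -(1 + β.re) by ring, Real.rpow_neg hy0.le,
      Real.div_rpow hT0.le hy0.le, Real.rpow_add hT0, Real.rpow_add hy0, Real.rpow_one,
      Real.rpow_one]
    field_simp
  · refine le_add_of_nonneg_of_le (by positivity) ?_
    refine (h.isLocal.norm_fourier_le _ y).trans ?_
    change M ≤ _
    rw [mul_assoc, show (-1 - β.re) = -(1 + β.re) by ring, Real.rpow_neg hy0.le,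
      ← div_eq_mul_inv, ← Real.div_rpow (by positivity) hy0.le]
    refine le_mul_of_one_le_right hM0 (Real.one_le_rpow ?_ (by linarith))
    rw [one_le_div hy0, zpow_sub₀ hq0.ne', le_div_iff₀ (by positivity)]
    rw [le_div_iff₀ hy0] at hc
    linarith

end IsNonarchSetup

end nonarchTate


/-! ### Nonarchimedean zeta integrals and gamma factors -/

section nonarchGamma

variable {K : Type*} [NontriviallyNormedField K] [IsUltrametricDist K] [ProperSpace K]
  [MeasurableSpace K] [BorelSpace K]

namespace IsNonarchSetup

variable {ϖ : Kˣ} {ψ : AddChar K Circle} {vol : Measure K} (h : IsNonarchSetup ϖ ψ vol)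
include h

lemma measurableSet_norm_eq (r : ℝ) : MeasurableSet {x : K | ‖x‖ = r} :=
  measurableSet_eq_fun measurable_norm measurable_const

lemma charExt_eq_one (χ : Kˣ →ₜ* Circle) {x : K} (h1 : ‖x‖ = 1)
    (h2 : ‖x - 1‖ ≤ (resCard K : ℝ) ^ (-(mulConductor χ : ℤ))) : charExt χ x = 1 := by
  have hx : x ≠ 0 := norm_pos_iff.1 (by rw [h1]; exact one_pos)
  rw [charExt_of_ne χ hx, mulConductor_spec h.uniformizer χ (Units.mk0 x hx) h1 h2, Circle.coe_one]

lemma charExt_eq_one_of_unramified {χ : Kˣ →ₜ* Circle} (hc : mulConductor χ = 0) {x : K}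
    (h1 : ‖x‖ = 1) : charExt χ x = 1 := by
  refine h.charExt_eq_one χ h1 ?_
  rw [hc, Nat.cast_zero, neg_zero, zpow_zero, sub_eq_add_neg]
  exact norm_add_le_of_le h1.le (by rw [norm_neg, norm_one])

lemma integrable_indicator_quasi (χ : Kˣ →ₜ* Circle) {w : ℂ} (hw : 0 < w.re) (n : ℤ) :
    Integrable (fun x => (Metric.closedBall 0 ((resCard K : ℝ) ^ n)).indicator (fun _ => (1 : ℂ)) x
      * (nonarchData ϖ ψ vol).quasi χ w x) (nonarchData ϖ ψ vol).mulHaar := by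
  have hq0 := h.q_pos
  have hmem := h.mem_schwartz_iff.2 ⟨n, n, h.isStep_indicator (x₀ := 0) le_rfl
    (by rw [norm_zero]; positivity)⟩
  have hm : AEStronglyMeasurable ((Metric.closedBall 0 ((resCard K : ℝ) ^ n)).indicator
    (fun _ => (1 : ℂ))) (nonarchData ϖ ψ vol).vol := (h.integrable_schwartz hmem).1
  rw [h.isLocal.integrable_mul_quasi_iff hm]
  refine h.isLocal.integrable_rapidDecay (fun N => ⟨(1 + (resCard K : ℝ) ^ n) ^ N, fun x _ => ?_⟩)
    hm hw
  by_cases hx : x ∈ Metric.closedBall 0 ((resCard K : ℝ) ^ n)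
  · rw [Set.indicator_of_mem hx, norm_one, mul_one]
    rw [mem_closedBall_zero_iff] at hx
    gcongr
  · rw [Set.indicator_of_notMem hx, norm_zero, mul_zero]
    positivity

lemma quasi_uniformizer_zpow (χ : Kˣ →ₜ* Circle) (w : ℂ) (n : ℤ) :
    (nonarchData ϖ ψ vol).quasi χ w ((ϖ : K) ^ n) =
      ((χ ϖ : Circle) : ℂ) ^ n * (resCard K : ℂ) ^ (-(n * w)) := by
  have hq0 := h.q_pos
  have h1 : charExt χ ((ϖ : K) ^ n) = ((χ ϖ : Circle) : ℂ) ^ n := by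
    rw [← Units.val_zpow_eq_zpow_val, charExt_unit, map_zpow, Circle.coe_zpow]
  rw [LocalFieldData.quasi, h1]
  congr 1
  change ((‖(ϖ : K) ^ n‖ : ℝ) : ℂ) ^ w = _
  rw [h.uniformizer.norm_zpow, ← Real.rpow_intCast, ← Complex.cpow_mul_ofReal_nonneg hq0.le]
  push_cast
  rw [neg_mul]

/-- The zeta integral of the indicator function of a ball. -/
lemma quasi_mul_integral_ball (χ : Kˣ →ₜ* Circle) (w : ℂ) (n : ℤ) :
    (nonarchData ϖ ψ vol).quasi χ w ((ϖ : K) ^ n) *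
      ∫ x, (Metric.closedBall 0 ((resCard K : ℝ) ^ n)).indicator (fun _ => (1 : ℂ)) x *
        (nonarchData ϖ ψ vol).quasi χ w x ∂(nonarchData ϖ ψ vol).mulHaar =
      ∫ x, (Metric.closedBall 0 1).indicator (fun _ => (1 : ℂ)) x *
        (nonarchData ϖ ψ vol).quasi χ w x ∂(nonarchData ϖ ψ vol).mulHaar := by
  have hq0 := h.q_pos
  rw [← integral_const_mul, ← h.isLocal.integral_mul_left (zpow_ne_zero n ϖ.ne_zero)
    (fun x => (Metric.closedBall 0 1).indicator (fun _ => (1 : ℂ)) x *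
        (nonarchData ϖ ψ vol).quasi χ w x)]
  refine integral_congr_ae (ae_of_all _ fun x => ?_)
  have e : (ϖ : K) ^ n * x ∈ Metric.closedBall 0 1 ↔
      x ∈ Metric.closedBall 0 ((resCard K : ℝ) ^ n) := by
    rw [mem_closedBall_zero_iff, mem_closedBall_zero_iff, norm_mul,
      h.uniformizer.norm_zpow, zpow_neg, inv_mul_le_iff₀ (by positivity), mul_one]
  simp only [h.isLocal.quasi_mul]
  by_cases hx : x ∈ Metric.closedBall 0 ((resCard K : ℝ) ^ n)
  · rw [Set.indicator_of_mem hx, Set.indicator_of_mem (e.2 hx)]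
    ring
  · rw [Set.indicator_of_notMem hx, Set.indicator_of_notMem (mt e.1 hx)]
    ring

/-- Multiplying the integral over `O` by `χ(ϖ) q^{-w}` gives the integral over `ϖ O`. The difference
is the integral over the units, on which an unramified quasi-character is `1`. -/
lemma integral_ball_of_unramified {χ : Kˣ →ₜ* Circle} (hc : mulConductor χ = 0) {w : ℂ}
    (hw : 0 < w.re) :
    (1 - ((χ ϖ : Circle) : ℂ) * (resCard K : ℂ) ^ (-w)) *
      ∫ x, (Metric.closedBall 0 1).indicator (fun _ => (1 : ℂ)) x *
        (nonarchData ϖ ψ vol).quasi χ w x ∂(nonarchData ϖ ψ vol).mulHaar =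
      (((nonarchData ϖ ψ vol).mulHaar.real {x | ‖x‖ = 1} : ℝ) : ℂ) := by
  have hq := h.uniformizer.one_lt_q
  have hq0 := h.q_pos
  set D := nonarchData ϖ ψ vol with hD
  have h1 := h.quasi_mul_integral_ball χ w (-1)
  have i0 := h.integrable_indicator_quasi χ hw 0
  have i1 := h.integrable_indicator_quasi χ hw (-1)
  rw [zpow_zero] at i0
  rw [← hD] at h1 i0 i1
  set Z := ∫ x, (Metric.closedBall 0 1).indicator (fun _ => (1 : ℂ)) x * D.quasi χ w x ∂D.mulHaar
    with hZ
  have hq1 := h.quasi_uniformizer_zpow χ w (-1)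
  have hq2 : ((χ ϖ : Circle) : ℂ) * (resCard K : ℂ) ^ (-w) * D.quasi χ w ((ϖ : K) ^ (-1 : ℤ)) = 1 := by
    rw [hq1, zpow_neg_one, Int.cast_neg, Int.cast_one, neg_mul, neg_neg, one_mul, Complex.cpow_neg]
    have h3 := Circle.coe_ne_zero (χ ϖ)
    have h4 : (resCard K : ℂ) ^ w ≠ 0 := by
      rw [Complex.cpow_def_of_ne_zero (by exact_mod_cast hq0.ne')]
      exact Complex.exp_ne_zero _
    field_simp
  rw [sub_mul, one_mul, ← h1, ← mul_assoc, hq2, one_mul, h1, hZ, ← integral_sub i0 i1]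
  rw [← mul_one ((D.mulHaar.real {x | ‖x‖ = 1} : ℝ) : ℂ), ← Complex.real_smul,
    ← integral_indicator_const _ (h.measurableSet_norm_eq 1)]
  refine integral_congr_ae (ae_of_all _ fun x => ?_)
  simp only
  by_cases hx : ‖x‖ = 1
  · rw [Set.indicator_of_mem (by simp [hx]), Set.indicator_of_notMem
      (by rw [mem_closedBall_zero_iff, hx, not_le]; exact zpow_lt_one_of_neg₀ hq (by norm_num)),
      Set.indicator_of_mem (s := {x : K | ‖x‖ = 1}) hx, zero_mul, sub_zero, one_mul,
      LocalFieldData.quasi,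
      h.charExt_eq_one_of_unramified hc hx, one_mul]
    change ((‖x‖ : ℝ) : ℂ) ^ w = 1
    rw [hx, Complex.ofReal_one, Complex.one_cpow]
  · rw [Set.indicator_of_notMem (s := {x : K | ‖x‖ = 1}) hx]
    have e : x ∈ Metric.closedBall (0 : K) 1 ↔
        x ∈ Metric.closedBall (0 : K) ((resCard K : ℝ) ^ (-1 : ℤ)) := by
      rw [mem_closedBall_zero_iff, mem_closedBall_zero_iff]
      refine ⟨fun h1 => ?_, fun h1 => h1.trans (zpow_lt_one_of_neg₀ hq (by norm_num)).le⟩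
      simpa using h.uniformizer.norm_le_zpow_sub_one (n := 0) (by simpa using h1) (by simpa using hx)
    by_cases hx1 : x ∈ Metric.closedBall (0 : K) 1
    · rw [Set.indicator_of_mem hx1, Set.indicator_of_mem (e.1 hx1), sub_self]
    · rw [Set.indicator_of_notMem hx1, Set.indicator_of_notMem (mt e.2 hx1), sub_self]

lemma mulHaar_real_sphere_pos : 0 < (nonarchData ϖ ψ vol).mulHaar.real {x | ‖x‖ = 1} := by
  have := h.haar
  have e : {x : K | ‖x‖ = 1} = {x | 1 ≤ ‖x‖ ∧ ‖x‖ ≤ 1} := by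
    ext x; simp [le_antisymm_iff, and_comm]
  refine ENNReal.toReal_pos ?_ ?_
  · intro h0
    have h1 := h.isLocal.vol_absolutelyContinuous h0
    have h2 : IsOpen {x : K | ‖x‖ = 1} := by
      have : {x : K | ‖x‖ = 1} = Metric.sphere 0 1 := by ext; simp
      rw [this]
      exact IsUltrametricDist.isOpen_sphere 0 one_ne_zero
    exact (h2.measure_pos vol ⟨1, norm_one⟩).ne' h1
  · rw [e]
    exact (h.isLocal.mulHaar_annulus_lt_top one_pos).ne

lemma gamma_of_unramified {χ : Kˣ →ₜ* Circle} (hc : mulConductor χ = 0) (w : ℂ) :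
    (nonarchData ϖ ψ vol).gamma w χ = ((χ ϖ : Circle) : ℂ) ^ addConductor ψ *
      (resCard K : ℂ) ^ ((addConductor ψ : ℂ) * (1 / 2 - w)) *
      (1 - ((χ⁻¹ ϖ : Circle) : ℂ) * (resCard K : ℂ) ^ (-(1 - w)))⁻¹ *
      (1 - ((χ ϖ : Circle) : ℂ) * (resCard K : ℂ) ^ (-w)) := by
  simp only [LocalFieldData.gamma, nonarchData, mulConductor_inv, hc, if_true, div_inv_eq_mul]

lemma one_sub_char_ne_zero (χ : Kˣ →ₜ* Circle) {w : ℂ} (hw : 0 < w.re) :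
    1 - ((χ ϖ : Circle) : ℂ) * (resCard K : ℂ) ^ (-w) ≠ 0 := by
  have hq := h.uniformizer.one_lt_q
  rw [sub_ne_zero]
  intro h1
  have h2 := congrArg norm h1
  rw [norm_one, norm_mul, Circle.norm_coe, one_mul,
    Complex.norm_natCast_cpow_of_pos (by exact_mod_cast h.q_pos), Complex.neg_re] at h2
  exact (Real.rpow_lt_one_of_one_lt_of_neg hq (neg_lt_zero.2 hw)).ne' h2

/-- The test function is the indicator of `O`, whose transform is `q^{-e/2}` times the indicator of
`ϖ^{-e} O`. Rescaling that ball to `O` produces the epsilon factor, and the two integrals over `O`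
the quotient of `L`-factors. -/
lemma exists_test_of_unramified {χ : Kˣ →ₜ* Circle} (hc : mulConductor χ = 0) :
    ∃ f ∈ (nonarchData ϖ ψ vol).schwartz, ∀ w : ℂ, 0 < w.re → w.re < 1 →
      ∫ x, (nonarchData ϖ ψ vol).mellinIntegrand f χ w x ∂(nonarchData ϖ ψ vol).vol ≠ 0 ∧
      ∫ x, (nonarchData ϖ ψ vol).mellinIntegrand ((nonarchData ϖ ψ vol).fourier f) χ⁻¹ (1 - w) x
          ∂(nonarchData ϖ ψ vol).vol = (nonarchData ϖ ψ vol).gamma w χ *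
        ∫ x, (nonarchData ϖ ψ vol).mellinIntegrand f χ w x ∂(nonarchData ϖ ψ vol).vol := by
  have hq0 := h.q_pos
  have hqc : (resCard K : ℂ) ≠ 0 := by exact_mod_cast hq0.ne'
  have hmem := h.mem_schwartz_iff.2 ⟨0, 0, h.isStep_indicator (n := 0) (m := 0) (x₀ := 0) le_rfl
    (by rw [norm_zero]; positivity)⟩
  refine ⟨_, hmem, fun w hw0 hw1 => ?_⟩
  rw [h.isLocal.integral_mellinIntegrand, h.isLocal.integral_mellinIntegrand, zpow_zero]
  have hw1' : 0 < (1 - w).re := by simpa using hw1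
  have hZ := h.integral_ball_of_unramified hc hw0
  have hZ' := h.integral_ball_of_unramified (by rwa [mulConductor_inv] : mulConductor χ⁻¹ = 0) hw1'
  have hn := h.one_sub_char_ne_zero χ hw0
  have hn' := h.one_sub_char_ne_zero χ⁻¹ hw1'
  have hVpos := h.mulHaar_real_sphere_pos
  have hE := h.quasi_mul_integral_ball χ⁻¹ (1 - w) (addConductor ψ)
  rw [h.quasi_uniformizer_zpow] at hE
  have hF := h.fourier_indicator 0
  simp only [zpow_zero, sub_zero, one_mul] at hF
  set D := nonarchData ϖ ψ vol with hD
  have hG := h.gamma_of_unramified hc w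
  rw [← hD] at hG
  set V : ℝ := D.mulHaar.real {x | ‖x‖ = 1}
  set Z := ∫ x, (Metric.closedBall 0 1).indicator (fun _ => (1 : ℂ)) x * D.quasi χ w x ∂D.mulHaar
  set Z' := ∫ x, (Metric.closedBall 0 1).indicator (fun _ => (1 : ℂ)) x *
    D.quasi χ⁻¹ (1 - w) x ∂D.mulHaar
  set A := ((resCard K : ℝ) ^ (-(addConductor ψ : ℝ) / 2)) with hA
  set E := ∫ x, (Metric.closedBall 0 ((resCard K : ℝ) ^ addConductor ψ)).indicator
    (fun _ => (1 : ℂ)) x * D.quasi χ⁻¹ (1 - w) x ∂D.mulHaar with hEdef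
  have hV0 : (V : ℂ) ≠ 0 := by exact_mod_cast hVpos.ne'
  refine ⟨fun h0 => hV0 (by rw [← hZ, h0, mul_zero]), ?_⟩
  have hFE : ∫ x, D.fourier ((Metric.closedBall 0 1).indicator fun _ => (1 : ℂ)) x *
      D.quasi χ⁻¹ (1 - w) x ∂D.mulHaar = (A : ℂ) * E := by
    rw [hEdef, ← integral_const_mul]
    refine integral_congr_ae (ae_of_all _ fun x => ?_)
    simp only [hF]
    by_cases hx : x ∈ Metric.closedBall 0 ((resCard K : ℝ) ^ addConductor ψ)
    · rw [Set.indicator_of_mem hx, Set.indicator_of_mem hx, one_mul]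
    · rw [Set.indicator_of_notMem hx, Set.indicator_of_notMem hx, zero_mul, mul_zero]
  have hχ0 := Circle.coe_ne_zero (χ ϖ)
  have hχi : ((χ⁻¹ ϖ : Circle) : ℂ) = ((χ ϖ : Circle) : ℂ)⁻¹ := Circle.coe_inv _
  have hEZ : E = ((χ ϖ : Circle) : ℂ) ^ addConductor ψ *
      (resCard K : ℂ) ^ ((addConductor ψ : ℂ) * (1 - w)) * Z' := by
    rw [← hE, hχi, Complex.cpow_neg, inv_zpow]
    have h4 : (resCard K : ℂ) ^ ((addConductor ψ : ℂ) * (1 - w)) ≠ 0 := by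
      rw [Complex.cpow_def_of_ne_zero hqc]
      exact Complex.exp_ne_zero _
    have h5 := zpow_ne_zero (addConductor ψ) hχ0
    field_simp
  have hAc : (A : ℂ) * (resCard K : ℂ) ^ ((addConductor ψ : ℂ) * (1 - w)) =
      (resCard K : ℂ) ^ ((addConductor ψ : ℂ) * (1 / 2 - w)) := by
    rw [hA, Complex.ofReal_cpow hq0.le]
    push_cast
    rw [← Complex.cpow_add _ _ hqc]
    congr 1
    ring
  have hZeq : (1 - ((χ ϖ : Circle) : ℂ) * (resCard K : ℂ) ^ (-w)) * Z =
      (1 - ((χ⁻¹ ϖ : Circle) : ℂ) * (resCard K : ℂ) ^ (-(1 - w))) * Z' := by rw [hZ, hZ']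
  rw [hFE, hEZ, hG, mul_assoc _ _ Z, hZeq, ← hAc]
  field_simp

lemma gamma_of_ramified {χ : Kˣ →ₜ* Circle} (hc : mulConductor χ ≠ 0) (w : ℂ) :
    (nonarchData ϖ ψ vol).gamma w χ =
      ∫ x in {x : K | ‖x‖ = (resCard K : ℝ) ^ (addConductor ψ + (mulConductor χ : ℤ))},
        charExt χ⁻¹ x * (‖x‖ : ℂ) ^ (-w) * ((ψ x : Circle) : ℂ) ∂vol := by
  simp only [LocalFieldData.gamma, nonarchData, mulConductor_inv, hc, if_false, mul_one, div_one]

/-- The norm is constant on the sphere of integration, so all dependence on `w` sits in one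
exponential factor; analyticity is then immediate. -/
lemma gamma_of_ramified' {χ : Kˣ →ₜ* Circle} (hc : mulConductor χ ≠ 0) (w : ℂ) :
    (nonarchData ϖ ψ vol).gamma w χ =
      ((((resCard K : ℝ) ^ (addConductor ψ + (mulConductor χ : ℤ)) : ℝ)) : ℂ) ^ (-w) *
      ∫ x in {x : K | ‖x‖ = (resCard K : ℝ) ^ (addConductor ψ + (mulConductor χ : ℤ))},
        charExt χ⁻¹ x * ((ψ x : Circle) : ℂ) ∂vol := by
  rw [h.gamma_of_ramified hc, ← integral_const_mul]
  refine setIntegral_congr_fun (h.measurableSet_norm_eq _) fun x hx => ?_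
  rw [Set.mem_ofPred_eq] at hx
  simp only [hx]
  ring

/-- The ramified test function is the indicator function of `1 + ϖ^c O`. -/
lemma fourier_indicator_one_add (n : ℤ) (y : K) : (nonarchData ϖ ψ vol).fourier
    ((Metric.closedBall 1 ((resCard K : ℝ) ^ n)).indicator fun _ => (1 : ℂ)) y =
      ((ψ y : Circle) : ℂ) * (Metric.closedBall 0 ((resCard K : ℝ) ^ (addConductor ψ - n))).indicator
        (fun _ => (((resCard K : ℝ) ^ n *
          (resCard K : ℝ) ^ (-(addConductor ψ : ℝ) / 2) : ℝ) : ℂ)) y := by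
  rw [← h.fourier_indicator]
  have h1 := h.fourier_comp_add
    ((Metric.closedBall 0 ((resCard K : ℝ) ^ n)).indicator fun _ => (1 : ℂ)) (-1) y
  rw [neg_one_mul, neg_neg] at h1
  rw [← h1]
  congr 1
  ext x
  have e : x ∈ Metric.closedBall (1 : K) ((resCard K : ℝ) ^ n) ↔
      x + -1 ∈ Metric.closedBall (0 : K) ((resCard K : ℝ) ^ n) := by
    rw [Metric.mem_closedBall, mem_closedBall_zero_iff, dist_eq_norm, sub_eq_add_neg]
  by_cases hx : x ∈ Metric.closedBall (1 : K) ((resCard K : ℝ) ^ n)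
  · rw [Set.indicator_of_mem hx, Set.indicator_of_mem (e.1 hx)]
  · rw [Set.indicator_of_notMem hx, Set.indicator_of_notMem (mt e.2 hx)]

/-- By minimality of the conductor `c` there is a unit `u` congruent to `1` modulo `ϖ^{c-1}` with
`χ(u) ≠ 1`. On the ball of radius `q^{e+c-1}` the substitution `x ↦ ux` leaves `ψ` unchanged and
multiplies the integral by `χ(u)`. -/
lemma integral_psi_ball_eq_zero {χ : Kˣ →ₜ* Circle} (hc : mulConductor χ ≠ 0) (w : ℂ) :
    ∫ x, (Metric.closedBall 0 ((resCard K : ℝ) ^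
        (addConductor ψ + (mulConductor χ : ℤ) - 1))).indicator (fun _ => (1 : ℂ)) x *
      ((ψ x : Circle) : ℂ) * (nonarchData ϖ ψ vol).quasi χ w x ∂(nonarchData ϖ ψ vol).mulHaar
      = 0 := by
  have hq0 := h.q_pos
  obtain ⟨u, hu1, hu2, hu3⟩ := exists_char_ne_one χ hc
  set F : K → ℂ := fun x => (Metric.closedBall 0 ((resCard K : ℝ) ^
        (addConductor ψ + (mulConductor χ : ℤ) - 1))).indicator (fun _ => (1 : ℂ)) x *
      ((ψ x : Circle) : ℂ) * (nonarchData ϖ ψ vol).quasi χ w x with hF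
  have h1 : ∀ x, F ((u : K) * x) = ((χ u : Circle) : ℂ) * F x := by
    intro x
    have hqu : (nonarchData ϖ ψ vol).quasi χ w (u : K) = ((χ u : Circle) : ℂ) := by
      rw [LocalFieldData.quasi, charExt_unit]
      change _ * ((‖(u : K)‖ : ℝ) : ℂ) ^ w = _
      rw [hu1, Complex.ofReal_one, Complex.one_cpow, mul_one]
    simp only [hF, h.isLocal.quasi_mul, hqu]
    have e : (u : K) * x ∈ Metric.closedBall (0 : K) ((resCard K : ℝ) ^
        (addConductor ψ + (mulConductor χ : ℤ) - 1)) ↔ x ∈ Metric.closedBall (0 : K)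
        ((resCard K : ℝ) ^ (addConductor ψ + (mulConductor χ : ℤ) - 1)) := by
      rw [mem_closedBall_zero_iff, mem_closedBall_zero_iff, norm_mul, hu1, one_mul]
    by_cases hx : x ∈ Metric.closedBall (0 : K) ((resCard K : ℝ) ^
        (addConductor ψ + (mulConductor χ : ℤ) - 1))
    · rw [Set.indicator_of_mem hx, Set.indicator_of_mem (e.2 hx)]
      have h2 : ψ ((u : K) * x) = ψ x := by
        rw [show (u : K) * x = (u - 1) * x + x by ring, AddChar.map_add_eq_mul,
          psi_eq_one h.uniformizer h.psi_continuous h.psi_ne_one, one_mul]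
        rw [mem_closedBall_zero_iff] at hx
        rw [norm_mul]
        refine (mul_le_mul hu2 hx (norm_nonneg _) (by positivity)).trans (le_of_eq ?_)
        rw [← zpow_add₀ hq0.ne']
        ring_nf
      rw [h2]
      ring
    · rw [Set.indicator_of_notMem hx, Set.indicator_of_notMem (mt e.1 hx)]
      ring
  have h2 := h.isLocal.integral_mul_left u.ne_zero F
  simp only [h1] at h2
  rw [integral_const_mul] at h2
  by_contra h0
  exact hu3 (Circle.ext (by simpa using mul_right_cancel₀ h0 (h2.trans (one_mul _).symm)))

/-- For the indicator of `1 + ϖ^c O` the zeta integral is just a volume. Its transform is that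
volume times `ψ` on the ball of radius `q^{e+c}`; the inner ball contributes nothing, and the
outermost sphere gives the Gauss integral defining `ε`. -/
lemma exists_test_of_ramified {χ : Kˣ →ₜ* Circle} (hc : mulConductor χ ≠ 0) :
    ∃ f ∈ (nonarchData ϖ ψ vol).schwartz, ∀ w : ℂ, 0 < w.re → w.re < 1 →
      ∫ x, (nonarchData ϖ ψ vol).mellinIntegrand f χ w x ∂(nonarchData ϖ ψ vol).vol ≠ 0 ∧
      ∫ x, (nonarchData ϖ ψ vol).mellinIntegrand ((nonarchData ϖ ψ vol).fourier f) χ⁻¹ (1 - w) x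
          ∂(nonarchData ϖ ψ vol).vol = (nonarchData ϖ ψ vol).gamma w χ *
        ∫ x, (nonarchData ϖ ψ vol).mellinIntegrand f χ w x ∂(nonarchData ϖ ψ vol).vol := by
  have := h.haar
  have hq := h.uniformizer.one_lt_q
  have hq0 := h.q_pos
  set c : ℤ := ((mulConductor χ : ℕ) : ℤ) with hcdef
  have hc1 : 1 ≤ c := by
    have := Nat.one_le_iff_ne_zero.2 hc
    omega
  have hmem := h.mem_schwartz_iff.2 ⟨-c, 0, h.isStep_indicator (n := -c) (m := 0) (x₀ := 1)
    (by omega) (by rw [norm_one, zpow_zero])⟩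
  refine ⟨_, hmem, fun w hw0 hw1 => ?_⟩
  have hw1' : 0 < (1 - w).re := by simpa using hw1
  set B := Metric.closedBall (1 : K) ((resCard K : ℝ) ^ (-c)) with hB
  have hBn : ∀ x ∈ B, ‖x‖ = 1 := by
    intro x hx
    rw [hB, Metric.mem_closedBall, dist_eq_norm] at hx
    have h1 : ‖x - 1‖ < ‖(1 : K)‖ := by
      rw [norm_one]
      exact hx.trans_lt (zpow_lt_one_of_neg₀ hq (by omega))
    rw [← add_sub_cancel 1 x, norm_add_eq_of_lt h1, norm_one]
  set A : ℝ := (resCard K : ℝ) ^ (-c) * (resCard K : ℝ) ^ (-(addConductor ψ : ℝ) / 2) with hA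
  have hA0 : (A : ℂ) ≠ 0 := by
    have : 0 < A := by positivity
    exact_mod_cast this.ne'
  have hZ : ∫ x, (nonarchData ϖ ψ vol).mellinIntegrand (B.indicator fun _ => (1 : ℂ)) χ w x
      ∂(nonarchData ϖ ψ vol).vol = A := by
    have e : ∀ x, (nonarchData ϖ ψ vol).mellinIntegrand (B.indicator fun _ => (1 : ℂ)) χ w x =
        B.indicator (fun _ => (1 : ℂ)) x := by
      intro x
      rw [LocalFieldData.mellinIntegrand]
      by_cases hx : x ∈ B
      · have hx' := hBn x hx
        rw [Set.indicator_of_mem hx, one_mul]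
        change _ * ((‖x‖ : ℝ) : ℂ) ^ (w - 1) = 1
        rw [hx', Complex.ofReal_one, Complex.one_cpow, mul_one]
        refine h.charExt_eq_one χ hx' ?_
        rwa [hB, Metric.mem_closedBall, dist_eq_norm] at hx
      · rw [Set.indicator_of_notMem hx, zero_mul, zero_mul]
    simp only [e]
    rw [integral_indicator_const _ Metric.isClosed_closedBall.measurableSet, Complex.real_smul,
      mul_one, hA, ← h.real_closedBall]
    change ((vol.real _ : ℝ) : ℂ) = _
    rw [Measure.real, Measure.real, ← measure_preimage_add_right vol (1 : K)]
    congr 3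
    ext z
    simp [dist_eq_norm]
  rw [hZ]
  refine ⟨hA0, ?_⟩
  have hz := h.integral_psi_ball_eq_zero (χ := χ⁻¹) (by rwa [mulConductor_inv]) (1 - w)
  rw [mulConductor_inv, ← hcdef] at hz
  rw [h.isLocal.integral_mellinIntegrand, h.gamma_of_ramified hc, ← hcdef]
  set S := {x : K | ‖x‖ = (resCard K : ℝ) ^ (addConductor ψ + c)} with hS
  have hSm : MeasurableSet S := h.measurableSet_norm_eq _
  set D := nonarchData ϖ ψ vol with hD
  have hε : ∫ x in S, charExt χ⁻¹ x * (‖x‖ : ℂ) ^ (-w) * ((ψ x : Circle) : ℂ) ∂vol =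
      ∫ x, S.indicator (fun x => ((ψ x : Circle) : ℂ) * D.quasi χ⁻¹ (1 - w) x) x ∂D.mulHaar := by
    rw [← integral_indicator hSm, h.isLocal.integral_mulHaar]
    refine integral_congr_ae (ae_of_all _ fun x => ?_)
    simp only
    by_cases hx : x ∈ S
    · rw [Set.indicator_of_mem hx, Set.indicator_of_mem hx]
      have hx0 : (0 : ℝ) < ‖x‖ := by
        rw [hS, Set.mem_ofPred_eq] at hx
        rw [hx]; positivity
      change _ = ((‖x‖ : ℝ)⁻¹) • (_ * (charExt χ⁻¹ x * ((‖x‖ : ℝ) : ℂ) ^ (1 - w)))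
      have hxc : ((‖x‖ : ℝ) : ℂ) ≠ 0 := by exact_mod_cast hx0.ne'
      rw [Complex.real_smul, sub_eq_add_neg, Complex.cpow_add _ _ hxc, Complex.cpow_one,
        Complex.ofReal_inv]
      field_simp
    · rw [Set.indicator_of_notMem hx, Set.indicator_of_notMem hx, smul_zero]
  rw [hε]
  set g : ℤ → K → ℂ := fun n x =>
    (Metric.closedBall 0 ((resCard K : ℝ) ^ n)).indicator (fun _ => (1 : ℂ)) x *
      ((ψ x : Circle) : ℂ) * D.quasi χ⁻¹ (1 - w) x with hg
  have hgi : ∀ n, Integrable (g n) D.mulHaar := by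
    intro n
    refine (h.integrable_indicator_quasi χ⁻¹ hw1' n).norm.mono' ?_ (ae_of_all _ fun x => ?_)
    · refine AEStronglyMeasurable.mul (AEStronglyMeasurable.mul ?_ ?_)
        (h.isLocal.measurable_quasi _ _).aestronglyMeasurable
      · exact ((measurable_const.indicator
          Metric.isClosed_closedBall.measurableSet)).aestronglyMeasurable
      · exact h.isLocal.psi_continuous.aestronglyMeasurable
    · rw [hg, norm_mul, norm_mul, Circle.norm_coe, mul_one, norm_mul]
  have hsum : ∀ x, D.fourier (B.indicator fun _ => (1 : ℂ)) x * D.quasi χ⁻¹ (1 - w) x =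
      A * (g (addConductor ψ + c - 1) x +
        S.indicator (fun x => ((ψ x : Circle) : ℂ) * D.quasi χ⁻¹ (1 - w) x) x) := by
    intro x
    rw [hD, h.fourier_indicator_one_add, sub_neg_eq_add, ← hA, ← hD]
    simp only [hg]
    by_cases hx : x ∈ S
    · have hx' : ‖x‖ = (resCard K : ℝ) ^ (addConductor ψ + c) := hx
      rw [Set.indicator_of_mem hx, Set.indicator_of_mem
        (by rw [mem_closedBall_zero_iff, hx']), Set.indicator_of_notMem
        (by rw [mem_closedBall_zero_iff, hx', not_le]; exact zpow_lt_zpow_right₀ hq (by omega))]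
      ring
    · have hx' : ‖x‖ ≠ (resCard K : ℝ) ^ (addConductor ψ + c) := hx
      rw [Set.indicator_of_notMem hx]
      have e : x ∈ Metric.closedBall (0 : K) ((resCard K : ℝ) ^ (addConductor ψ + c)) ↔
          x ∈ Metric.closedBall (0 : K) ((resCard K : ℝ) ^ (addConductor ψ + c - 1)) := by
        rw [mem_closedBall_zero_iff, mem_closedBall_zero_iff]
        exact ⟨fun h1 => h.uniformizer.norm_le_zpow_sub_one h1 hx',
          fun h1 => h1.trans (zpow_le_zpow_right₀ hq.le (by omega))⟩
      by_cases hx1 : x ∈ Metric.closedBall (0 : K) ((resCard K : ℝ) ^ (addConductor ψ + c))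
      · rw [Set.indicator_of_mem hx1, Set.indicator_of_mem (e.1 hx1)]
        ring
      · rw [Set.indicator_of_notMem hx1, Set.indicator_of_notMem (mt e.2 hx1)]
        ring
  have hSi : Integrable (fun x => S.indicator (fun x => ((ψ x : Circle) : ℂ) *
      D.quasi χ⁻¹ (1 - w) x) x) D.mulHaar := by
    refine ((hgi (addConductor ψ + c)).indicator hSm).congr (ae_of_all _ fun x => ?_)
    simp only
    by_cases hx : x ∈ S
    · have hx' : ‖x‖ = (resCard K : ℝ) ^ (addConductor ψ + c) := hx
      rw [Set.indicator_of_mem hx, Set.indicator_of_mem hx]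
      simp only [hg]
      rw [Set.indicator_of_mem (by rw [mem_closedBall_zero_iff, hx']), one_mul]
    · rw [Set.indicator_of_notMem hx, Set.indicator_of_notMem hx]
  simp only [hsum]
  rw [integral_const_mul, integral_add (hgi _) hSi, hz, zero_add, mul_comm]

lemma gamma_meromorphicAt (χ : Kˣ →ₜ* Circle) (z : ℂ) :
    MeromorphicAt (fun w => (nonarchData ϖ ψ vol).gamma w χ) z ∧
      (z.re < 1 → AnalyticAt ℂ (fun w => (nonarchData ϖ ψ vol).gamma w χ) z) := by
  have hq0 := h.q_pos
  have hcp : ∀ {q : ℝ} (_ : 0 < q) {g : ℂ → ℂ} (_ : Differentiable ℂ g),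
      Differentiable ℂ fun w => (q : ℂ) ^ g w := by
    intro q hq g hg
    have hqc : (q : ℂ) ≠ 0 := by exact_mod_cast hq.ne'
    exact fun w => (hg w).const_cpow (Or.inl hqc)
  by_cases hc : mulConductor χ = 0
  · simp only [h.gamma_of_unramified hc]
    have hcq := fun {g : ℂ → ℂ} (hg : Differentiable ℂ g) => hcp hq0 hg
    simp only [Complex.ofReal_natCast] at hcq
    have h1 : AnalyticAt ℂ (fun w => ((χ ϖ : Circle) : ℂ) ^ addConductor ψ *
      (resCard K : ℂ) ^ ((addConductor ψ : ℂ) * (1 / 2 - w))) z :=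
      ((hcq (by fun_prop)).const_mul _).analyticAt z
    have h2 : AnalyticAt ℂ
        (fun w => (1 - ((χ⁻¹ ϖ : Circle) : ℂ) * (resCard K : ℂ) ^ (-(1 - w)))) z :=
      (((hcq (by fun_prop)).const_mul _).const_sub 1).analyticAt z
    have h3 : AnalyticAt ℂ (fun w => 1 - ((χ ϖ : Circle) : ℂ) * (resCard K : ℂ) ^ (-w)) z :=
      (((hcq (by fun_prop)).const_mul _).const_sub 1).analyticAt z
    refine ⟨(h1.meromorphicAt.mul h2.meromorphicAt.inv).mul h3.meromorphicAt, fun hz => ?_⟩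
    exact (h1.mul (h2.inv (h.one_sub_char_ne_zero χ⁻¹ (by simpa using hz)))).mul h3
  · simp only [h.gamma_of_ramified' hc]
    have h1 : Differentiable ℂ fun w : ℂ =>
        ((((resCard K : ℝ) ^ (addConductor ψ + (mulConductor χ : ℤ)) : ℝ)) : ℂ) ^ (-w) *
        ∫ x in {x : K | ‖x‖ = (resCard K : ℝ) ^ (addConductor ψ + (mulConductor χ : ℤ))},
          charExt χ⁻¹ x * ((ψ x : Circle) : ℂ) ∂vol :=
      (hcp (by positivity) (by fun_prop)).mul_const _
    exact ⟨(h1.analyticAt z).meromorphicAt, fun _ => h1.analyticAt z⟩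

lemma isTate : (nonarchData ϖ ψ vol).IsTate 1 where
  toIsLocal := h.isLocal
  schwartz_continuous f hf := hf.1.continuous
  schwartz_decay f hf := by
    intro N
    have h1 : Continuous fun x => ((1 + ‖x‖) ^ N : ℝ) • f x :=
      (by fun_prop : Continuous fun x : K => ((1 + ‖x‖) ^ N : ℝ)).smul hf.1.continuous
    obtain ⟨C, hC⟩ := (hf.2.smul_left (f := fun x : K => ((1 + ‖x‖) ^ N : ℝ))
      ).exists_bound_of_continuous h1
    refine ⟨C, fun x _ => ?_⟩
    have h2 := hC x
    rwa [Pi.smul_apply', norm_smul, Real.norm_of_nonneg (by positivity)] at h2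
  schwartz_add f hf g hg := ⟨hf.1.add hg.1, hf.2.add hg.2⟩
  schwartz_smul c f hf := ⟨hf.1.comp fun z => c * z, hf.2.smul_left (f := fun _ => c)⟩
  schwartz_comp_mul a ha f hf := ⟨hf.1.comp_continuous (by fun_prop),
    hf.2.comp_homeomorph (Homeomorph.mulLeft₀ a ha)⟩
  fourier_mem f hf := by
    obtain ⟨n, m, hs⟩ := h.mem_schwartz_iff.1 hf
    exact h.mem_schwartz_iff.2 ⟨_, _, h.isStep_fourier hs⟩
  fourier_fourier f hf := h.fourier_fourier hf
  ae_eq_zero u hu hz := h.ae_eq_zero hu hz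
  exists_test χ := by
    by_cases hc : mulConductor χ = 0
    · exact h.exists_test_of_unramified hc
    · exact h.exists_test_of_ramified hc
  gamma_meromorphic χ z := (h.gamma_meromorphicAt χ z).1
  gamma_analytic χ z := (h.gamma_meromorphicAt χ z).2

end IsNonarchSetup

end nonarchGamma


/-! ### Functions with a power-like singularity at `0` -/

section symbol

variable {E : Type*} [NormedAddCommGroup E] [NormedSpace ℝ E]

/-- The first `k` derivatives of `F` in the direction `v` exist off `0`, and the `j`-th one is
bounded by a multiple of `‖x‖ ^ (b - j)`. -/
def IsSymbol (v : E) : ℕ → ℝ → (E → ℂ) → Prop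
  | 0, b, F => ∃ C : ℝ, ∀ x, x ≠ 0 → ‖F x‖ ≤ C * ‖x‖ ^ b
  | k + 1, b, F => (∃ C : ℝ, ∀ x, x ≠ 0 → ‖F x‖ ≤ C * ‖x‖ ^ b) ∧
      ∃ F' : E → ℂ, (∀ x, x ≠ 0 → HasLineDerivAt ℝ F (F' x) x v) ∧ IsSymbol v k (b - 1) F'

namespace IsSymbol

variable {v : E} {k : ℕ} {b b' : ℝ} {F G : E → ℂ}

lemma bound (h : IsSymbol v k b F) : ∃ C : ℝ, 0 ≤ C ∧ ∀ x, x ≠ 0 → ‖F x‖ ≤ C * ‖x‖ ^ b := by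
  obtain ⟨C, hC⟩ : ∃ C : ℝ, ∀ x, x ≠ 0 → ‖F x‖ ≤ C * ‖x‖ ^ b := by
    cases k with
    | zero => exact h
    | succ k => exact h.1
  refine ⟨|C|, abs_nonneg C, fun x hx => (hC x hx).trans ?_⟩
  gcongr
  exact le_abs_self C

lemma of_succ (h : IsSymbol v (k + 1) b F) : IsSymbol v k b F := by
  induction k generalizing b F with
  | zero => exact h.1
  | succ k ih =>
    obtain ⟨h1, F', h2, h3⟩ := h
    exact ⟨h1, F', h2, ih h3⟩

lemma add (hF : IsSymbol v k b F) (hG : IsSymbol v k b G) :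
    IsSymbol v k b (fun x => F x + G x) := by
  have key : ∃ C : ℝ, ∀ x, x ≠ 0 → ‖F x + G x‖ ≤ C * ‖x‖ ^ b := by
    obtain ⟨C, -, hC⟩ := hF.bound
    obtain ⟨C', -, hC'⟩ := hG.bound
    refine ⟨C + C', fun x hx => (norm_add_le _ _).trans ?_⟩
    have := hC x hx
    have := hC' x hx
    linarith
  induction k generalizing b F G with
  | zero => exact key
  | succ k ih =>
    obtain ⟨-, F', h2, h3⟩ := hF
    obtain ⟨-, G', h2', h3'⟩ := hG
    refine ⟨key, _, fun x hx => (h2 x hx).add (h2' x hx), ih h3 h3' ?_⟩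
    obtain ⟨C, -, hC⟩ := h3.bound
    obtain ⟨C', -, hC'⟩ := h3'.bound
    refine ⟨C + C', fun x hx => (norm_add_le _ _).trans ?_⟩
    have := hC x hx
    have := hC' x hx
    linarith

lemma mul_bound (hF : IsSymbol v k b F) (hG : IsSymbol v k b' G) :
    ∃ C : ℝ, ∀ x, x ≠ 0 → ‖F x * G x‖ ≤ C * ‖x‖ ^ (b + b') := by
  obtain ⟨C, hC0, hC⟩ := hF.bound
  obtain ⟨C', hC0', hC'⟩ := hG.bound
  refine ⟨C * C', fun x hx => ?_⟩
  rw [norm_mul, Real.rpow_add (norm_pos_iff.2 hx), mul_mul_mul_comm]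
  exact mul_le_mul (hC x hx) (hC' x hx) (norm_nonneg _) (by positivity)

lemma mul (hF : IsSymbol v k b F) (hG : IsSymbol v k b' G) :
    IsSymbol v k (b + b') (fun x => F x * G x) := by
  induction k generalizing b b' F G with
  | zero => exact hF.mul_bound hG
  | succ k ih =>
    refine ⟨hF.mul_bound hG, ?_⟩
    have hF0 := hF.of_succ
    have hG0 := hG.of_succ
    obtain ⟨-, F', h2, h3⟩ := hF
    obtain ⟨-, G', h2', h3'⟩ := hG
    refine ⟨fun x => F' x * G x + F x * G' x, fun x hx => ?_, ?_⟩
    · have h4 : HasDerivAt (fun t : ℝ => F (x + t • v)) (F' x) 0 := h2 x hx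
      have h5 : HasDerivAt (fun t : ℝ => G (x + t • v)) (G' x) 0 := h2' x hx
      have h6 := h4.mul h5
      simp only [zero_smul, add_zero] at h6
      exact h6
    · have h4 := ih h3 hG0
      have h5 := ih hF0 h3'
      rw [show b - 1 + b' = b + b' - 1 by ring] at h4
      rw [show b + (b' - 1) = b + b' - 1 by ring] at h5
      exact h4.add h5

lemma zero (v : E) (k : ℕ) (b : ℝ) : IsSymbol v k b (fun _ => 0) := by
  induction k generalizing b with
  | zero => exact ⟨0, by simp⟩
  | succ k ih => exact ⟨⟨0, by simp⟩, fun _ => 0, fun x _ => hasDerivAt_const _ _, ih _⟩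

lemma const (v : E) (k : ℕ) (c : ℂ) : IsSymbol v k 0 (fun _ => c) := by
  cases k with
  | zero => exact ⟨‖c‖, by simp⟩
  | succ k => exact ⟨⟨‖c‖, by simp⟩, fun _ => 0, fun x _ => hasDerivAt_const _ _, zero _ _ _⟩

lemma inner {E : Type*} [NormedAddCommGroup E] [InnerProductSpace ℝ E] (v : E) (k : ℕ) :
    IsSymbol v k 1 (fun x => ((Inner.inner ℝ x v : ℝ) : ℂ)) := by
  have key : ∃ C : ℝ, ∀ x : E, x ≠ 0 → ‖((Inner.inner ℝ x v : ℝ) : ℂ)‖ ≤ C * ‖x‖ ^ (1 : ℝ) := by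
    refine ⟨‖v‖, fun x _ => ?_⟩
    rw [Complex.norm_real, Real.rpow_one, mul_comm]
    exact norm_inner_le_norm x v
  cases k with
  | zero => exact key
  | succ k =>
    refine ⟨key, fun _ => ((Inner.inner ℝ v v : ℝ) : ℂ), fun x _ => ?_, ?_⟩
    · have h1 : HasDerivAt (fun t : ℝ => Inner.inner ℝ (x + t • v) v) (Inner.inner ℝ v v) 0 := by
        simp only [inner_add_left, inner_smul_left]
        simpa using ((hasDerivAt_id (0 : ℝ)).mul_const (Inner.inner ℝ v v)).const_add
          (Inner.inner ℝ x v)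
      exact h1.ofReal_comp
    · rw [sub_self]
      exact const _ _ _

/-- The derivative along `v` is `c ‖x‖^{c-2} ⟨x, v⟩`, a product of symbols of total order `Re c -
1`, so induction on `k` closes. -/
lemma norm_cpow {E : Type*} [NormedAddCommGroup E] [InnerProductSpace ℝ E] (v : E) (k : ℕ)
    (c : ℂ) : IsSymbol v k c.re (fun x => (‖x‖ : ℂ) ^ c) := by
  have key : ∀ c : ℂ, ∃ C : ℝ, ∀ x : E, x ≠ 0 → ‖(‖x‖ : ℂ) ^ c‖ ≤ C * ‖x‖ ^ c.re := by
    refine fun c => ⟨1, fun x hx => ?_⟩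
    rw [Complex.norm_cpow_eq_rpow_re_of_pos (norm_pos_iff.2 hx), one_mul]
  induction k generalizing c with
  | zero => exact key c
  | succ k ih =>
    refine ⟨key c, fun x => c * ((‖x‖ : ℂ) ^ (c - 2) * ((Inner.inner ℝ x v : ℝ) : ℂ)),
      fun x hx => ?_, ?_⟩
    · have hx0 := norm_pos_iff.2 hx
      have hxc : (‖x‖ : ℂ) ≠ 0 := by exact_mod_cast hx0.ne'
      have h1 : HasDerivAt (fun t : ℝ => x + t • v) v 0 := by
        simpa using ((hasDerivAt_id (0 : ℝ)).smul_const v).const_add x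
      have h2 := h1.norm_sq.sqrt (by simpa using hx0.ne')
      simp only [zero_smul, add_zero, Real.sqrt_sq (norm_nonneg _)] at h2
      have h3 : HasDerivAt (fun z : ℂ => z ^ c) (c * (‖x‖ : ℂ) ^ (c - 1)) (‖x‖ : ℂ) := by
        simpa using (hasDerivAt_id (‖x‖ : ℂ)).cpow_const (c := c) (Or.inl (by simpa using hx0))
      have h4 := h3.comp_ofReal
      have h5 := h4.scomp_of_eq (0 : ℝ) h2 (by simp)
      have e : ((2 * Inner.inner ℝ x v / (2 * ‖x‖) : ℝ)) • (c * (‖x‖ : ℂ) ^ (c - 1)) =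
          c * ((‖x‖ : ℂ) ^ (c - 2) * ((Inner.inner ℝ x v : ℝ) : ℂ)) := by
        rw [show c - 1 = (c - 2) + 1 by ring, Complex.cpow_add _ _ hxc, Complex.cpow_one,
          Complex.real_smul]
        push_cast
        field_simp
      rw [e] at h5
      exact h5
    · have h6 := (const v k c).mul ((ih (c - 2)).mul (inner v k))
      have e : 0 + ((c - 2).re + 1) = c.re - 1 := by
        simp; ring
      rwa [e] at h6

open LineDeriv in
-- Only the order `0` is used in the end. Arbitrary `n` is kept because each derivative must gain a
-- power of `‖x‖`, which the induction takes from the rapid decay.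
lemma schwartz (v : E) (k n : ℕ) (f : 𝓢(E, ℂ)) : IsSymbol v k (-(n : ℝ)) f := by
  have key : ∀ (n : ℕ) (f : 𝓢(E, ℂ)), ∃ C : ℝ, ∀ x : E, x ≠ 0 → ‖f x‖ ≤ C * ‖x‖ ^ (-(n : ℝ)) := by
    intro n f
    obtain ⟨C, hC⟩ := f.decay n 0
    refine ⟨C, fun x hx => ?_⟩
    have := hC.2 x
    rw [norm_iteratedFDeriv_zero] at this
    rw [Real.rpow_neg (norm_nonneg _), Real.rpow_natCast, ← div_eq_mul_inv,
      le_div_iff₀ (pow_pos (norm_pos_iff.2 hx) n), mul_comm]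
    exact this
  induction k generalizing n f with
  | zero => exact key n f
  | succ k ih =>
    refine ⟨key n f, fun x => (∂_{v} f : 𝓢(E, ℂ)) x, fun x _ => ?_, ?_⟩
    · simp only [SchwartzMap.lineDerivOp_apply]
      exact f.differentiableAt.lineDifferentiableAt.hasLineDerivAt
    · have := ih (n + 1) (∂_{v} f)
      rwa [show (-((n + 1 : ℕ) : ℝ)) = -(n : ℝ) - 1 by push_cast; ring] at this

end IsSymbol

end symbol


/-! ### Iterated differences of such functions -/

section difference

variable {E : Type*} [NormedAddCommGroup E] [NormedSpace ℝ E] {v : E} {k : ℕ} {b : ℝ} {F : E → ℂ}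

lemma hasLineDerivAt_fwdDiff_iter {F' : E → ℂ} (hF : ∀ x, x ≠ 0 → HasLineDerivAt ℝ F (F' x) x v)
    (a : E) (k : ℕ) (z : E) (hz : ∀ j : ℕ, j ≤ k → z + j • a ≠ 0) :
    HasLineDerivAt ℝ ((fwdDiff a)^[k] F) ((fwdDiff a)^[k] F' z) z v := by
  induction k generalizing z with
  | zero => exact hF z (by simpa using hz 0 le_rfl)
  | succ k ih =>
    rw [Function.iterate_succ_apply', Function.iterate_succ_apply']
    have h1 := ih z fun j hj => hz j (by omega)
    have h2 := ih (z + a) fun j hj => by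
      have := hz (j + 1) (by omega)
      rwa [add_smul, one_smul, add_comm (j • a), ← add_assoc] at this
    have h3 : HasDerivAt (fun t : ℝ => (fwdDiff a)^[k] F (z + t • v + a))
        ((fwdDiff a)^[k] F' (z + a)) 0 := by
      refine HasDerivAt.congr_deriv (HasDerivAt.congr_of_eventuallyEq h2 ?_) rfl
      exact Eventually.of_forall fun t => by simp only [add_right_comm]
    exact h3.sub h1

lemma HasLineDerivAt.hasDerivAt_add_smul {G : E → ℂ} {d : ℂ} {x : E} {t : ℝ}
    (h : HasLineDerivAt ℝ G d (x + t • v) v) : HasDerivAt (fun s : ℝ => G (x + s • v)) d t := by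
  have h1 : HasDerivAt (fun s : ℝ => G (x + t • v + s • v)) d (t - t) := by
    rw [sub_self]; exact h
  refine (h1.comp_sub_const t t).congr_of_eventuallyEq (Eventually.of_forall fun s => ?_)
  simp only [add_assoc, ← add_smul, add_sub_cancel]

lemma rpow_le_two_rpow_mul {r s p : ℝ} (hr : 0 < r) (h1 : r / 2 ≤ s) (h2 : s ≤ 2 * r) :
    s ^ p ≤ 2 ^ |p| * r ^ p := by
  have hs : 0 < s := by linarith
  rcases le_total 0 p with hp | hp
  · rw [abs_of_nonneg hp, ← Real.mul_rpow (by norm_num) hr.le]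
    exact Real.rpow_le_rpow hs.le h2 hp
  · rw [abs_of_nonpos hp, Real.rpow_neg (by norm_num), ← Real.inv_rpow (by norm_num),
      ← Real.mul_rpow (by norm_num) hr.le]
    exact Real.rpow_le_rpow_of_nonpos (by positivity) (by linarith) hp

/-- The mean value inequality turns one difference into one derivative and a factor `|τ|`. The
condition on `x` keeps all points involved at distance at least `‖x‖/2` from the singularity, so the
powers of their norms are comparable with those of `‖x‖`. -/
lemma IsSymbol.norm_fwdDiff_iter_le (h : IsSymbol v k b F) : ∃ C : ℝ, 0 ≤ C ∧ ∀ (τ : ℝ) (x : E),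
    x ≠ 0 → 2 * k * ‖τ • v‖ ≤ ‖x‖ →
      ‖(fwdDiff (τ • v))^[k] F x‖ ≤ C * |τ| ^ k * ‖x‖ ^ (b - k) := by
  induction k generalizing b F with
  | zero =>
    obtain ⟨C, hC0, hC⟩ := h.bound
    exact ⟨C, hC0, fun τ x hx _ => by simpa using hC x hx⟩
  | succ k ih =>
    obtain ⟨-, F', h2, h3⟩ := h
    obtain ⟨C, hC0, hC⟩ := ih h3
    refine ⟨C * 2 ^ |b - 1 - k|, by positivity, fun τ x hx hτ => ?_⟩
    have hx0 := norm_pos_iff.2 hx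
    push_cast at hτ
    have hk0 : (0 : ℝ) ≤ k := Nat.cast_nonneg k
    have ha0 := norm_nonneg (τ • v)
    set a := τ • v with ha
    have hka : 0 ≤ (k : ℝ) * ‖a‖ := by positivity
    have hseg : ∀ t ∈ Set.uIcc 0 τ, ‖t • v‖ ≤ ‖a‖ := by
      intro t ht
      rw [ha, norm_smul, norm_smul]
      refine mul_le_mul_of_nonneg_right ?_ (norm_nonneg v)
      have := Set.abs_sub_left_of_mem_uIcc ht
      simpa using this
    have hlow : ∀ t ∈ Set.uIcc 0 τ, ‖x‖ - ‖a‖ ≤ ‖x + t • v‖ := by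
      intro t ht
      have h4 := norm_sub_le (x + t • v) (t • v)
      rw [add_sub_cancel_right] at h4
      have := hseg t ht
      linarith
    have hder : ∀ t ∈ Set.uIcc 0 τ, HasDerivWithinAt (fun s : ℝ => (fwdDiff a)^[k] F (x + s • v))
        ((fwdDiff a)^[k] F' (x + t • v)) (Set.uIcc 0 τ) t := by
      intro t ht
      refine (HasLineDerivAt.hasDerivAt_add_smul (hasLineDerivAt_fwdDiff_iter h2 a k _
        fun j hj => ?_)).hasDerivWithinAt
      rw [← norm_pos_iff]
      have h5 := norm_sub_le (x + t • v + j • a) (j • a)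
      rw [add_sub_cancel_right] at h5
      have h6 : ‖j • a‖ ≤ k * ‖a‖ := by
        refine (norm_nsmul_le (n := j) (a := a)).trans ?_
        gcongr
      have h7 := hlow t ht
      by_contra! h8
      nlinarith
    have hbd : ∀ t ∈ Set.uIcc 0 τ, ‖(fwdDiff a)^[k] F' (x + t • v)‖ ≤
        C * |τ| ^ k * (2 ^ |b - 1 - k| * ‖x‖ ^ (b - 1 - k)) := by
      intro t ht
      have h7 := hlow t ht
      have h8 : ‖x + t • v‖ ≤ ‖x‖ + ‖a‖ := (norm_add_le _ _).trans (by linarith [hseg t ht])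
      have h9 : ‖a‖ ≤ ‖x‖ / 2 := by nlinarith
      refine (hC τ (x + t • v) ?_ (by rw [← ha]; nlinarith)).trans ?_
      · rw [← norm_pos_iff]; linarith
      · gcongr
        exact rpow_le_two_rpow_mul hx0 (by linarith) (by linarith)
    have hmv := (convex_uIcc (0 : ℝ) τ).norm_image_sub_le_of_norm_hasDerivWithin_le hder hbd
      Set.left_mem_uIcc Set.right_mem_uIcc
    simp only [zero_smul, add_zero, sub_zero, ← ha] at hmv
    rw [Function.iterate_succ_apply', fwdDiff]
    refine hmv.trans (le_of_eq ?_)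
    rw [Real.norm_eq_abs, pow_succ, show b - ((k + 1 : ℕ) : ℝ) = b - 1 - k by push_cast; ring]
    ring

/-- Near the singularity no cancellation is available, but each difference at most doubles the
supremum over the points involved. -/
lemma norm_fwdDiff_iter_le_of_bound {C : ℝ} (hb : 0 ≤ b) (hF : ∀ x, x ≠ 0 → ‖F x‖ ≤ C * ‖x‖ ^ b)
    (hC : 0 ≤ C) {R : ℝ} (a : E) (k : ℕ) (x : E) (hx : ∀ j : ℕ, x + j • a ≠ 0)
    (hxR : ‖x‖ + k * ‖a‖ ≤ R) : ‖(fwdDiff a)^[k] F x‖ ≤ 2 ^ k * (C * R ^ b) := by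
  induction k generalizing x with
  | zero =>
    have h0 : x ≠ 0 := by simpa using hx 0
    simp only [Nat.cast_zero, zero_mul, add_zero] at hxR
    simp only [Function.iterate_zero, id_eq, pow_zero, one_mul]
    exact (hF x h0).trans (by gcongr)
  | succ k ih =>
    push_cast at hxR
    have ha := norm_nonneg a
    rw [Function.iterate_succ_apply', fwdDiff]
    have h1 := ih x hx (by nlinarith)
    have h2 := ih (x + a) (fun j => by
      have := hx (j + 1)
      rwa [add_smul, one_smul, add_comm (j • a), ← add_assoc] at this)
      (by linarith [norm_add_le x a])
    refine (norm_sub_le _ _).trans ?_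
    rw [pow_succ]
    linarith

end difference

/-! ### Archimedean decay of Fourier transforms -/

section decay

variable {K : Type*} [NontriviallyNormedField K] [MeasurableSpace K]
  {D : LocalFieldData K} {d : ℕ} [BorelSpace K] [ProperSpace K] [NormedAlgebra ℝ K]
  [FiniteDimensional ℝ K] (hD : D.IsLocal d) (hd : Module.finrank ℝ K = d)
include hD

lemma LocalFieldData.IsLocal.fourier_fwdDiff {F : K → ℂ} (hF : Integrable F D.vol) (a y : K) :
    Integrable (fwdDiff a F) D.vol ∧
      D.fourier (fwdDiff a F) y = (D.psi (-(a * y)) - 1) * D.fourier F y := by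
  have := hD.haar
  have hi : ∀ {G : K → ℂ}, Integrable G D.vol → Integrable (fun x => G x * D.psi (x * y)) D.vol := by
    intro G hG
    refine hG.norm.mono' (hG.1.mul ?_) (ae_of_all _ fun x => ?_)
    · exact (hD.psi_continuous.comp (continuous_id.mul continuous_const)).aestronglyMeasurable
    · rw [norm_mul, hD.psi_norm, mul_one]
  have h1 := hF.comp_add_right a
  refine ⟨h1.sub hF, ?_⟩
  have h2 : D.fourier (fun x => F (x + a)) y = D.psi (-(a * y)) * D.fourier F y := by
    simp only [LocalFieldData.fourier]
    rw [← integral_const_mul, ← integral_add_right_eq_self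
      (fun x => D.psi (-(a * y)) * (F x * D.psi (x * y))) a]
    refine integral_congr_ae (ae_of_all _ fun x => ?_)
    have h3 : D.psi (x * y) = D.psi (-(a * y)) * D.psi ((x + a) * y) := by
      rw [← hD.psi_add]; ring_nf
    simp only [h3]
    ring
  rw [sub_mul, one_mul, ← h2]
  simp only [LocalFieldData.fourier, fwdDiff, sub_mul]
  exact integral_sub (hi h1) (hi hF)

lemma LocalFieldData.IsLocal.fourier_fwdDiff_iter {F : K → ℂ} (hF : Integrable F D.vol) (a y : K)
    (k : ℕ) : Integrable ((fwdDiff a)^[k] F) D.vol ∧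
      D.fourier ((fwdDiff a)^[k] F) y = (D.psi (-(a * y)) - 1) ^ k * D.fourier F y := by
  induction k with
  | zero => simpa using hF
  | succ k ih =>
    obtain ⟨h1, h2⟩ := hD.fourier_fwdDiff ih.1 a y
    rw [Function.iterate_succ_apply']
    refine ⟨h1, ?_⟩
    rw [h2, ih.2, pow_succ]
    ring

include hd

/-- The Fourier transform of a function with symbol-type singularity of order `b` at `0` is
`O(‖y‖ ^ (-d - b))` in directions along which the character oscillates. -/
lemma LocalFieldData.IsLocal.fourier_symbol_le {v : K} (hv : ‖v‖ = 1) {k : ℕ} {b : ℝ} (hb : 0 ≤ b)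
    (hk : b + d < k) {F : K → ℂ} (hF : Integrable F D.vol) (hs : IsSymbol v k b F) :
    ∃ C : ℝ, 0 ≤ C ∧ ∀ (τ : ℝ) (y : K), τ ≠ 0 → D.psi (-(τ • v * y)) = -1 →
      ‖D.fourier F y‖ ≤ C * |τ| ^ (b + d) := by
  have := hD.haar
  obtain ⟨C₀, hC₀, h0⟩ := hs.bound
  obtain ⟨C₁, hC₁, h1⟩ := hs.norm_fwdDiff_iter_le
  have hk1 : 1 ≤ k := by
    have hd0 : (0 : ℝ) ≤ d := Nat.cast_nonneg d
    have : (0 : ℝ) < k := by linarith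
    exact_mod_cast this
  have hk1' : (1 : ℝ) ≤ k := by exact_mod_cast hk1
  set p : ℝ := k - b with hp
  have hp0 : 0 < p := by
    have hd0 : (0 : ℝ) ≤ d := Nat.cast_nonneg d
    linarith
  -- The two summands are for the regimes `‖x‖ < 2k|τ|` (trivial bound) and `‖x‖ ≥ 2k|τ|`
  -- (derivative bound).
  set A : ℝ := 2 ^ k * (C₀ * (3 * k) ^ b) * (1 + 2 * k) ^ p + C₁ * 2 ^ p with hA
  have hA0 : 0 ≤ A := by positivity
  set H : K → ℝ := fun x => A * (1 + ‖x‖) ^ (-p) with hH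
  have hHi : Integrable H D.vol :=
    (integrable_one_add_norm (by rw [hd]; linarith)).const_mul A
  -- In the variable `x/τ` the `k`-th difference has the scale-free majorant `|τ|^b H`, and `H` is
  -- integrable because `p = k - b > d`. Rescaling the integral contributes the remaining `|τ|^d`.
  have hdom : ∀ τ : ℝ, τ ≠ 0 → ∀ᵐ x ∂D.vol,
      ‖(fwdDiff (τ • v))^[k] F x‖ ≤ |τ| ^ b * H (algebraMap ℝ K τ⁻¹ * x) := by
    intro τ hτ
    have hτ0 : 0 < |τ| := _root_.abs_pos.2 hτ
    have hae : ∀ᵐ x ∂D.vol, ∀ j : ℕ, x + j • (τ • v) ≠ 0 := by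
      rw [ae_all_iff]
      intro j
      have : ∀ᵐ x ∂D.vol, x ≠ -(j • (τ • v)) := by
        have h2 := measure_preimage_add D.vol (j • (τ • v)) {0}
        rw [hD.vol_singleton] at h2
        rw [ae_iff]
        convert h2 using 2
        ext x
        simp [eq_neg_iff_add_eq_zero, add_comm]
      filter_upwards [this] with x hx h
      exact hx (eq_neg_of_add_eq_zero_left h)
    filter_upwards [hae] with x hx
    have hx0 : x ≠ 0 := by simpa using hx 0
    have hxn := norm_pos_iff.2 hx0
    have hna : ‖τ • v‖ = |τ| := by rw [norm_smul, hv, mul_one, Real.norm_eq_abs]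
    have hnx : ‖algebraMap ℝ K τ⁻¹ * x‖ = ‖x‖ / |τ| := by
      rw [norm_mul, norm_algebraMap', norm_inv, Real.norm_eq_abs, div_eq_inv_mul]
    rw [hH]
    simp only [hnx]
    set r := ‖x‖ / |τ| with hr
    have hr0 : 0 < r := by positivity
    have hxr : ‖x‖ = |τ| * r := by rw [hr]; field_simp
    rcases le_or_gt (2 * (k : ℝ)) r with hc | hc
    · have h2 := h1 τ x hx0 (by rw [hna, hxr, mul_comm |τ|]; gcongr)
      refine h2.trans ?_
      have h3 : r ^ (-p) ≤ 2 ^ p * (1 + r) ^ (-p) := by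
        have h4 : r ^ (-p) ≤ ((1 + r) / 2) ^ (-p) :=
          Real.rpow_le_rpow_of_nonpos (by positivity) (by linarith) (by linarith)
        have h6 : ((1 + r) / 2) ^ (-p) = 2 ^ p * (1 + r) ^ (-p) := by
          rw [Real.div_rpow (by positivity) (by norm_num), Real.rpow_neg (by norm_num : (0 : ℝ) ≤ 2),
            div_inv_eq_mul, mul_comm]
        rw [h6] at h4
        exact h4
      rw [hxr, show b - k = -p by rw [hp]; ring, Real.mul_rpow hτ0.le hr0.le]
      have h5 : |τ| ^ k * |τ| ^ (-p) = |τ| ^ b := by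
        rw [← Real.rpow_natCast, ← Real.rpow_add hτ0, hp]
        ring_nf
      calc C₁ * |τ| ^ k * (|τ| ^ (-p) * r ^ (-p))
          = |τ| ^ b * (C₁ * r ^ (-p)) := by rw [← h5]; ring
        _ ≤ |τ| ^ b * (C₁ * (2 ^ p * (1 + r) ^ (-p))) := by gcongr
        _ ≤ |τ| ^ b * (A * (1 + r) ^ (-p)) := by
          rw [← mul_assoc C₁]
          gcongr
          exact le_add_of_nonneg_left (by positivity)
    · have h2 := norm_fwdDiff_iter_le_of_bound hb h0 hC₀ (R := |τ| * (3 * k)) (τ • v) k x hx (by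
        rw [hna, hxr]; nlinarith)
      refine h2.trans ?_
      rw [Real.mul_rpow hτ0.le (by positivity)]
      have h3 : 1 ≤ (1 + 2 * k : ℝ) ^ p * (1 + r) ^ (-p) := by
        rw [Real.rpow_neg (by positivity), ← div_eq_mul_inv, one_le_div (by positivity)]
        exact Real.rpow_le_rpow (by positivity) (by linarith) hp0.le
      calc (2 : ℝ) ^ k * (C₀ * (|τ| ^ b * (3 * k) ^ b))
          = |τ| ^ b * (2 ^ k * (C₀ * (3 * k) ^ b)) * 1 := by ring
        _ ≤ |τ| ^ b * (2 ^ k * (C₀ * (3 * k) ^ b)) * ((1 + 2 * k : ℝ) ^ p * (1 + r) ^ (-p)) := by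
          gcongr
        _ = |τ| ^ b * ((2 ^ k * (C₀ * (3 * k) ^ b) * (1 + 2 * k) ^ p) * (1 + r) ^ (-p)) := by ring
        _ ≤ |τ| ^ b * (A * (1 + r) ^ (-p)) := by
          gcongr
          exact le_add_of_nonneg_right (by positivity)
  set M := ∫ x, H x ∂D.vol with hM
  have hM0 : 0 ≤ M := integral_nonneg fun x => by positivity
  refine ⟨M, hM0, fun τ y hτ hy => ?_⟩
  have hτ0 : 0 < |τ| := _root_.abs_pos.2 hτ
  obtain ⟨hi, he⟩ := hD.fourier_fwdDiff_iter hF (τ • v) y k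
  have hτK : algebraMap ℝ K τ⁻¹ ≠ 0 := by
    simpa using hτ
  have hHi' := hD.integrable_comp_mul hτK hHi
  have h5 : ‖D.fourier ((fwdDiff (τ • v))^[k] F) y‖ ≤ |τ| ^ b * (|τ| ^ d * M) := by
    refine (hD.norm_fourier_le _ y).trans ?_
    refine (integral_mono_ae hi.norm (hHi'.const_mul _) (hdom τ hτ)).trans (le_of_eq ?_)
    rw [integral_const_mul, hD.integral_comp_mul hτK H, hD.abs_eq, norm_algebraMap', norm_inv,
      Real.norm_eq_abs, inv_pow, inv_inv, smul_eq_mul]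
  -- Since the character is `-1` at the shift, differencing multiplies the transform by `(-2)^k`,
  -- which is bounded away from `0`.
  rw [he, hy, norm_mul, norm_pow, show ‖(-1 - 1 : ℂ)‖ = 2 by norm_num] at h5
  have h6 : ‖D.fourier F y‖ ≤ 2 ^ k * ‖D.fourier F y‖ :=
    le_mul_of_one_le_left (norm_nonneg _) (one_le_pow₀ (by norm_num))
  refine (h6.trans h5).trans (le_of_eq ?_)
  rw [Real.rpow_add hτ0, Real.rpow_natCast]
  ring

end decay


/-! ### Gaussians as Schwartz functions and their radial Mellin transform -/

section gaussian

lemma exists_one_add_pow_mul_exp_le {b : ℝ} (hb : 0 < b) (N : ℕ) :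
    ∃ B : ℝ, ∀ r : ℝ, 0 ≤ r → (1 + r) ^ N * Real.exp (-b * r ^ 2) ≤ B := by
  refine ⟨N.factorial * b⁻¹ ^ N * Real.exp (2 * b), fun r hr => ?_⟩
  have h1 := Real.pow_div_factorial_le_exp (x := b * (1 + r)) (by positivity) N
  have hN : (0 : ℝ) < N.factorial := by exact_mod_cast N.factorial_pos
  rw [div_le_iff₀ hN, mul_pow] at h1
  have h2 : (1 + r) ^ N ≤ N.factorial * b⁻¹ ^ N * Real.exp (b * (1 + r)) := by
    have h3 : (1 + r) ^ N = b⁻¹ ^ N * (b ^ N * (1 + r) ^ N) := by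
      rw [← mul_assoc, ← mul_pow, inv_mul_cancel₀ hb.ne', one_pow, one_mul]
    rw [h3]
    calc b⁻¹ ^ N * (b ^ N * (1 + r) ^ N) ≤ b⁻¹ ^ N * (Real.exp (b * (1 + r)) * N.factorial) := by
          gcongr
      _ = _ := by ring
  calc (1 + r) ^ N * Real.exp (-b * r ^ 2)
      ≤ N.factorial * b⁻¹ ^ N * Real.exp (b * (1 + r)) * Real.exp (-b * r ^ 2) := by gcongr
    _ = N.factorial * b⁻¹ ^ N * Real.exp (b * (1 + r) + -b * r ^ 2) := by
      rw [mul_assoc, ← Real.exp_add]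
    _ ≤ _ := by
      gcongr
      nlinarith [mul_nonneg hb.le (sq_nonneg (r - 1 / 2))]

variable {V : Type*} [NormedAddCommGroup V] [InnerProductSpace ℝ V]

lemma norm_iteratedFDeriv_real_exp (i : ℕ) (y : ℝ) :
    ‖iteratedFDeriv ℝ i Real.exp y‖ = Real.exp y := by
  rw [norm_iteratedFDeriv_eq_norm_iteratedDeriv, iteratedDeriv_eq_iterate, Real.iter_deriv_exp,
    Real.norm_of_nonneg (Real.exp_pos y).le]

variable (V) in
-- Compose `exp` with a quadratic of temperate growth. All derivatives of `exp` equal `exp`, so the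
-- bound for derivatives of a composition is a polynomial in `‖x‖` times the Gaussian itself.
lemma exists_schwartz_gaussian {b : ℝ} (hb : 0 < b) :
    ∃ g : 𝓢(V, ℂ), ∀ x, g x = Complex.exp (-b * ‖x‖ ^ 2) := by
  set Q : V → ℝ := fun x => -b * ‖x‖ ^ 2 with hQ
  have hQt : Q.HasTemperateGrowth :=
    (Function.HasTemperateGrowth.const (-b)).mul (Function.hasTemperateGrowth_norm_sq V)
  set f : V → ℝ := Real.exp ∘ Q with hf
  have hfs : ContDiff ℝ (⊤ : ℕ∞) f := Real.contDiff_exp.comp hQt.1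
  refine ⟨⟨Complex.ofRealLI ∘ f, Complex.ofRealCLM.contDiff.comp hfs, fun k n => ?_⟩, fun x => ?_⟩
  · obtain ⟨l, C, hC0, hC⟩ := hQt.norm_iteratedFDeriv_le_uniform n
    obtain ⟨B, hB⟩ := exists_one_add_pow_mul_exp_le hb (k + l * n)
    refine ⟨n.factorial * (C + 1) ^ n * B, fun x => ?_⟩
    rw [Complex.ofRealLI.norm_iteratedFDeriv_comp_left (n := (⊤ : ℕ∞)) hfs.contDiffAt
      (by exact_mod_cast le_top)]
    have h1 : ‖iteratedFDeriv ℝ n f x‖ ≤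
        n.factorial * Real.exp (Q x) * ((C + 1) * (1 + ‖x‖) ^ l) ^ n := by
      refine norm_iteratedFDeriv_comp_le (N := (⊤ : ℕ∞)) Real.contDiff_exp hQt.1
        (by exact_mod_cast le_top) x (fun i _ => (norm_iteratedFDeriv_real_exp i _).le)
        fun i hi hin => ?_
      refine (hC i hin x).trans ?_
      have h2 : 1 ≤ (C + 1) * (1 + ‖x‖) ^ l :=
        one_le_mul_of_one_le_of_one_le (by linarith)
          (one_le_pow₀ (by linarith [norm_nonneg x]))
      refine le_trans ?_ (le_self_pow₀ h2 (by omega))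
      gcongr
      linarith
    have hx : ‖x‖ ^ k ≤ (1 + ‖x‖) ^ k := by gcongr; linarith [norm_nonneg x]
    calc ‖x‖ ^ k * ‖iteratedFDeriv ℝ n f x‖
        ≤ (1 + ‖x‖) ^ k * (n.factorial * Real.exp (Q x) * ((C + 1) * (1 + ‖x‖) ^ l) ^ n) := by
          gcongr
      _ = n.factorial * (C + 1) ^ n * ((1 + ‖x‖) ^ (k + l * n) * Real.exp (-b * ‖x‖ ^ 2)) := by
          rw [mul_pow, pow_add, pow_mul]
          ring
      _ ≤ n.factorial * (C + 1) ^ n * B := by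
          gcongr
          exact hB _ (norm_nonneg x)
  · change ((Real.exp (-b * ‖x‖ ^ 2) : ℝ) : ℂ) = _
    push_cast
    rfl

lemma integral_rpow_mul_gaussian {b : ℝ} (hb : 0 < b) {s : ℂ} (hs : 0 < s.re) :
    ∫ r in Set.Ioi (0 : ℝ), (r : ℂ) ^ (s - 1) * Complex.exp (-b * (r : ℂ) ^ 2) =
      1 / 2 * ((1 / b : ℂ) ^ (s / 2) * Complex.Gamma (s / 2)) := by
  have h1 := mellin_comp_rpow (fun t : ℝ => Complex.exp (-(b * t))) s 2
  have h2 := Complex.integral_cpow_mul_exp_neg_mul_Ioi (a := s / 2) (r := b)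
    (by simpa using hs) hb
  simp only [mellin, smul_eq_mul] at h1
  have e : ∀ r : ℝ, (r : ℂ) ^ (s - 1) * Complex.exp (-b * (r : ℂ) ^ 2) =
      (r : ℂ) ^ (s - 1) * Complex.exp (-(b * ((r ^ (2 : ℝ) : ℝ) : ℂ))) := by
    intro r
    rw [Real.rpow_two]
    push_cast
    ring_nf
  simp only [e]
  rw [h1, Complex.real_smul]
  rw [show s / ((2 : ℝ) : ℂ) = s / 2 by push_cast; rfl, h2]
  rw [abs_of_pos (by norm_num : (0 : ℝ) < 2)]
  push_cast
  ring

end gaussian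

/-! ### Continuous unitary characters of the real line -/

section oneParameter

/-- A continuous unitary character of `ℝ` is of the form `u ↦ e ^ {itu}`. -/
lemma exists_eq_exp_of_continuous {φ : ℝ → ℂ} (hc : Continuous φ)
    (hadd : ∀ u v, φ (u + v) = φ u * φ v) (hn : ∀ u, ‖φ u‖ = 1) :
    ∃ t : ℝ, ∀ u : ℝ, φ u = Complex.exp (t * u * Complex.I) := by
  have hne : ∀ u, φ u ≠ 0 := fun u => norm_pos_iff.1 (by rw [hn]; exact one_pos)
  have h0 : φ 0 = 1 := by
    have := hadd 0 0
    rw [add_zero] at this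
    exact mul_left_cancel₀ (hne 0) (by rw [← this, mul_one])
  set Φ : ℝ → ℂ := fun x => ∫ y in (0 : ℝ)..x, φ y with hΦ
  have hΦd : ∀ x, HasDerivAt Φ (φ x) x := fun x => hc.integral_hasStrictDerivAt 0 x |>.hasDerivAt
  have hΦ0 : Φ 0 = 0 := intervalIntegral.integral_same
  -- Averaging over an interval with nonzero mean exhibits the merely continuous `φ` as a difference
  -- of primitives, hence differentiable; it then solves `φ' = α φ`, and `|φ| = 1` makes `α`
  -- imaginary.
  obtain ⟨δ, hδ⟩ : ∃ δ, Φ δ ≠ 0 := by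
    have h1 := (hΦd 0).eventually_ne (c := 0) (hne 0)
    exact h1.exists
  have h1 : ∀ u, φ u * Φ δ = Φ (u + δ) - Φ u := by
    intro u
    have h2 : Φ (u + δ) - Φ u = ∫ y in u..(u + δ), φ y :=
      intervalIntegral.integral_interval_sub_left (hc.intervalIntegrable _ _)
        (hc.intervalIntegrable _ _)
    have h3 : ∫ y in u..(u + δ), φ y = ∫ y in (0 : ℝ)..δ, φ (y + u) := by
      rw [intervalIntegral.integral_comp_add_right, zero_add, add_comm δ]
    rw [h2, h3, hΦ, ← intervalIntegral.integral_const_mul]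
    congr 1
    ext y
    rw [hadd, mul_comm]
  set α : ℂ := (φ δ - 1) / Φ δ with hα
  have h2 : ∀ u, HasDerivAt φ (α * φ u) u := by
    intro u
    have h3 : φ = fun u => (Φ (u + δ) - Φ u) / Φ δ := by
      ext u
      rw [← h1, mul_div_cancel_right₀ _ hδ]
    have h4 : HasDerivAt (fun u => (Φ (u + δ) - Φ u) / Φ δ) ((φ (u + δ) - φ u) / Φ δ) u :=
      ((HasDerivAt.comp_add_const u δ (hΦd (u + δ))).sub (hΦd u)).div_const _
    rw [← h3] at h4
    convert! h4 using 1
    rw [hadd, hα]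
    ring
  have h3 : ∀ u : ℝ, HasDerivAt (fun u : ℝ => φ u * Complex.exp (-α * u)) 0 u := by
    intro u
    have h4 : HasDerivAt (fun u : ℝ => Complex.exp (-α * u)) (Complex.exp (-α * u) * (-α * 1)) u :=
      (HasDerivAt.const_mul (-α) (Complex.ofRealCLM.hasDerivAt (x := u))).cexp
    have h5 := (h2 u).mul h4
    convert! h5 using 1
    ring
  have h4 : ∀ u : ℝ, φ u * Complex.exp (-α * u) = 1 := by
    intro u
    have h5 := is_const_of_deriv_eq_zero (f := fun u : ℝ => φ u * Complex.exp (-α * u))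
      (fun u => (h3 u).differentiableAt) (fun u => (h3 u).deriv) u 0
    simpa [h0] using h5
  have h5 : ∀ u : ℝ, φ u = Complex.exp (α * u) := by
    intro u
    have h6 := h4 u
    rw [neg_mul, Complex.exp_neg] at h6
    exact (mul_inv_eq_one₀ (Complex.exp_ne_zero _)).1 h6
  have hre : α.re = 0 := by
    have h6 := hn 1
    rw [h5, Complex.norm_exp] at h6
    simpa using h6
  refine ⟨α.im, fun u => ?_⟩
  rw [h5]
  congr 1
  apply Complex.ext <;> simp [hre]

end oneParameter

/-! ### Archimedean Schwartz spaces -/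

section schwartzSpace

variable {K : Type*} [NontriviallyNormedField K] [NormedAlgebra ℝ K]

lemma rapidDecay_schwartz (f : 𝓢(K, ℂ)) : RapidDecay f := by
  intro N
  have h1 := SchwartzMap.one_add_le_sup_seminorm_apply (𝕜 := ℝ) (m := (N, 0)) (k := N) (n := 0)
    le_rfl le_rfl f
  exact ⟨_, fun x _ => by simpa using h1 x⟩

lemma schwartz_comp_mul {a : K} (ha : a ≠ 0) (f : 𝓢(K, ℂ)) :
    ∃ g : 𝓢(K, ℂ), (fun x => f (a * x)) = g := by
  let e : K ≃L[ℝ] K := ContinuousLinearEquiv.equivOfInverse (ContinuousLinearMap.mul ℝ K a)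
    (ContinuousLinearMap.mul ℝ K a⁻¹) (fun x => by simp [ha]) (fun x => by simp [ha])
  exact ⟨SchwartzMap.compCLMOfContinuousLinearEquiv ℝ e f, rfl⟩

lemma ae_eq_zero_of_integral_schwartz [MeasurableSpace K] [BorelSpace K] [FiniteDimensional ℝ K]
    {μ : Measure K} {u : K → ℂ} (hu : LocallyIntegrable u μ)
    (h : ∀ f : 𝓢(K, ℂ), HasCompactSupport f → ∫ x, u x * f x ∂μ = 0) : u =ᵐ[μ] 0 := by
  refine ae_eq_zero_of_integral_contDiff_smul_eq_zero hu fun g hg hgc => ?_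
  have h1 : HasCompactSupport (Complex.ofRealCLM ∘ g) := hgc.comp_left (map_zero _)
  rw [← h (h1.toSchwartzMap (Complex.ofRealCLM.contDiff.comp hg)) h1]
  refine integral_congr_ae (ae_of_all _ fun x => ?_)
  change g x • u x = u x * ((g x : ℝ) : ℂ)
  rw [Complex.real_smul, mul_comm]

end schwartzSpace


/-! ### Integrability of `|x|^β f` and analyticity of gamma quotients -/

section general

variable {K : Type*} [NontriviallyNormedField K] [MeasurableSpace K]
  {D : LocalFieldData K} {d : ℕ} [BorelSpace K] [ProperSpace K]

lemma LocalFieldData.IsLocal.integrable_abs_cpow_mul (hD : D.IsLocal d) {f : K → ℂ}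
    (hf : RapidDecay f) (hm : AEStronglyMeasurable f D.vol) {β : ℂ} (hβ : 0 ≤ β.re) :
    Integrable (fun x => (D.abs x : ℂ) ^ β * f x) D.vol := by
  have hma := hD.measurable_abs
  have hmF : AEStronglyMeasurable (fun x => (D.abs x : ℂ) ^ β * f x) D.vol :=
    (Measurable.aestronglyMeasurable (by fun_prop)).mul hm
  rw [← hD.integrable_norm_mul_abs_rpow_one hmF]
  refine (hD.integrable_rapidDecay hf hm (σ := β.re + 1) (by linarith)).congr ?_
  filter_upwards [hD.ae_mulHaar_ne_zero] with x hx
  have hx0 := hD.abs_pos hx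
  rw [norm_mul, Complex.norm_cpow_eq_rpow_re_of_pos hx0, Real.rpow_add hx0]
  ring

/-- As `1/Λ` is entire, poles can only come from the numerator, and for `Re w < 1` its argument has
positive real part, where `1/Λ` does not vanish. -/
lemma meromorphicAt_gamma_ratio {Λ : ℂ → ℂ} (hΛ : Differentiable ℂ fun s => (Λ s)⁻¹)
    (hne : ∀ s : ℂ, 0 < s.re → Λ s ≠ 0) (ε c c' z : ℂ) (hc' : 0 ≤ c'.re) :
    MeromorphicAt (fun w => ε * Λ (1 - w + c') / Λ (w + c)) z ∧
      (z.re < 1 → AnalyticAt ℂ (fun w => ε * Λ (1 - w + c') / Λ (w + c)) z) := by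
  have e : (fun w => ε * Λ (1 - w + c') / Λ (w + c)) =
      fun w => ε * ((Λ (1 - w + c'))⁻¹)⁻¹ * (Λ (w + c))⁻¹ := by
    ext w
    rw [inv_inv, div_eq_mul_inv]
  have h1 : AnalyticAt ℂ (fun w => (Λ (1 - w + c'))⁻¹) z :=
    (hΛ.comp (by fun_prop : Differentiable ℂ fun w : ℂ => 1 - w + c')).analyticAt z
  have h2 : AnalyticAt ℂ (fun w => (Λ (w + c))⁻¹) z :=
    (hΛ.comp (by fun_prop : Differentiable ℂ fun w : ℂ => w + c)).analyticAt z
  rw [e]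
  refine ⟨((MeromorphicAt.const ε z).mul h1.meromorphicAt.inv).mul h2.meromorphicAt, fun hz => ?_⟩
  refine (analyticAt_const.mul (h1.inv (inv_ne_zero (hne _ ?_)))).mul h2
  simp only [Complex.add_re, Complex.sub_re, Complex.one_re]
  linarith

end general

/-! ### The real place -/

section realPlace

open FourierTransform

lemma realData_isLocal : realData.IsLocal 1 where
  pos := one_pos
  abs_eq x := (pow_one _).symm
  haar := inferInstanceAs (volume : Measure ℝ).IsAddHaarMeasure
  map_mul a ha := Real.smul_map_volume_mul_left ha
  psi_continuous := by
    change Continuous fun x : ℝ => Complex.exp (2 * Real.pi * Complex.I * x)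
    fun_prop
  psi_add x y := by
    change Complex.exp _ = Complex.exp _ * Complex.exp _
    rw [← Complex.exp_add]
    push_cast
    ring_nf
  psi_norm x := by
    change ‖Complex.exp _‖ = 1
    rw [show 2 * (Real.pi : ℂ) * Complex.I * (x : ℂ) = ((2 * Real.pi * x : ℝ) : ℂ) * Complex.I by
      push_cast; ring, Complex.norm_exp_ofReal_mul_I]

/-- The character `e^{2πix}` has the sign of the inverse transform. -/
lemma realData_fourier (f : ℝ → ℂ) : realData.fourier f = 𝓕⁻ f := by
  ext y
  rw [Real.fourierInv_eq']
  refine integral_congr_ae (ae_of_all _ fun x => ?_)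
  have hi : inner ℝ x y = x * y := by simp [mul_comm]
  simp only [hi, realData, smul_eq_mul, mul_comm (f x)]
  congr 2
  push_cast
  ring

lemma realData_fourier_gaussian (y : ℝ) :
    realData.fourier (fun x : ℝ => Complex.exp (-Real.pi * ‖x‖ ^ 2)) y =
      Complex.exp (-Real.pi * ‖y‖ ^ 2) := by
  have hpi : (Real.pi : ℂ) ≠ 0 := by exact_mod_cast Real.pi_ne_zero
  rw [realData_fourier, Real.fourierInv_eq_fourier_neg,
    fourier_gaussian_innerProductSpace (by simpa using Real.pi_pos), div_self hpi,
    Complex.one_cpow, one_mul, norm_neg]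
  congr 1
  field_simp

open LineDeriv in
/-- The test functions `x ^ a e ^ {-πx²}`. -/
lemma exists_realTest {a : ℕ} (ha : a = 0 ∨ a = 1) : ∃ f : 𝓢(ℝ, ℂ),
    (∀ x, f x = (x : ℂ) ^ a * Complex.exp (-Real.pi * ‖x‖ ^ 2)) ∧
    ∀ y, realData.fourier f y =
      Complex.I ^ a * ((y : ℂ) ^ a * Complex.exp (-Real.pi * ‖y‖ ^ 2)) := by
  have hpi : (Real.pi : ℂ) ≠ 0 := by exact_mod_cast Real.pi_ne_zero
  obtain ⟨g, hg⟩ := exists_schwartz_gaussian ℝ Real.pi_pos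
  have hgf : (g : ℝ → ℂ) = fun x : ℝ => Complex.exp (-Real.pi * ‖x‖ ^ 2) := funext hg
  have hgF : ∀ y, realData.fourier g y = Complex.exp (-Real.pi * ‖y‖ ^ 2) := by
    intro y
    rw [hgf, realData_fourier_gaussian]
  rcases ha with rfl | rfl
  · exact ⟨g, by simpa using hg, by simpa using hgF⟩
  · have hd : ∀ x : ℝ, (∂_{(1 : ℝ)} g : 𝓢(ℝ, ℂ)) x =
        -(2 * Real.pi) * (x * Complex.exp (-Real.pi * ‖x‖ ^ 2)) := by
      intro x
      rw [SchwartzMap.lineDerivOp_apply_eq_fderiv, fderiv_apply_one_eq_deriv, hgf]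
      have e : (fun x : ℝ => Complex.exp (-Real.pi * ‖x‖ ^ 2)) =
          fun x : ℝ => Complex.exp (-Real.pi * (x : ℂ) ^ 2) := by
        ext x
        rw [← Complex.ofReal_pow, ← Complex.ofReal_pow, Real.norm_eq_abs, sq_abs]
      have e' : Complex.exp (-Real.pi * ‖x‖ ^ 2) = Complex.exp (-Real.pi * (x : ℂ) ^ 2) :=
        congrFun e x
      rw [e, e']
      have h1 : HasDerivAt (fun x : ℝ => (x : ℂ)) 1 x := Complex.ofRealCLM.hasDerivAt
      have h2 := ((h1.pow 2).const_mul (-(Real.pi : ℂ))).cexp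
      rw [HasDerivAt.deriv (f' := -(2 * Real.pi) * (x * Complex.exp (-Real.pi * (x : ℂ) ^ 2)))]
      convert! h2 using 1
      simp only [Pi.pow_apply]
      push_cast
      ring
    -- The odd test function is a multiple of the derivative of the Gaussian, so its transform
    -- follows from the rule exchanging differentiation and multiplication.
    refine ⟨(-(1 / (2 * Real.pi) : ℂ)) • (∂_{(1 : ℝ)} g), fun x => ?_, fun y => ?_⟩
    · rw [smul_apply, hd, smul_eq_mul]
      field_simp
    · have h1 : realData.fourier ((-(1 / (2 * Real.pi) : ℂ)) • (∂_{(1 : ℝ)} g) : 𝓢(ℝ, ℂ)) y =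
          (𝓕⁻ ((-(1 / (2 * Real.pi) : ℂ)) • (∂_{(1 : ℝ)} g) : 𝓢(ℝ, ℂ)) : 𝓢(ℝ, ℂ)) y := by
        rw [realData_fourier, SchwartzMap.fourierInv_coe]
      have h2 : (𝓕⁻ g : 𝓢(ℝ, ℂ)) y = Complex.exp (-Real.pi * ‖y‖ ^ 2) := by
        rw [← hgF y, realData_fourier, SchwartzMap.fourierInv_coe]
      have h3 : (inner ℝ · (1 : ℝ) : ℝ → ℝ).HasTemperateGrowth := by fun_prop
      rw [h1, FourierTransform.fourierInv_smul, SchwartzMap.fourierInv_lineDerivOp_eq,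
        smul_apply, smul_apply, SchwartzMap.smulLeftCLM_apply_apply h3, h2]
      have hi : inner ℝ y (1 : ℝ) = y := by simp
      rw [hi]
      simp only [smul_eq_mul, Complex.real_smul, pow_one]
      field_simp

lemma realExponent_spec (χ : ℝˣ →ₜ* Circle) (x : ℝˣ) (hx : 0 < (x : ℝ)) :
    ((χ x : Circle) : ℂ) = ((x : ℝ) : ℂ) ^ ((realExponent χ : ℂ) * Complex.I) := by
  refine Classical.epsilon_spec (p := fun t : ℝ =>
    ∀ x : ℝˣ, 0 < (x : ℝ) → ((χ x : Circle) : ℂ) = ((x : ℝ) : ℂ) ^ ((t : ℂ) * Complex.I)) ?_ x hx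
  obtain ⟨t, ht⟩ := exists_eq_exp_of_continuous (φ := fun u => charExt χ (Real.exp u))
    ((continuousOn_charExt χ).comp_continuous Real.continuous_exp fun u => (Real.exp_pos u).ne')
    (fun u v => by rw [Real.exp_add, charExt_mul]) (fun u => norm_charExt χ (Real.exp_pos u).ne')
  refine ⟨t, fun x hx => ?_⟩
  have h1 : charExt χ (Real.exp (Real.log x)) = _ := ht (Real.log x)
  rw [Real.exp_log hx, charExt_unit] at h1
  rw [h1, Complex.cpow_def_of_ne_zero (by exact_mod_cast hx.ne'), ← Complex.ofReal_log hx.le]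
  ring_nf

lemma realParity_inv (χ : ℝˣ →ₜ* Circle) : realParity χ⁻¹ = realParity χ := by
  have h : χ⁻¹ (-1) = 1 ↔ χ (-1) = 1 := inv_eq_one (a := χ (-1))
  by_cases hp : χ (-1) = 1
  · rw [realParity, realParity, if_pos hp, if_pos (h.2 hp)]
  · rw [realParity, realParity, if_neg hp, if_neg (mt h.1 hp)]

lemma realParity_eq (χ : ℝˣ →ₜ* Circle) : realParity χ = 0 ∨ realParity χ = 1 := by
  unfold realParity
  split_ifs <;> simp

lemma pow_mul_charExt_real (χ : ℝˣ →ₜ* Circle) {x : ℝ} (hx : x ≠ 0) :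
    (x : ℂ) ^ realParity χ * charExt χ x =
      ((|x| : ℝ) : ℂ) ^ ((realExponent χ : ℂ) * Complex.I + realParity χ) := by
  have hpos : ∀ y : ℝ, 0 < y → charExt χ y = (y : ℂ) ^ ((realExponent χ : ℂ) * Complex.I) := by
    intro y hy
    rw [charExt_of_ne χ hy.ne', realExponent_spec χ _ hy]
    rfl
  have habs : ((|x| : ℝ) : ℂ) ≠ 0 := by exact_mod_cast (abs_pos.2 hx).ne'
  rw [Complex.cpow_add _ _ habs, Complex.cpow_natCast, ← hpos _ (abs_pos.2 hx)]
  rcases lt_or_gt_of_ne hx with h | h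
  · rw [abs_of_neg h, ← neg_one_mul x, charExt_mul, Complex.ofReal_mul, mul_pow]
    have h1 : charExt χ (-1 : ℝ) = ((χ (-1) : Circle) : ℂ) := by
      have := charExt_unit χ (-1 : ℝˣ)
      simpa using this
    have h2 : ((χ (-1) : Circle) : ℂ) * ((-1 : ℝ) : ℂ) ^ realParity χ = 1 := by
      have hsq : ((χ (-1) : Circle) : ℂ) * ((χ (-1) : Circle) : ℂ) = 1 := by
        rw [← Circle.coe_mul, ← map_mul]
        simp
      unfold realParity
      split_ifs with hp
      · simp [hp]
      · have : ((χ (-1) : Circle) : ℂ) = -1 := by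
          rcases mul_self_eq_one_iff.1 hsq with h3 | h3
          · exact absurd (Circle.ext (by simpa using h3)) hp
          · exact h3
        rw [this]
        simp
    rw [h1]
    calc (x : ℂ) ^ realParity χ * charExt χ x
        = (((χ (-1) : Circle) : ℂ) * ((-1 : ℝ) : ℂ) ^ realParity χ) *
          ((x : ℂ) ^ realParity χ * charExt χ x) := by rw [h2, one_mul]
      _ = _ := by ring
  · rw [abs_of_pos h, mul_comm]

/-- The factor `x^a` cancels the sign of `χ`, so the integrand is radial and the integral is a
Gaussian Mellin transform, that is, `Γ_ℝ`. -/
lemma real_zeta (χ : ℝˣ →ₜ* Circle) {w : ℂ} (hw : 0 < w.re) (c : ℂ) :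
    ∫ x, realData.mellinIntegrand
      (fun x => c * ((x : ℂ) ^ realParity χ * Complex.exp (-Real.pi * ‖x‖ ^ 2))) χ w x
      ∂realData.vol = c * realData.LFactor w χ := by
  set s : ℂ := w + realExponent χ * Complex.I + realParity χ with hs
  have hsre : 0 < s.re := by
    rw [hs]
    simp
    positivity
  have hint := integral_fun_norm_addHaar (volume : Measure ℝ)
    (fun r : ℝ => (r : ℂ) ^ (s - 1) * Complex.exp (-Real.pi * (r : ℂ) ^ 2))
  have e : ∀ᵐ x : ℝ ∂volume, realData.mellinIntegrand
      (fun x => c * ((x : ℂ) ^ realParity χ * Complex.exp (-Real.pi * ‖x‖ ^ 2))) χ w x =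
      c * ((‖x‖ : ℂ) ^ (s - 1) * Complex.exp (-Real.pi * (‖x‖ : ℂ) ^ 2)) := by
    filter_upwards [realData_isLocal.ae_ne_zero] with x hx
    have habs : ((|x| : ℝ) : ℂ) ≠ 0 := by exact_mod_cast (abs_pos.2 hx).ne'
    have h1 := pow_mul_charExt_real χ hx
    rw [LocalFieldData.mellinIntegrand]
    change _ * _ * ((|x| : ℝ) : ℂ) ^ (w - 1) = _
    rw [Real.norm_eq_abs, show s - 1 = ((realExponent χ : ℂ) * Complex.I + realParity χ) + (w - 1) by
      rw [hs]; ring, Complex.cpow_add _ _ habs, ← h1]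
    ring
  change ∫ x, _ ∂volume = _
  rw [integral_congr_ae e, integral_const_mul, hint]
  have h2 : (volume : Measure ℝ).real (Metric.ball 0 1) = 2 := by
    simp [Measure.real, Real.volume_ball]
  rw [h2, Module.finrank_self]
  simp only [Nat.sub_self, pow_zero, one_smul]
  rw [integral_rpow_mul_gaussian Real.pi_pos hsre]
  congr 1
  change _ = Complex.Gammaℝ s
  have h3 : (1 / (Real.pi : ℂ)) ^ (s / 2) = (Real.pi : ℂ) ^ (-s / 2) := by
    rw [one_div, Complex.inv_cpow _ _ (by
      rw [Complex.arg_ofReal_of_nonneg Real.pi_pos.le]; exact Real.pi_ne_zero.symm),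
      ← Complex.cpow_neg, neg_div]
  rw [Complex.Gammaℝ_def, h3, two_smul]
  ring

lemma realData_isTate : realData.IsTate 1 where
  toIsLocal := realData_isLocal
  schwartz_continuous := by
    rintro _ ⟨g, rfl⟩
    exact g.continuous
  schwartz_decay := by
    rintro _ ⟨g, rfl⟩
    exact rapidDecay_schwartz g
  schwartz_add := by
    rintro _ ⟨g, rfl⟩ _ ⟨g', rfl⟩
    exact ⟨g + g', rfl⟩
  schwartz_smul := by
    rintro c _ ⟨g, rfl⟩
    exact ⟨c • g, rfl⟩
  schwartz_comp_mul := by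
    rintro a ha _ ⟨g, rfl⟩
    exact schwartz_comp_mul ha g
  fourier_mem := by
    rintro _ ⟨g, rfl⟩
    exact ⟨𝓕⁻ g, by rw [realData_fourier, SchwartzMap.fourierInv_coe]⟩
  fourier_fourier := by
    rintro _ ⟨g, rfl⟩ x
    rw [realData_fourier, realData_fourier, Real.fourierInv_eq_fourier_neg,
      ← SchwartzMap.fourierInv_coe, ← SchwartzMap.fourier_coe, FourierTransform.fourier_fourierInv_eq]
  ae_eq_zero u hu h := ae_eq_zero_of_integral_schwartz (μ := volume) hu
    fun f hf => h f ⟨f, rfl⟩ hf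
  exists_test χ := by
    obtain ⟨f, hf, hF⟩ := exists_realTest (realParity_eq χ)
    refine ⟨f, ⟨f, rfl⟩, fun w hw0 hw1 => ?_⟩
    have hL : realData.LFactor w χ ≠ 0 := by
      refine Complex.Gammaℝ_ne_zero_of_re_pos ?_
      simp
      positivity
    have h1 := real_zeta χ hw0 1
    simp only [one_mul] at h1
    have h2 := real_zeta χ⁻¹ (w := 1 - w) (by simpa using hw1) (Complex.I ^ realParity χ)
    rw [realParity_inv] at h2
    rw [show (f : ℝ → ℂ) = _ from funext hf] at hF ⊢
    rw [show realData.fourier _ = _ from funext hF, h1, h2]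
    refine ⟨hL, ?_⟩
    rw [LocalFieldData.gamma, div_mul_cancel₀ _ hL]
    rfl
  gamma_meromorphic χ z := by
    have h := meromorphicAt_gamma_ratio Complex.differentiable_Gammaℝ_inv
      (fun s hs => Complex.Gammaℝ_ne_zero_of_re_pos hs) (Complex.I ^ realParity χ)
      (realExponent χ * Complex.I + realParity χ)
      (realExponent χ⁻¹ * Complex.I + realParity χ⁻¹) z (by simp)
    simp only [← add_assoc] at h
    exact h.1
  gamma_analytic χ z := by
    have h := meromorphicAt_gamma_ratio Complex.differentiable_Gammaℝ_inv
      (fun s hs => Complex.Gammaℝ_ne_zero_of_re_pos hs) (Complex.I ^ realParity χ)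
      (realExponent χ * Complex.I + realParity χ)
      (realExponent χ⁻¹ * Complex.I + realParity χ⁻¹) z (by simp)
    simp only [← add_assoc] at h
    exact h.2

/-- Decay of Fourier transforms of functions on `ℝ` with a symbol-type singularity at `0`. -/
lemma realData_fourier_symbol_le {b : ℝ} (hb : 0 ≤ b) {F : ℝ → ℂ} (hF : Integrable F volume)
    (hs : ∀ k, IsSymbol (1 : ℝ) k b F) :
    ∃ C, ∀ y : ℝ, 1 ≤ ‖y‖ → ‖realData.fourier F y‖ ≤ C * |y| ^ (-1 - b) := by
  obtain ⟨k, hk⟩ := exists_nat_gt (b + 1)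
  obtain ⟨C, hC0, hC⟩ := realData_isLocal.fourier_symbol_le (by simp) norm_one hb
    (by exact_mod_cast hk) hF (hs k)
  refine ⟨C, fun y hy => ?_⟩
  have hy0 : 0 < |y| := one_pos.trans_le hy
  have hyne : y ≠ 0 := abs_pos.1 hy0
  have hτ : (1 / (2 * y) : ℝ) ≠ 0 := by positivity
  refine (hC (1 / (2 * y)) y hτ ?_).trans ?_
  · change Complex.exp _ = -1
    have e : -((1 / (2 * y)) • (1 : ℝ) * y) = -(1 / 2) := by
      rw [smul_eq_mul, mul_one]; field_simp
    rw [e, ← Complex.exp_neg_pi_mul_I]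
    congr 1
    push_cast
    ring
  · gcongr
    rw [show -1 - b = -(b + (1 : ℕ)) by push_cast; ring, Real.rpow_neg hy0.le,
      ← Real.inv_rpow hy0.le]
    refine Real.rpow_le_rpow (abs_nonneg _) ?_ (by positivity)
    rw [abs_div, abs_one, abs_mul, abs_two, one_div]
    exact inv_anti₀ hy0 (by linarith)

theorem real_hankel_of_schwartzRho (s : ℂ) (hs : s.re ≤ 1 / 2) (φ : ℝ → ℂ)
    (hφ : φ ∈ realData.schwartzRho s) : (∃ h, realData.IsHankelTransform s φ h) ∧
      ∀ (h : ℝ → ℂ) (χ : ℝˣ →ₜ* Circle), realData.IsHankelTransform s φ h →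
        realData.MellinIdentity s φ χ h := by
  refine realData_isTate.hankel_of_schwartzRho ?_ s hs φ hφ
  rintro _ ⟨g, rfl⟩ β hβ
  refine realData_fourier_symbol_le hβ.le (realData_isLocal.integrable_abs_cpow_mul
    (rapidDecay_schwartz g) g.continuous.aestronglyMeasurable hβ.le) fun k => ?_
  have h := (IsSymbol.norm_cpow (1 : ℝ) k β).mul (IsSymbol.schwartz (1 : ℝ) k 0 g)
  rw [Nat.cast_zero, neg_zero, add_zero] at h
  exact h

lemma rapidDecay_twoSided {f : ℝ → ℂ} (hf : f ∈ realTwoSidedSchwartz) :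
    AEStronglyMeasurable f volume ∧ RapidDecay f := by
  obtain ⟨g₁, g₂, h1, h2⟩ := hf
  classical
  constructor
  · have h3 : AEStronglyMeasurable ((Set.Ioi (0 : ℝ)).piecewise g₁ g₂) volume :=
      AEStronglyMeasurable.piecewise measurableSet_Ioi g₁.continuous.aestronglyMeasurable
        g₂.continuous.aestronglyMeasurable
    refine h3.congr ?_
    filter_upwards [realData_isLocal.ae_ne_zero] with x hx
    rcases lt_or_gt_of_ne hx with h | h
    · rw [Set.piecewise_eq_of_notMem _ _ _ (by simpa using h.le), h2 x h]
    · rw [Set.piecewise_eq_of_mem _ _ _ (Set.mem_Ioi.2 h), h1 x h]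
  · intro N
    obtain ⟨C, hC⟩ := rapidDecay_schwartz g₁ N
    obtain ⟨C', hC'⟩ := rapidDecay_schwartz g₂ N
    refine ⟨max C C', fun x hx => ?_⟩
    rcases lt_or_gt_of_ne hx with h | h
    · rw [h2 x h]
      exact (hC' x hx).trans (le_max_right _ _)
    · rw [h1 x h]
      exact (hC x hx).trans (le_max_left _ _)

open LineDeriv in
-- Symbol estimates concern only points off `0`, so a jump there is invisible to them.
lemma isSymbol_twoSided {f : ℝ → ℂ} {g₁ g₂ : 𝓢(ℝ, ℂ)} (h1 : ∀ x, 0 < x → f x = g₁ x)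
    (h2 : ∀ x, x < 0 → f x = g₂ x) (k n : ℕ) : IsSymbol (1 : ℝ) k (-(n : ℝ)) f := by
  have key : ∀ (n : ℕ) (f : ℝ → ℂ) (g₁ g₂ : 𝓢(ℝ, ℂ)), (∀ x, 0 < x → f x = g₁ x) →
      (∀ x, x < 0 → f x = g₂ x) → ∃ C : ℝ, ∀ x : ℝ, x ≠ 0 → ‖f x‖ ≤ C * ‖x‖ ^ (-(n : ℝ)) := by
    intro n f g₁ g₂ h1 h2
    obtain ⟨C, -, hC⟩ := (IsSymbol.schwartz (1 : ℝ) 0 n g₁).bound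
    obtain ⟨C', -, hC'⟩ := (IsSymbol.schwartz (1 : ℝ) 0 n g₂).bound
    refine ⟨max C C', fun x hx => ?_⟩
    rcases lt_or_gt_of_ne hx with h | h
    · rw [h2 x h]
      refine (hC' x hx).trans ?_
      gcongr
      exact le_max_right _ _
    · rw [h1 x h]
      refine (hC x hx).trans ?_
      gcongr
      exact le_max_left _ _
  induction k generalizing n f g₁ g₂ with
  | zero => exact key n f g₁ g₂ h1 h2
  | succ k ih =>
    classical
    set f' : ℝ → ℂ := (Set.Ioi (0 : ℝ)).piecewise (∂_{(1 : ℝ)} g₁ : 𝓢(ℝ, ℂ))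
      (∂_{(1 : ℝ)} g₂ : 𝓢(ℝ, ℂ)) with hf'
    have e1 : ∀ x, 0 < x → f' x = (∂_{(1 : ℝ)} g₁ : 𝓢(ℝ, ℂ)) x := fun x hx =>
      Set.piecewise_eq_of_mem _ _ _ hx
    have e2 : ∀ x, x < 0 → f' x = (∂_{(1 : ℝ)} g₂ : 𝓢(ℝ, ℂ)) x := fun x hx =>
      Set.piecewise_eq_of_notMem _ _ _ (by simpa using hx.le)
    refine ⟨key n f g₁ g₂ h1 h2, f', fun x hx => ?_, ?_⟩
    · have hline : ∀ g : 𝓢(ℝ, ℂ), HasLineDerivAt ℝ g ((∂_{(1 : ℝ)} g : 𝓢(ℝ, ℂ)) x) x 1 := by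
        intro g
        rw [SchwartzMap.lineDerivOp_apply]
        exact g.differentiableAt.lineDifferentiableAt.hasLineDerivAt
      rcases lt_or_gt_of_ne hx with h | h
      · rw [e2 x h]
        refine (hline g₂).congr_of_eventuallyEq ?_
        filter_upwards [Iio_mem_nhds h] with z hz using h2 z hz
      · rw [e1 x h]
        refine (hline g₁).congr_of_eventuallyEq ?_
        filter_upwards [Ioi_mem_nhds h] with z hz using h1 z hz
    · have := ih e1 e2 (n + 1)
      rwa [show (-((n + 1 : ℕ) : ℝ)) = -(n : ℝ) - 1 by push_cast; ring] at this

theorem real_hankel_of_twoSided (s : ℂ) (hs : s.re ≤ 1 / 2) (φ : ℝ → ℂ)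
    (hφ : φ ∈ realData.rhoSpace realTwoSidedSchwartz s) :
    (1 / 4 < s.re → ∃ h, realData.IsHankelTransform s φ h) ∧
      ∀ (h : ℝ → ℂ) (χ : ℝˣ →ₜ* Circle), realData.IsHankelTransform s φ h →
        realData.MellinIdentity s φ χ h := by
  have hT : ∀ f ∈ realTwoSidedSchwartz, AEStronglyMeasurable f realData.vol ∧ RapidDecay f :=
    fun f hf => rapidDecay_twoSided hf
  refine ⟨fun hs4 => ?_, fun h χ hh => realData_isTate.mellinIdentity_of_mem_rhoSpace hT hs hφ χ hh⟩
  -- A jump at `0` gives no more decay than `|y|⁻¹`, that is `b = 0`, and the requirement `b > 1/2 -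
  -- 2 Re s` becomes `Re s > 1/4`.
  refine realData_isTate.exists_hankel_of_mem_rhoSpace hT hs (b := 0) (by linarith) ?_ hφ
  intro hs2 f hf β hβ
  have hβ0 : 0 ≤ β.re := by
    rcases hβ with rfl | rfl
    · simp
    · simp
      linarith
  obtain ⟨hm, hd⟩ := rapidDecay_twoSided hf
  obtain ⟨g₁, g₂, h1, h2⟩ := hf
  obtain ⟨C, hC⟩ := realData_fourier_symbol_le hβ0
    (realData_isLocal.integrable_abs_cpow_mul hd hm hβ0) fun k => by
      have h := (IsSymbol.norm_cpow (1 : ℝ) k β).mul (isSymbol_twoSided h1 h2 k 0)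
      rw [Nat.cast_zero, neg_zero, add_zero] at h
      exact h
  refine ⟨|C|, fun y hy => (hC y hy).trans ?_⟩
  have hy' : 1 ≤ |y| := hy
  change C * |y| ^ _ ≤ |C| * |y| ^ _
  have h3 : |y| ^ (-1 - β.re) ≤ |y| ^ (-1 - (0 : ℝ)) :=
    Real.rpow_le_rpow_of_exponent_le hy' (by linarith)
  calc C * |y| ^ (-1 - β.re) ≤ |C| * |y| ^ (-1 - β.re) := by
        gcongr
        exact le_abs_self C
    _ ≤ _ := by gcongr

end realPlace


/-! ### The complex place: Fourier transform and test functions -/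

section complexPlace

open FourierTransform ComplexConjugate

lemma complexData_isLocal : complexData.IsLocal 2 where
  pos := two_pos
  abs_eq _ := rfl
  haar := Measure.IsAddHaarMeasure.smul (volume : Measure ℂ) two_ne_zero ENNReal.ofNat_ne_top
  map_mul a ha := by
    have hdet : LinearMap.det (LinearMap.mulLeft ℝ a) = ‖a‖ ^ 2 := by
      rw [← Complex.normSq_eq_norm_sq, ← Algebra.norm_complex_apply]
      rfl
    have ha2 : 0 < ‖a‖ ^ 2 := by positivity
    have h := Measure.map_linearMap_addHaar_eq_smul_addHaar (volume : Measure ℂ)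
      (f := LinearMap.mulLeft ℝ a) (by rw [hdet]; exact ha2.ne')
    rw [hdet, abs_of_pos (by positivity)] at h
    change ENNReal.ofReal (‖a‖ ^ 2) • Measure.map (LinearMap.mulLeft ℝ a)
      ((2 : ENNReal) • volume) = (2 : ENNReal) • volume
    rw [Measure.map_smul, h, smul_comm, smul_smul, smul_smul, mul_assoc, ← ENNReal.ofReal_mul ha2.le,
      mul_inv_cancel₀ ha2.ne', ENNReal.ofReal_one, mul_one]
  psi_continuous := by
    change Continuous fun z : ℂ => Complex.exp (4 * Real.pi * Complex.I * z.re)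
    fun_prop
  psi_add x y := by
    change Complex.exp _ = Complex.exp _ * Complex.exp _
    rw [← Complex.exp_add, Complex.add_re]
    push_cast
    ring_nf
  psi_norm x := by
    change ‖Complex.exp _‖ = 1
    rw [show 4 * (Real.pi : ℂ) * Complex.I * (x.re : ℂ) =
      ((4 * Real.pi * x.re : ℝ) : ℂ) * Complex.I by push_cast; ring, Complex.norm_exp_ofReal_mul_I]

lemma integral_complexData (f : ℂ → ℂ) : ∫ z, f z ∂complexData.vol = 2 * ∫ z, f z := by
  change ∫ z, f z ∂((2 : ENNReal) • volume) = _
  rw [integral_smul_measure]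
  simp

/-- The real-linear automorphism `w ↦ 2 w̄` of `ℂ`. -/
def twoConj : ℂ ≃L[ℝ] ℂ :=
  Complex.conjCLE.trans (ContinuousLinearEquiv.smulLeft (Units.mk0 (2 : ℝ) two_ne_zero))

lemma twoConj_apply (w : ℂ) : twoConj w = 2 * conj w := by
  simp [twoConj, Units.smul_def]

lemma inner_twoConj (z w : ℂ) : inner ℝ z (twoConj w) = 2 * (z * w).re := by
  rw [twoConj_apply, Complex.inner]
  simp
  ring

/-- The phase `4π Re(zw)` is `2π` times the real inner product of `z` and `2 w̄`; the factor `2` is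
that of the measure. -/
lemma complexData_fourier (f : ℂ → ℂ) (w : ℂ) :
    complexData.fourier f w = 2 * 𝓕⁻ f (twoConj w) := by
  rw [LocalFieldData.fourier, integral_complexData, Real.fourierInv_eq']
  congr 1
  refine integral_congr_ae (ae_of_all _ fun z => ?_)
  simp only [inner_twoConj, complexData, smul_eq_mul, mul_comm (f z)]
  congr 2
  push_cast
  ring

lemma complexData_fourier_comp_conj (f : ℂ → ℂ) (w : ℂ) :
    complexData.fourier (fun z => f (conj z)) w = complexData.fourier f (conj w) := by
  rw [LocalFieldData.fourier, LocalFieldData.fourier, integral_complexData, integral_complexData,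
    ← (Complex.conjLIE.measurePreserving).integral_comp Complex.conjLIE.toHomeomorph.measurableEmbedding]
  congr 1
  refine integral_congr_ae (ae_of_all _ fun z => ?_)
  simp [complexData]

lemma integral_comp_twoConj (f : ℂ → ℂ) : ∫ w, f (twoConj w) = 1 / 4 * ∫ w, f w := by
  have h1 : ∫ w, f (twoConj w) = ∫ w, f ((2 : ℝ) • w) := by
    rw [← (Complex.conjLIE.measurePreserving).integral_comp
      Complex.conjLIE.toHomeomorph.measurableEmbedding]
    refine integral_congr_ae (ae_of_all _ fun z => ?_)
    simp [twoConj_apply]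
  rw [h1, Measure.integral_comp_smul, Complex.finrank_real_complex, Complex.real_smul]
  norm_num

/-- The two factors `2` of the measure cancel the Jacobian `4` of `w ↦ 2 w̄`, so inversion reduces
to the standard one. -/
lemma complexData_fourier_fourier (g : 𝓢(ℂ, ℂ)) (z : ℂ) :
    complexData.fourier (complexData.fourier g) z = g (-z) := by
  have h : 𝓕⁻ (𝓕⁻ (g : ℂ → ℂ)) z = g (-z) := by
    rw [Real.fourierInv_eq_fourier_neg, ← SchwartzMap.fourierInv_coe, ← SchwartzMap.fourier_coe,
      FourierTransform.fourier_fourierInv_eq]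
  rw [← h, complexData_fourier, Real.fourierInv_eq', Real.fourierInv_eq']
  have e : ∀ w : ℂ, Complex.exp (((2 * Real.pi * inner ℝ w (twoConj z) : ℝ) : ℂ) * Complex.I) •
      complexData.fourier g w = 2 * (fun u : ℂ =>
        Complex.exp (((2 * Real.pi * inner ℝ u z : ℝ) : ℂ) * Complex.I) • 𝓕⁻ (g : ℂ → ℂ) u)
          (twoConj w) := by
    intro w
    have hi : inner ℝ (twoConj w) z = inner ℝ w (twoConj z) := by
      rw [real_inner_comm, inner_twoConj, inner_twoConj, mul_comm z]
    simp only [hi, complexData_fourier, smul_eq_mul]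
    ring
  rw [integral_congr_ae (ae_of_all _ e), integral_const_mul, integral_comp_twoConj fun u =>
    Complex.exp (((2 * Real.pi * inner ℝ u z : ℝ) : ℂ) * Complex.I) • 𝓕⁻ (g : ℂ → ℂ) u]
  ring

lemma complexData_fourier_gaussian (w : ℂ) :
    complexData.fourier (fun z : ℂ => Complex.exp (-(2 * Real.pi : ℝ) * ‖z‖ ^ 2)) w =
      Complex.exp (-(2 * Real.pi : ℝ) * ‖w‖ ^ 2) := by
  have hpi : (Real.pi : ℂ) ≠ 0 := by exact_mod_cast Real.pi_ne_zero
  have hn : ‖twoConj w‖ = 2 * ‖w‖ := by simp [twoConj_apply]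
  rw [complexData_fourier, Real.fourierInv_eq_fourier_neg,
    fourier_gaussian_innerProductSpace (by simpa using Real.pi_pos), norm_neg, hn,
    Complex.finrank_real_complex]
  rw [show ((2 : ℕ) : ℂ) / 2 = 1 by norm_num, Complex.cpow_one, ← mul_assoc,
    show 2 * ((Real.pi : ℂ) / ((2 * Real.pi : ℝ) : ℂ)) = 1 by push_cast; field_simp, one_mul]
  congr 1
  push_cast
  field_simp

lemma ofReal_norm_sq (z : ℂ) : (‖z‖ : ℂ) ^ 2 = conj z * z := by
  rw [← Complex.normSq_eq_conj_mul_self, Complex.normSq_eq_norm_sq]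
  push_cast
  rfl

open LineDeriv in
lemma complexData_fourier_lineDeriv (f : 𝓢(ℂ, ℂ)) (v w : ℂ) :
    complexData.fourier (∂_{v} f : 𝓢(ℂ, ℂ)) w =
      -(4 * Real.pi * Complex.I) * (v * w).re * complexData.fourier f w := by
  have h3 : (inner ℝ · v : ℂ → ℝ).HasTemperateGrowth := by fun_prop
  rw [complexData_fourier, complexData_fourier, ← SchwartzMap.fourierInv_coe,
    ← SchwartzMap.fourierInv_coe, SchwartzMap.fourierInv_lineDerivOp_eq, smul_apply,
    SchwartzMap.smulLeftCLM_apply_apply h3, real_inner_comm, inner_twoConj]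
  simp only [smul_eq_mul, Complex.real_smul]
  push_cast
  ring

open LineDeriv in
/-- The test functions `z̄ ^ m e ^ {-2π|z|²}`. -/
lemma exists_conj_pow_mul_gaussian (m : ℕ) : ∃ f : 𝓢(ℂ, ℂ),
    (∀ z, f z = conj z ^ m * Complex.exp (-(2 * Real.pi : ℝ) * ‖z‖ ^ 2)) ∧
    ∀ w, complexData.fourier f w =
      Complex.I ^ m * (w ^ m * Complex.exp (-(2 * Real.pi : ℝ) * ‖w‖ ^ 2)) := by
  have hpi : (Real.pi : ℂ) ≠ 0 := by exact_mod_cast Real.pi_ne_zero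
  induction m with
  | zero =>
    obtain ⟨g, hg⟩ := exists_schwartz_gaussian ℂ (mul_pos two_pos Real.pi_pos)
    refine ⟨g, by simpa using hg, fun w => ?_⟩
    rw [show (g : ℂ → ℂ) = _ from funext hg, complexData_fourier_gaussian]
    simp
  | succ m ih =>
    obtain ⟨f, hf, hF⟩ := ih
    have hd : ∀ v z : ℂ, (∂_{v} f : 𝓢(ℂ, ℂ)) z =
        (m * conj z ^ (m - 1) * conj v - 2 * Real.pi * conj z ^ m * (conj v * z + conj z * v)) *
          Complex.exp (-(2 * Real.pi : ℝ) * ‖z‖ ^ 2) := by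
      intro v z
      rw [SchwartzMap.lineDerivOp_apply]
      refine HasLineDerivAt.lineDeriv ?_
      have e : (fun t : ℝ => f (z + t • v)) = fun t : ℝ => (conj z + t * conj v) ^ m *
          Complex.exp (-(2 * Real.pi : ℝ) * ((conj z + t * conj v) * (z + t * v))) := by
        ext t
        rw [hf, ofReal_norm_sq, Complex.real_smul]
        simp
      rw [HasLineDerivAt, e, ofReal_norm_sq]
      have h0 : HasDerivAt (fun t : ℝ => (t : ℂ)) 1 0 := Complex.ofRealCLM.hasDerivAt
      have h1 := (h0.mul_const (conj v)).const_add (conj z)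
      have h2 := (h0.mul_const v).const_add z
      have h4 := (h1.fun_pow m).fun_mul (((h1.fun_mul h2).const_mul (-((2 * Real.pi : ℝ) : ℂ))).cexp)
      convert! h4 using 1
      simp
      ring
    -- `∂_1 - i ∂_i` is twice the Wirtinger derivative in `z`. It ignores `z̄^m` and takes `-4π z̄`
    -- out of the Gaussian, while on the Fourier side it multiplies by `-4πi w`.
    refine ⟨(-(1 / (4 * Real.pi) : ℂ)) • ((∂_{(1 : ℂ)} f : 𝓢(ℂ, ℂ)) -
      Complex.I • (∂_{Complex.I} f : 𝓢(ℂ, ℂ))), fun z => ?_, fun w => ?_⟩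
    · simp only [smul_apply, sub_apply, smul_eq_mul, hd, map_one, Complex.conj_I]
      have hI := Complex.I_mul_I
      have h1 : 1 / (4 * (Real.pi : ℂ)) * (4 * Real.pi) = 1 := by field_simp
      generalize Complex.exp _ = E
      calc _ = -(1 / (4 * (Real.pi : ℂ))) * (m * conj z ^ (m - 1) * (1 + Complex.I * Complex.I) -
            2 * Real.pi * conj z ^ m * (z * (1 + Complex.I * Complex.I) +
              conj z * (1 - Complex.I * Complex.I))) * E := by ring
        _ = 1 / (4 * (Real.pi : ℂ)) * (4 * Real.pi) * (conj z ^ (m + 1) * E) := by rw [hI]; ring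
        _ = _ := by rw [h1, one_mul]
    · have hlin : ∀ (c : ℂ) (a b : 𝓢(ℂ, ℂ)), complexData.fourier
          (c • (a - Complex.I • b) : 𝓢(ℂ, ℂ)) w =
          c * (complexData.fourier a w - Complex.I * complexData.fourier b w) := by
        intro c a b
        simp only [complexData_fourier, ← SchwartzMap.fourierInv_coe]
        rw [sub_eq_add_neg, ← neg_smul, FourierTransform.fourierInv_smul,
          FourierTransform.fourierInv_add, FourierTransform.fourierInv_smul]
        simp only [smul_apply, add_apply, smul_eq_mul]
        ring
      rw [hlin, complexData_fourier_lineDeriv, complexData_fourier_lineDeriv, hF]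
      have hw : ((1 * w).re : ℂ) - Complex.I * ((Complex.I * w).re : ℂ) = w := by
        apply Complex.ext <;> simp
      have h1 : -(1 / (4 * (Real.pi : ℂ))) * (4 * Real.pi) = -1 := by field_simp
      generalize Complex.exp _ = E at *
      calc _ = (-(1 / (4 * (Real.pi : ℂ))) * (4 * Real.pi)) * -(Complex.I) * (((1 * w).re : ℂ) -
            Complex.I * ((Complex.I * w).re : ℂ)) * (Complex.I ^ m * (w ^ m * E)) := by ring
        _ = _ := by rw [h1, hw]; ring

lemma exists_pow_mul_gaussian (m : ℕ) : ∃ f : 𝓢(ℂ, ℂ),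
    (∀ z, f z = z ^ m * Complex.exp (-(2 * Real.pi : ℝ) * ‖z‖ ^ 2)) ∧
    ∀ w, complexData.fourier f w =
      Complex.I ^ m * (conj w ^ m * Complex.exp (-(2 * Real.pi : ℝ) * ‖w‖ ^ 2)) := by
  obtain ⟨f, hf, hF⟩ := exists_conj_pow_mul_gaussian m
  refine ⟨SchwartzMap.compCLMOfContinuousLinearEquiv ℝ Complex.conjCLE f, fun z => ?_, fun w => ?_⟩
  · change f (conj z) = _
    rw [hf]
    simp
  · have := complexData_fourier_comp_conj f w
    rw [hF] at this
    refine Eq.trans ?_ (this.trans ?_)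
    · rfl
    · simp

end complexPlace


/-! ### The complex place: characters, zeta integrals and decay -/

section complexPlace

open FourierTransform ComplexConjugate

lemma complexParams_spec (χ : ℂˣ →ₜ* Circle) {z : ℂ} (hz : z ≠ 0) :
    charExt χ z = (z / (‖z‖ : ℂ)) ^ (complexParams χ).1 *
      ((‖z‖ ^ 2 : ℝ) : ℂ) ^ (((complexParams χ).2 : ℂ) * Complex.I) := by
  have hex : ∃ p : ℤ × ℝ, ∀ z : ℂˣ, ((χ z : Circle) : ℂ) =
      ((z : ℂ) / (‖(z : ℂ)‖ : ℂ)) ^ p.1 * ((‖(z : ℂ)‖ ^ 2 : ℝ) : ℂ) ^ ((p.2 : ℂ) * Complex.I) := by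
    obtain ⟨τ, hτ⟩ := exists_eq_exp_of_continuous (φ := fun u : ℝ => charExt χ (Complex.exp u))
      ((continuousOn_charExt χ).comp_continuous (by fun_prop) fun u => Complex.exp_ne_zero _)
      (fun u v => by rw [Complex.ofReal_add, Complex.exp_add, charExt_mul])
      (fun u => norm_charExt χ (Complex.exp_ne_zero _))
    obtain ⟨ν, hν⟩ := exists_eq_exp_of_continuous
      (φ := fun u : ℝ => charExt χ (Complex.exp (u * Complex.I)))
      ((continuousOn_charExt χ).comp_continuous (by fun_prop) fun u => Complex.exp_ne_zero _)
      (fun u v => by rw [Complex.ofReal_add, add_mul, Complex.exp_add, charExt_mul])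
      (fun u => norm_charExt χ (Complex.exp_ne_zero _))
    have hper : Complex.exp (ν * (2 * Real.pi : ℝ) * Complex.I) = 1 := by
      rw [← hν, Complex.ofReal_mul, Complex.ofReal_ofNat, Complex.exp_two_pi_mul_I]
      simpa using charExt_unit χ (1 : ℂˣ)
    obtain ⟨n, hn⟩ := Complex.exp_eq_one_iff.1 hper
    have hνn : (ν : ℂ) = n := by
      have h2 : (2 * Real.pi * Complex.I : ℂ) ≠ 0 := Complex.two_pi_I_ne_zero
      refine mul_right_cancel₀ h2 ?_
      rw [← hn]
      push_cast
      ring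
    -- The exponent is halved because the normalised absolute value is `‖z‖²`; `n` is an integer
    -- because the restriction to the circle has period `2π`.
    refine ⟨(n, τ / 2), fun z => ?_⟩
    have hz0 : 0 < ‖(z : ℂ)‖ := norm_pos_iff.2 z.ne_zero
    have hzn : (‖(z : ℂ)‖ : ℂ) ≠ 0 := by exact_mod_cast hz0.ne'
    have hpol : (z : ℂ) = Complex.exp (Real.log ‖(z : ℂ)‖ : ℝ) *
        Complex.exp ((z : ℂ).arg * Complex.I) := by
      rw [← Complex.ofReal_exp, Real.exp_log hz0, Complex.norm_mul_exp_arg_mul_I]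
    have harg : (z : ℂ) / (‖(z : ℂ)‖ : ℂ) = Complex.exp ((z : ℂ).arg * Complex.I) := by
      rw [div_eq_iff hzn, mul_comm, Complex.norm_mul_exp_arg_mul_I]
    have h1 : charExt χ (z : ℂ) = Complex.exp (τ * (Real.log ‖(z : ℂ)‖ : ℝ) * Complex.I) *
        Complex.exp (ν * ((z : ℂ).arg : ℝ) * Complex.I) := by
      rw [← hτ, ← hν, ← charExt_mul, ← hpol]
    rw [← charExt_unit, h1, harg, ← Complex.exp_int_mul, hνn, mul_comm,
      Complex.cpow_def_of_ne_zero (by exact_mod_cast (by positivity : (‖(z : ℂ)‖ ^ 2 : ℝ) ≠ 0)),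
      ← Complex.ofReal_log (by positivity), Real.log_pow]
    push_cast
    ring_nf
  have h := Classical.epsilon_spec hex (Units.mk0 z hz)
  rw [charExt_of_ne χ hz]
  exact h

/-- If the two integers had nonzero sum `k`, evaluating `χ χ⁻¹ = 1` at `e^{iπ/k}` would give `-1 =
1`. This matters because the test function for `χ` and its transform must share `|n|`. -/
lemma complexParams_inv_fst (χ : ℂˣ →ₜ* Circle) :
    (complexParams χ⁻¹).1 = -(complexParams χ).1 := by
  by_contra hne
  set k : ℤ := (complexParams χ).1 + (complexParams χ⁻¹).1 with hk
  have hk0 : (k : ℂ) ≠ 0 := by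
    exact_mod_cast fun h : k = 0 => hne (by omega)
  set z : ℂ := Complex.exp ((Real.pi / k : ℝ) * Complex.I) with hz
  have hz0 : z ≠ 0 := Complex.exp_ne_zero _
  have hzn : ‖z‖ = 1 := Complex.norm_exp_ofReal_mul_I _
  have h1 := complexParams_spec χ hz0
  have h2 := complexParams_spec χ⁻¹ hz0
  simp only [hzn, one_pow, Complex.ofReal_one, Complex.one_cpow, div_one, mul_one] at h1 h2
  have h3 : charExt χ z * charExt χ⁻¹ z = 1 := by
    rw [charExt_of_ne χ hz0, charExt_of_ne χ⁻¹ hz0, ← Circle.coe_mul]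
    change ((χ _ * (χ _)⁻¹ : Circle) : ℂ) = 1
    rw [mul_inv_cancel, Circle.coe_one]
  rw [h1, h2, ← zpow_add₀ hz0, ← hk, hz, ← Complex.exp_int_mul,
    show (k : ℂ) * ((Real.pi / k : ℝ) * Complex.I) = Real.pi * Complex.I by
      push_cast; field_simp, Complex.exp_pi_mul_I] at h3
  norm_num at h3

lemma ofReal_sq_cpow {r : ℝ} (hr : 0 ≤ r) (β : ℂ) : ((r ^ 2 : ℝ) : ℂ) ^ β = (r : ℂ) ^ (2 * β) := by
  have h := Complex.cpow_nat_mul' (x := r) (n := 2)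
    (by rw [Complex.arg_ofReal_of_nonneg hr]; simpa using Real.pi_pos)
    (by rw [Complex.arg_ofReal_of_nonneg hr]; simpa using Real.pi_pos.le) β
  rw [Complex.ofReal_pow, ← h]
  norm_num

lemma ofReal_norm_sq_cpow_half (z : ℂ) (N : ℕ) :
    ((‖z‖ ^ 2 : ℝ) : ℂ) ^ ((N : ℂ) / 2) = (‖z‖ : ℂ) ^ N := by
  rw [ofReal_sq_cpow (norm_nonneg z), mul_div_cancel₀ _ two_ne_zero, Complex.cpow_natCast]

lemma conj_pow_mul_charExt (χ : ℂˣ →ₜ* Circle) (hn : 0 ≤ (complexParams χ).1) {z : ℂ}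
    (hz : z ≠ 0) : conj z ^ (complexParams χ).1.natAbs * charExt χ z =
      ((‖z‖ ^ 2 : ℝ) : ℂ) ^ ((complexParams χ).2 * Complex.I +
        ((complexParams χ).1.natAbs : ℂ) / 2) := by
  have hz0 : ((‖z‖ ^ 2 : ℝ) : ℂ) ≠ 0 := by
    exact_mod_cast (by positivity : (‖z‖ ^ 2 : ℝ) ≠ 0)
  have hzn : (‖z‖ : ℂ) ≠ 0 := by exact_mod_cast norm_ne_zero_iff.2 hz
  have h1 : conj z * (z / (‖z‖ : ℂ)) = ‖z‖ := by
    rw [← mul_div_assoc, ← ofReal_norm_sq, sq, mul_div_cancel_right₀ _ hzn]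
  have h2 : (z / (‖z‖ : ℂ)) ^ (complexParams χ).1 =
      (z / (‖z‖ : ℂ)) ^ (complexParams χ).1.natAbs := by
    rw [← zpow_natCast, Int.natAbs_of_nonneg hn]
  rw [complexParams_spec χ hz, h2, Complex.cpow_add _ _ hz0, ofReal_norm_sq_cpow_half,
    ← mul_assoc, ← mul_pow, h1, mul_comm]

lemma pow_mul_charExt_complex (χ : ℂˣ →ₜ* Circle) (hn : (complexParams χ).1 ≤ 0) {z : ℂ}
    (hz : z ≠ 0) : z ^ (complexParams χ).1.natAbs * charExt χ z =
      ((‖z‖ ^ 2 : ℝ) : ℂ) ^ ((complexParams χ).2 * Complex.I +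
        ((complexParams χ).1.natAbs : ℂ) / 2) := by
  have hz0 : ((‖z‖ ^ 2 : ℝ) : ℂ) ≠ 0 := by
    exact_mod_cast (by positivity : (‖z‖ ^ 2 : ℝ) ≠ 0)
  have hzn : (‖z‖ : ℂ) ≠ 0 := by exact_mod_cast norm_ne_zero_iff.2 hz
  have h1 : z * (z / (‖z‖ : ℂ))⁻¹ = ‖z‖ := by
    field_simp
  have h2 : (complexParams χ).1 = -((complexParams χ).1.natAbs : ℤ) := by
    rw [Int.ofNat_natAbs_of_nonpos hn, neg_neg]
  have h3 : (z / (‖z‖ : ℂ)) ^ (complexParams χ).1 =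
      (z / (‖z‖ : ℂ))⁻¹ ^ (complexParams χ).1.natAbs := by
    rw [h2, zpow_neg, zpow_natCast, Int.natAbs_neg, Int.natAbs_natCast, inv_pow]
  rw [complexParams_spec χ hz, h3, Complex.cpow_add _ _ hz0, ofReal_norm_sq_cpow_half,
    ← mul_assoc, ← mul_pow, h1, mul_comm]

/-- The polynomial factor is `z̄^{|n|}` or `z^{|n|}` according to the sign of `n`, chosen to cancel
the angular part of `χ`. The Fourier transform exchanges the two, as required for `χ⁻¹`. -/
lemma exists_complexTest (χ : ℂˣ →ₜ* Circle) : ∃ f : 𝓢(ℂ, ℂ),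
    (∀ z, z ≠ 0 → f z * charExt χ z = 1 * (((‖z‖ ^ 2 : ℝ) : ℂ) ^ ((complexParams χ).2 * Complex.I +
        ((complexParams χ).1.natAbs : ℂ) / 2) * Complex.exp (-(2 * Real.pi : ℝ) * ‖z‖ ^ 2))) ∧
    ∀ z, z ≠ 0 → complexData.fourier f z * charExt χ⁻¹ z =
      Complex.I ^ (complexParams χ).1.natAbs *
        (((‖z‖ ^ 2 : ℝ) : ℂ) ^ ((complexParams χ⁻¹).2 * Complex.I +
        ((complexParams χ⁻¹).1.natAbs : ℂ) / 2) * Complex.exp (-(2 * Real.pi : ℝ) * ‖z‖ ^ 2)) := by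
  have hinv := complexParams_inv_fst χ
  have habs : (complexParams χ⁻¹).1.natAbs = (complexParams χ).1.natAbs := by
    rw [hinv, Int.natAbs_neg]
  rcases le_total 0 (complexParams χ).1 with hn | hn
  · obtain ⟨f, hf, hF⟩ := exists_conj_pow_mul_gaussian (complexParams χ).1.natAbs
    refine ⟨f, fun z hz => ?_, fun z hz => ?_⟩
    · rw [← conj_pow_mul_charExt χ hn hz, hf]
      ring
    · rw [← pow_mul_charExt_complex χ⁻¹ (by omega) hz, hF, habs]
      ring
  · obtain ⟨f, hf, hF⟩ := exists_pow_mul_gaussian (complexParams χ).1.natAbs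
    refine ⟨f, fun z hz => ?_, fun z hz => ?_⟩
    · rw [← pow_mul_charExt_complex χ hn hz, hf]
      ring
    · rw [← conj_pow_mul_charExt χ⁻¹ (by omega) hz, hF, habs]
      ring

lemma complex_zeta (χ : ℂˣ →ₜ* Circle) {w : ℂ} (hw : 0 < w.re) {c : ℂ} {f : ℂ → ℂ}
    (hf : ∀ z, z ≠ 0 → f z * charExt χ z =
      c * (((‖z‖ ^ 2 : ℝ) : ℂ) ^ ((complexParams χ).2 * Complex.I +
        ((complexParams χ).1.natAbs : ℂ) / 2) * Complex.exp (-(2 * Real.pi : ℝ) * ‖z‖ ^ 2))) :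
    ∫ z, complexData.mellinIntegrand f χ w z ∂complexData.vol = c * complexData.LFactor w χ := by
  set s : ℂ := w + (complexParams χ).2 * Complex.I + ((complexParams χ).1.natAbs : ℂ) / 2 with hs
  have hsre : 0 < s.re := by
    have : 0 ≤ (((complexParams χ).1.natAbs : ℂ) / 2).re := by
      rw [Complex.div_ofNat_re, Complex.natCast_re]
      positivity
    rw [hs]
    simp only [Complex.add_re, Complex.re_ofReal_mul, Complex.I_re, mul_zero, add_zero]
    linarith
  have hpi : (0 : ℝ) < 2 * Real.pi := by positivity
  have hpi0 : ((2 * Real.pi : ℝ) : ℂ) ≠ 0 := by exact_mod_cast hpi.ne'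
  have e : ∀ᵐ z : ℂ ∂volume, complexData.mellinIntegrand f χ w z =
      c * ((‖z‖ : ℂ) ^ (2 * s - 2) * Complex.exp (-(2 * Real.pi : ℝ) * (‖z‖ : ℂ) ^ 2)) := by
    filter_upwards [Measure.ae_ne volume (0 : ℂ)] with z hz
    have hz0 : ((‖z‖ ^ 2 : ℝ) : ℂ) ≠ 0 := by
      exact_mod_cast (by positivity : (‖z‖ ^ 2 : ℝ) ≠ 0)
    rw [LocalFieldData.mellinIntegrand, hf z hz]
    change _ * ((‖z‖ ^ 2 : ℝ) : ℂ) ^ (w - 1) = _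
    rw [show 2 * s - 2 = 2 * (((complexParams χ).2 * Complex.I +
      ((complexParams χ).1.natAbs : ℂ) / 2) + (w - 1)) by rw [hs]; ring,
      ← ofReal_sq_cpow (norm_nonneg z), Complex.cpow_add _ (w - 1) hz0]
    ring
  have hint := integral_fun_norm_addHaar (volume : Measure ℂ)
    (fun r : ℝ => (r : ℂ) ^ (2 * s - 2) * Complex.exp (-(2 * Real.pi : ℝ) * (r : ℂ) ^ 2))
  have h2 : (volume : Measure ℂ).real (Metric.ball 0 1) = Real.pi := by
    simp [Measure.real, Complex.volume_ball]
  have h4 : ∫ r in Set.Ioi (0 : ℝ), r ^ (2 - 1) • ((r : ℂ) ^ (2 * s - 2) *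
      Complex.exp (-(2 * Real.pi : ℝ) * (r : ℂ) ^ 2)) =
      ∫ r in Set.Ioi (0 : ℝ), (r : ℂ) ^ (2 * s - 1) *
        Complex.exp (-(2 * Real.pi : ℝ) * (r : ℂ) ^ 2) := by
    refine setIntegral_congr_fun measurableSet_Ioi fun r hr => ?_
    have hr0 : (r : ℂ) ≠ 0 := by exact_mod_cast (Set.mem_Ioi.1 hr).ne'
    change r ^ (2 - 1) • _ = _
    rw [show 2 * s - 1 = 1 + (2 * s - 2) by ring, Complex.cpow_add _ _ hr0, Complex.cpow_one,
      Complex.real_smul]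
    norm_num
    ring
  rw [integral_complexData, integral_congr_ae e, integral_const_mul, hint, h2,
    Complex.finrank_real_complex, h4,
    integral_rpow_mul_gaussian hpi (by simpa using hsre), mul_div_cancel_left₀ _ two_ne_zero]
  change _ = c * zetaC s
  have h5 : (1 / ((2 * Real.pi : ℝ) : ℂ)) ^ s = ((2 * Real.pi : ℝ) : ℂ) ^ (-s) := by
    rw [one_div, Complex.inv_cpow _ _ (by
      rw [Complex.arg_ofReal_of_nonneg hpi.le]; exact Real.pi_ne_zero.symm), ← Complex.cpow_neg]
  have h6 : (2 * Real.pi : ℂ) = ((2 * Real.pi : ℝ) : ℂ) := by push_cast; rfl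
  rw [zetaC, h6, h5, sub_eq_add_neg, Complex.cpow_add _ _ hpi0, Complex.cpow_one, two_smul,
    Complex.real_smul]
  push_cast
  ring

lemma zetaC_ne_zero {s : ℂ} (hs : 0 < s.re) : zetaC s ≠ 0 :=
  mul_ne_zero (by rw [Complex.cpow_ne_zero_iff]; left; simp)
    (Complex.Gamma_ne_zero_of_re_pos hs)

lemma differentiable_zetaC_inv : Differentiable ℂ fun s => (zetaC s)⁻¹ := by
  have hpi : (2 * Real.pi : ℂ) ≠ 0 := by simp
  have e : (fun s => (zetaC s)⁻¹) =
      fun s : ℂ => (2 * Real.pi : ℂ) ^ (s - 1) * (Complex.Gamma s)⁻¹ := by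
    ext s
    rw [zetaC, mul_inv, ← Complex.cpow_neg, neg_sub]
  rw [e]
  refine Differentiable.mul ?_ Complex.differentiable_one_div_Gamma
  exact fun s => ((differentiable_id.sub_const 1) s).const_cpow (Or.inl hpi)

lemma re_complexParams_nonneg (χ : ℂˣ →ₜ* Circle) :
    0 ≤ ((complexParams χ).2 * Complex.I + ((complexParams χ).1.natAbs : ℂ) / 2).re := by
  rw [Complex.add_re, Complex.re_ofReal_mul, Complex.I_re, mul_zero, zero_add,
    Complex.div_ofNat_re, Complex.natCast_re]
  positivity

lemma complexData_isTate : complexData.IsTate 2 where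
  toIsLocal := complexData_isLocal
  schwartz_continuous := by
    rintro _ ⟨g, rfl⟩
    exact g.continuous
  schwartz_decay := by
    rintro _ ⟨g, rfl⟩
    exact rapidDecay_schwartz g
  schwartz_add := by
    rintro _ ⟨g, rfl⟩ _ ⟨g', rfl⟩
    exact ⟨g + g', rfl⟩
  schwartz_smul := by
    rintro c _ ⟨g, rfl⟩
    exact ⟨c • g, rfl⟩
  schwartz_comp_mul := by
    rintro a ha _ ⟨g, rfl⟩
    exact schwartz_comp_mul ha g
  fourier_mem := by
    rintro _ ⟨g, rfl⟩
    refine ⟨(2 : ℂ) • SchwartzMap.compCLMOfContinuousLinearEquiv ℝ twoConj (𝓕⁻ g), ?_⟩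
    ext w
    rw [complexData_fourier, ← SchwartzMap.fourierInv_coe]
    rfl
  fourier_fourier := by
    rintro _ ⟨g, rfl⟩ x
    exact complexData_fourier_fourier g x
  ae_eq_zero u hu h := ae_eq_zero_of_integral_schwartz hu fun f hf => h f ⟨f, rfl⟩ hf
  exists_test χ := by
    obtain ⟨f, hf, hF⟩ := exists_complexTest χ
    refine ⟨f, ⟨f, rfl⟩, fun w hw0 hw1 => ?_⟩
    have hL : complexData.LFactor w χ ≠ 0 := by
      refine zetaC_ne_zero ?_
      have := re_complexParams_nonneg χ
      rw [add_assoc, Complex.add_re]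
      linarith
    rw [complex_zeta χ hw0 hf, one_mul, complex_zeta χ⁻¹ (w := 1 - w) (by simpa using hw1) hF]
    refine ⟨hL, ?_⟩
    rw [LocalFieldData.gamma, div_mul_cancel₀ _ hL]
    rfl
  gamma_meromorphic χ z := by
    have h := meromorphicAt_gamma_ratio differentiable_zetaC_inv (fun s hs => zetaC_ne_zero hs)
      (Complex.I ^ (complexParams χ).1.natAbs)
      ((complexParams χ).2 * Complex.I + ((complexParams χ).1.natAbs : ℂ) / 2) _ z
      (re_complexParams_nonneg χ⁻¹)
    simp only [← add_assoc] at h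
    exact h.1
  gamma_analytic χ z := by
    have h := meromorphicAt_gamma_ratio differentiable_zetaC_inv (fun s hs => zetaC_ne_zero hs)
      (Complex.I ^ (complexParams χ).1.natAbs)
      ((complexParams χ).2 * Complex.I + ((complexParams χ).1.natAbs : ℂ) / 2) _ z
      (re_complexParams_nonneg χ⁻¹)
    simp only [← add_assoc] at h
    exact h.2

/-- Decay of Fourier transforms of functions on `ℂ` with a symbol-type singularity at `0`. -/
lemma complexData_fourier_symbol_le {b : ℝ} (hb : 0 ≤ b) {F : ℂ → ℂ}
    (hF : Integrable F complexData.vol) (hs : ∀ (v : ℂ) (k : ℕ), IsSymbol v k b F) :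
    ∃ C, ∀ y : ℂ, 1 ≤ ‖y‖ → ‖complexData.fourier F y‖ ≤ C * ‖y‖ ^ (-(b + 2)) := by
  obtain ⟨k, hk⟩ := exists_nat_gt (b + 2)
  obtain ⟨C, hC0, hC⟩ := complexData_isLocal.fourier_symbol_le Complex.finrank_real_complex
    norm_one hb (by exact_mod_cast hk) hF (hs 1 k)
  obtain ⟨C', hC0', hC'⟩ := complexData_isLocal.fourier_symbol_le Complex.finrank_real_complex
    Complex.norm_I hb (by exact_mod_cast hk) hF (hs Complex.I k)
  -- For `τ = 1 / (4 Re(vy))` the character takes the value `-1`, and `|τ| ≤ 1/‖y‖` when `|Re(vy)| ≥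
  -- ‖y‖/2`. One of the directions `v = 1` and `v = i` always satisfies this.
  have key : ∀ (v : ℂ) (B : ℝ), 0 ≤ B → (∀ (τ : ℝ) (y : ℂ), τ ≠ 0 →
      complexData.psi (-(τ • v * y)) = -1 → ‖complexData.fourier F y‖ ≤ B * |τ| ^ (b + (2 : ℕ))) →
      ∀ y : ℂ, 1 ≤ ‖y‖ → ‖y‖ / 2 ≤ |(v * y).re| →
        ‖complexData.fourier F y‖ ≤ B * ‖y‖ ^ (-(b + 2)) := by
    intro v B hB0 hB y hy hvy
    have hy0 : 0 < ‖y‖ := one_pos.trans_le hy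
    have hr : (v * y).re ≠ 0 := abs_pos.1 ((by positivity : 0 < ‖y‖ / 2).trans_le hvy)
    have hrC : ((v * y).re : ℂ) ≠ 0 := by exact_mod_cast hr
    have hτ : (1 / (4 * (v * y).re) : ℝ) ≠ 0 := by positivity
    refine (hB _ y hτ ?_).trans ?_
    · change Complex.exp _ = -1
      rw [← Complex.exp_neg_pi_mul_I, smul_mul_assoc, Complex.neg_re, Complex.smul_re, smul_eq_mul]
      congr 1
      push_cast
      field_simp
    · gcongr
      rw [Real.rpow_neg hy0.le, ← Real.inv_rpow hy0.le, Nat.cast_ofNat]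
      refine Real.rpow_le_rpow (abs_nonneg _) ?_ (by positivity)
      rw [abs_div, abs_one, abs_mul, one_div]
      refine inv_anti₀ hy0 ?_
      rw [abs_of_pos (by norm_num : (0 : ℝ) < 4)]
      linarith
  refine ⟨max C C', fun y hy => ?_⟩
  have hpos : 0 ≤ ‖y‖ ^ (-(b + 2)) := by positivity
  have hn := Complex.norm_le_abs_re_add_abs_im y
  rcases le_total (‖y‖ / 2) |y.re| with h | h
  · refine (key 1 C hC0 hC y hy (by simpa using h)).trans ?_
    gcongr
    exact le_max_left _ _
  · refine (key Complex.I C' hC0' hC' y hy ?_).trans ?_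
    · rw [Complex.I_mul_re, abs_neg]
      linarith
    · gcongr
      exact le_max_right _ _

theorem complex_hankel_of_schwartzRho (s : ℂ) (hs : s.re ≤ 1 / 2) (φ : ℂ → ℂ)
    (hφ : φ ∈ complexData.schwartzRho s) : (∃ h, complexData.IsHankelTransform s φ h) ∧
      ∀ (h : ℂ → ℂ) (χ : ℂˣ →ₜ* Circle), complexData.IsHankelTransform s φ h →
        complexData.MellinIdentity s φ χ h := by
  refine complexData_isTate.hankel_of_schwartzRho ?_ s hs φ hφ
  rintro _ ⟨g, rfl⟩ β hβ
  have hre : (2 * β).re = 2 * β.re := by simp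
  -- Orders are measured in `‖x‖` while `|x| = ‖x‖²`, so the order doubles; the resulting `‖y‖^{-2 -
  -- 2 Re β}` is `|y|^{-1 - Re β}`.
  obtain ⟨C, hC⟩ := complexData_fourier_symbol_le (b := 2 * β.re) (by positivity)
    (complexData_isLocal.integrable_abs_cpow_mul
      (rapidDecay_schwartz g) g.continuous.aestronglyMeasurable hβ.le) fun v k => by
    have h := (IsSymbol.norm_cpow v k (2 * β)).mul (IsSymbol.schwartz v k 0 g)
    rw [Nat.cast_zero, neg_zero, add_zero, hre] at h
    simp only [← ofReal_sq_cpow (norm_nonneg _)] at h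
    exact h
  refine ⟨C, fun y hy => (hC y hy).trans_eq ?_⟩
  change _ = C * (‖y‖ ^ 2) ^ _
  rw [← Real.rpow_natCast ‖y‖ 2, ← Real.rpow_mul (norm_nonneg y)]
  push_cast
  ring_nf

end complexPlace

end HankelGL1

end

/-- The local functional equation for the Hankel transform over `ℝ`, over `ℂ`, and over every
nonarchimedean local field; the last conjunct treats, over `ℝ`, the larger space built from
functions that are Schwartz on each side of `0` separately, where `H_s φ` is always defined for
`Re s > 1/4`, while for `Re s ≤ 1/4` it is defined for some `φ` only. -/
theorem mainTheorem5 :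
    (∀ s : ℂ, s.re ≤ 1 / 2 →
      ∀ φ ∈ HankelGL1.realData.schwartzRho s,
        (∃ h, HankelGL1.realData.IsHankelTransform s φ h) ∧
        ∀ (h : ℝ → ℂ) (χ : ℝˣ →ₜ* Circle), HankelGL1.realData.IsHankelTransform s φ h →
          HankelGL1.realData.MellinIdentity s φ χ h) ∧
    (∀ s : ℂ, s.re ≤ 1 / 2 →
      ∀ φ ∈ HankelGL1.complexData.schwartzRho s,
        (∃ h, HankelGL1.complexData.IsHankelTransform s φ h) ∧
        ∀ (h : ℂ → ℂ) (χ : ℂˣ →ₜ* Circle), HankelGL1.complexData.IsHankelTransform s φ h →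
          HankelGL1.complexData.MellinIdentity s φ χ h) ∧
    (∀ (K : Type*) [NontriviallyNormedField K] [IsUltrametricDist K] [ProperSpace K]
      [MeasurableSpace K] [BorelSpace K]
      (ϖ : Kˣ) (_ : HankelGL1.IsNormalizedUniformizer ϖ)
      (ψ : AddChar K Circle) (_ : Continuous ψ) (_ : ψ ≠ 1)
      (vol : MeasureTheory.Measure K) [vol.IsAddHaarMeasure]
      (_ : vol (Metric.closedBall 0 1) =
        ENNReal.ofReal ((HankelGL1.resCard K : ℝ) ^ (-(HankelGL1.addConductor ψ : ℝ) / 2))),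
      ∀ s : ℂ, s.re ≤ 1 / 2 →
      ∀ φ ∈ (HankelGL1.nonarchData ϖ ψ vol).schwartzRho s,
        (∃ h, (HankelGL1.nonarchData ϖ ψ vol).IsHankelTransform s φ h) ∧
        ∀ (h : K → ℂ) (χ : Kˣ →ₜ* Circle),
          (HankelGL1.nonarchData ϖ ψ vol).IsHankelTransform s φ h →
          (HankelGL1.nonarchData ϖ ψ vol).MellinIdentity s φ χ h) ∧
    (∀ s : ℂ, s.re ≤ 1 / 2 →
      ∀ φ ∈ HankelGL1.realData.rhoSpace HankelGL1.realTwoSidedSchwartz s,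
        (1 / 4 < s.re → ∃ h, HankelGL1.realData.IsHankelTransform s φ h) ∧
        ∀ (h : ℝ → ℂ) (χ : ℝˣ →ₜ* Circle), HankelGL1.realData.IsHankelTransform s φ h →
          HankelGL1.realData.MellinIdentity s φ χ h) := by
  refine ⟨HankelGL1.real_hankel_of_schwartzRho, HankelGL1.complex_hankel_of_schwartzRho, ?_,
    HankelGL1.real_hankel_of_twoSided⟩
  intro K _ _ _ _ _ ϖ hϖ ψ hψ hψ1 vol _ hvol s hs φ hφ
  have h : HankelGL1.IsNonarchSetup ϖ ψ vol := ⟨hϖ, hψ, hψ1, inferInstance, hvol⟩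
  exact h.isTate.hankel_of_schwartzRho (fun f hf β hβ => h.fourier_abs_cpow_mul_le hf hβ) s hs φ hφ
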